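/- **Setting.** There are $\mathcal T$ periods $t=1,\dots,\mathcal T$ and units $i$ with binary treatments $D_{it}$. Assume staggered adoption ($D_{i,t-1}=1\Rightarrow D_{it}=1$) and that no unit is treated in period 1. The group $G_i$ is the first treated period of unit $i$ ($\infty$ if never treated), $Y_{it}(g)$ is the potential outcome in group $g$, $Y_{it}(0):=Y_{it}(\infty)$, and $Y_{it}=Y_{it}(G_i)$ is observed. Assume: 1. (no anticipation) $Y_{it}=Y_{it}(0)$ for $t<G_i$; 2. (sampling) the vectors $(Y_{i1},\dots,Y_{i\mathcal T},G_i)$ are iid over $i$, and $\mathbb E[Y_t^4]<\infty$ for all $t$; 3. (interactive fixed effects) $Y_{it}(0)=\theta_t+\eta_i+\lambda_i'F_t+e_{it}$ with nonrandom $\theta_t\in\mathbb R$, $F_t\in\mathbb R^R$, random $\eta_i\in\mathbb R$, integrable $\lambda_i\in\mathbb R^R$, and integrable idiosyncratic errors, $\mathbb E[e_t\mid\eta,\lambda]=0$; 4. (unconfoundedness) $Y_t(0)$ is integrable and $\mathbb E[Y_t(0)\mid\eta,\lambda,G]=\mathbb E[Y_t(0)\mid\eta,\lambda]$ a.s. Let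 $p_g=P(G=g)$, $\mathcal G=\{g\in\{2,\dots,\mathcal T,\infty\}:p_g>0\}$, $\mathcal G^{comp}(t)=\{g'\in\mathcal G:g'>t\}$, and let $t^{max}$ be the largest $t\le\mathcal T$ with $|\mathcal G^{comp}(t)|\ge R+1$. Let $\mathcal P$ be the set of pairs $(g,t)$ with $g\in\mathcal G$ and $R+2\le g\le t\le t^{max}$. For $(g,t)\in\mathcal P$ write $\Delta y^{pre}=(\Delta y_2,\dots,\Delta y_{g-1})'$, let $\mathbf{\Delta F}^{pre}$ be the matrix with rows $\Delta F_2',\dots,\Delta F_{g-1}'$, put $\ell_i=(1\{G_i=g'\}/p_{g'})_{g'\in\mathcal G^{comp}(t)}$, and assume $$\operatorname{rank}\mathbf{\Delta F}^{pre}=R,\qquad \operatorname{rank}\,\mathbb E[\ell\,(1,\lambda')]=R+1 .$$ Let $\Omega=\Omega(g,t)$ be a $(g-2)\times R$ matrix of rank $R$ with $\operatorname{rank}(\Omega'\mathbf{\Delta F}^{pre})=\operatorname{rank}\mathbf{\Delta F}^{pre}$, and $W=W(g,t)$ a positive definite matrix. Let $\widehat\Omega,\widehat W$ be functions of the first $n$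 observations converging in probability to $\Omega,W$ (a known $\Omega$ is the case $\widehat\Omega=\Omega$). **Population quantities.** For $(g,t)\in\mathcal P$ let $x_i=(1,(\Omega'\Delta Y_i^{pre})')'$, $A_i=1\{G_i=g\}x_i$, $\Gamma=\mathbb E[\ell x']$, $B=(\Gamma'W\Gamma)^{-1}\Gamma'W$, $H=(\Omega'\mathbf{\Delta F}^{pre})^{-1}\Omega'$, $ATT(g,t)=\mathbb E[Y_t(g)-Y_t(0)\mid G=g]$, $$\theta^*=(\theta_t-\theta_{g-1})-(F_t-F_{g-1})'H\Delta\theta^{pre},\quad F^{*\prime}=(F_t-F_{g-1})'(\Omega'\mathbf{\Delta F}^{pre})^{-1},\quad \delta^*=(\theta^*,F^{*\prime})',$$ $$v_i=(e_{it}-e_{i,g-1})-(F_t-F_{g-1})'H\Delta e_i^{pre},\qquad d_i=1\{G_i=g\}(Y_{it}-Y_{i,g-1}),$$ $$\psi_{igt}=\frac{d_i-\mathbb E[d]}{p_g}-\frac{\mathbb E[A]'}{p_g}B\,\ell_iv_i-\frac{\delta^{*\prime}}{p_g}(A_i-\mathbb E[A])-\frac{ATT(g,t)}{p_g}(1\{G_i=g\}-p_g),$$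 and $\Psi_i=(\psi_{igt})_{(g,t)\in\mathcal P}$. **Estimators.** $\mathbb E_n$ is the average over the $n$ sampled units, $\hat p_g=\mathbb E_n[1\{G_i=g\}]$, and $\hat x_i,\hat A_i$ are $x_i,A_i$ with $\widehat\Omega$ for $\Omega$. Let $\hat\ell_i$ be $\ell_i$ with denominators that are either all $p_{g'}$ or all $\hat p_{g'}$ (the result holds for both choices). Put $\widehat\Gamma=\mathbb E_n[\hat\ell_i\hat x_i']$, $\widehat B=(\widehat\Gamma'\widehat W\widehat\Gamma)^{-1}\widehat\Gamma'\widehat W$, $\hat\delta=\widehat B\,\mathbb E_n[\hat\ell_i(Y_{it}-Y_{i,g-1})]$, $$\widehat{ATT}(g,t)=\hat p_g^{-1}\{\mathbb E_n[d_i]-\mathbb E_n[\hat A_i]'\hat\delta\},\qquad \hat v_i=(Y_{it}-Y_{i,g-1})-\hat x_i'\hat\delta .$$ Let $\widehat\Psi_i$ be the vector with entries $$\hat\psi_{igt}=\frac{d_i-\mathbb E_n[d]}{\hat p_g}-\frac{\mathbb E_n[\hat A]'}{\hat p_g}\widehat B\,\hat\ell_i\hat v_i-\frac{\hat\delta'}{\hat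 p_g}(\hat A_i-\mathbb E_n[\hat A])-\frac{\widehat{ATT}(g,t)}{\hat p_g}(1\{G_i=g\}-\hat p_g).$$ Undefined inverses, which occur with probability tending to zero, get a conventional value. **Multiplier bootstrap.** Let $\zeta_1,\zeta_2,\dots$ be iid with mean zero, unit variance and finite third absolute moment, independent of the observed data, and let $$\widehat{ATT}^{*}=\widehat{ATT}+\frac1n\sum_{i=1}^n\zeta_i\widehat\Psi_i .$$ **Corollary.** $\mathbb E\|\Psi\|^2<\infty$, and, conditionally on the data, $\sqrt n(\widehat{ATT}^{*}-\widehat{ATT})$ converges in bootstrap distribution to $N(0,\mathbb E[\Psi\Psi'])$: for every bounded continuous $h:\mathbb R^{\mathcal P}\to\mathbb R$, $$\mathbb E\big[h\big(\sqrt n(\widehat{ATT}^{*}-\widehat{ATT})\big)\,\big|\,(Y_{i1},\dots,Y_{i\mathcal T},G_i)_{i\le n}\big]\ \xrightarrow{\;p\;}\ \mathbb E[h(Z)],\qquad Z\sim N(0,\mathbb E[\Psi\Psi']).$$ This is also the limit distribution of the estimator: $\sqrt n(\widehat{ATT}-ATT)\xrightarrow{d}N(0,\mathbb E[\Psi\Psi'])$,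 where $ATT=(ATT(g,t))_{(g,t)\in\mathcal P}$. -/

import Mathlib

open MeasureTheory ProbabilityTheory Filter Topology
open scoped Matrix ENNReal BoundedContinuousFunction

/-- The random elements of a staggered-adoption panel with `T` periods (numbered `1, …, T`)
and `R` interactive fixed effects. Units are indexed by `i : ℕ`, and a sample of size `n`
consists of the units `i < n`. A group is an element of `ℕ∞`: the period of first treatment, or
`⊤` for never treated. The time effects `θ` and the factors `F` are nonrandom. -/
structure StaggeredPanel (Ω : Type*) [MeasurableSpace Ω] (T R : ℕ) where
  /-- treatment status `D_{it}` -/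
  D : ℕ → ℕ → Ω → Bool
  /-- potential outcome `Y_{it}(g)` of unit `i` in period `t` if it were in group `g` -/
  Ypot : ℕ → ℕ → ℕ∞ → Ω → ℝ
  /-- unit fixed effect `η_i` -/
  eta : ℕ → Ω → ℝ
  /-- factor loadings `λ_i` -/
  lam : ℕ → Ω → Fin R → ℝ
  /-- idiosyncratic error `e_{it}` -/
  e : ℕ → ℕ → Ω → ℝ
  /-- time fixed effect `θ_t` -/
  theta : ℕ → ℝ
  /-- factors `F_t` -/
  F : ℕ → Fin R → ℝ
  measurable_D : ∀ i t, Measurable (D i t)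
  measurable_Ypot : ∀ i t g, Measurable (Ypot i t g)
  measurable_eta : ∀ i, Measurable (eta i)
  measurable_lam : ∀ i, Measurable (lam i)
  measurable_e : ∀ i t, Measurable (e i t)

/-- Sample average `E_n` over the units `i < n`. -/
noncomputable def sampleMean (n : ℕ) (f : ℕ → ℝ) : ℝ :=
  (n : ℝ)⁻¹ * ∑ i ∈ Finset.range n, f i

/-- `ΔY^{pre(g)} = (ΔY_2, …, ΔY_{g-1})` for an outcome path `y` (also used for `θ` and `e`). -/
def preDiff (g : ℕ) (y : ℕ → ℝ) : Fin (g - 2) → ℝ :=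
  fun j => y (j + 2) - y (j + 1)

/-- The regressor vector `(1, (Om' ΔY^{pre(g)})')'`. -/
noncomputable def regressor {R : ℕ} (g : ℕ) (Om : Matrix (Fin (g - 2)) (Fin R) ℝ) (y : ℕ → ℝ) :
    Fin (R + 1) → ℝ :=
  Fin.cons 1 (Omᵀ *ᵥ preDiff g y)

/-- The indicator `1{γ = g}` as a real number. -/
noncomputable def groupInd (γ g : ℕ∞) : ℝ := if γ = g then 1 else 0

/-- `A(g) = 1{γ = g} (1, (Om' ΔY^{pre(g)})')'` for a unit with group `γ` and outcome path `y`. -/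
noncomputable def regA {R : ℕ} (g : ℕ) (Om : Matrix (Fin (g - 2)) (Fin R) ℝ) (γ : ℕ∞)
    (y : ℕ → ℝ) : Fin (R + 1) → ℝ :=
  fun k => groupInd γ g * regressor g Om y k

/-- `(Γ' W Γ)⁻¹ Γ' W`. -/
noncomputable def gmmMatrix {c : Type*} [Fintype c] {k : ℕ} (Gam : Matrix c (Fin k) ℝ)
    (W : Matrix c c ℝ) : Matrix (Fin k) c ℝ :=
  (Gamᵀ * W * Gam)⁻¹ * Gamᵀ * W

/-- Entrywise convergence in probability of random matrices to a constant matrix. -/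
def MatrixTendstoInProb {Ω : Type*} [MeasurableSpace Ω] (μ : Measure Ω) {a b : Type*}
    (X : ℕ → Ω → Matrix a b ℝ) (X₀ : Matrix a b ℝ) : Prop :=
  ∀ j k, TendstoInMeasure μ (fun n ω => X n ω j k) atTop (fun _ => X₀ j k)

/-- Convergence in bootstrap distribution: given the data `𝒟 n`, the conditional law of `Z n`
converges weakly to `ν`, in probability. -/
def TendstoInBootstrapDistribution {Ω E : Type*} [MeasurableSpace Ω] [TopologicalSpace E]
    [MeasurableSpace E] (μ : Measure Ω) (𝒟 : ℕ → MeasurableSpace Ω) (Z : ℕ → Ω → E)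
    (ν : Measure E) : Prop :=
  ∀ h : E →ᵇ ℝ, TendstoInMeasure μ (fun n => μ[fun ω => h (Z n ω) | 𝒟 n]) atTop
    (fun _ => ∫ x, h x ∂ν)

namespace StaggeredPanel

variable {Ω : Type*} [MeasurableSpace Ω] {T R : ℕ} (M : StaggeredPanel Ω T R) (μ : Measure Ω)

/-! ### Observed data -/

/-- The group `G_i`: the first period in which unit `i` is treated, `⊤` if there is none. -/
noncomputable def G (i : ℕ) (ω : Ω) : ℕ∞ :=
  ((Finset.Icc 1 T).filter fun t => M.D i t ω = true).inf fun t => (t : ℕ∞)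

/-- The untreated potential outcome `Y_{it}(0)`: the outcome if never treated. -/
def Y0 (i t : ℕ) (ω : Ω) : ℝ := M.Ypot i t ⊤ ω

/-- The observed outcome `Y_{it} = Y_{it}(G_i)`. -/
noncomputable def Y (i t : ℕ) (ω : Ω) : ℝ := M.Ypot i t (M.G i ω) ω

/-- The observed outcome path of unit `i`. -/
noncomputable def path (i : ℕ) (ω : Ω) : ℕ → ℝ := fun t => M.Y i t ω

/-- The observation `(Y_{i1}, …, Y_{iT}, G_i)`. -/
noncomputable def obs (i : ℕ) (ω : Ω) : (Finset.Icc 1 T → ℝ) × ℕ∞ :=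
  (fun t => M.Y i t ω, M.G i ω)

/-- The sigma-algebra generated by the data of the units `i < n`. -/
noncomputable abbrev data (n : ℕ) : MeasurableSpace Ω :=
  MeasurableSpace.comap (fun ω (i : Fin n) => M.obs i ω) inferInstance

/-! ### Groups. Population quantities are those of unit `0`. -/

/-- `p_g = P(G = g)`. -/
noncomputable def p (g : ℕ∞) : ℝ := μ.real {ω | M.G 0 ω = g}

open Classical in
/-- The set `𝒢 ⊆ {2, …, T, ∞}` of groups that occur. -/
noncomputable def groups : Finset ℕ∞ :=
  (insert ⊤ ((Finset.Icc 2 T).image fun t : ℕ => (t : ℕ∞))).filter fun g => 0 < M.p μ g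

/-- `𝒢^comp(g,t) = {g' ∈ 𝒢 : t < g'}` (it does not depend on `g`). -/
noncomputable def comp (t : ℕ) : Finset ℕ∞ := (M.groups μ).filter fun g' => (t : ℕ∞) < g'

/-- `t^max(g)`: the largest period `t` with `|𝒢^comp(g,t)| ≥ R + 1` (it does not depend on `g`,
and is set to `0` if there is no such period). -/
noncomputable def tMax : ℕ :=
  ((Finset.Icc 1 T).filter fun t => R + 1 ≤ (M.comp μ t).card).sup id

open Classical in
/-- The pairs `(g,t)` with `g ∈ 𝒢†`, that is `g ∈ 𝒢` and `R + 2 ≤ g ≤ t^max(g)`, and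
`g ≤ t ≤ t^max(g)`. -/
noncomputable def pairs : Finset (ℕ × ℕ) :=
  (Finset.Icc 1 T ×ˢ Finset.Icc 1 T).filter fun gt =>
    (gt.1 : ℕ∞) ∈ M.groups μ ∧ R + 2 ≤ gt.1 ∧ gt.1 ≤ M.tMax μ ∧ gt.1 ≤ gt.2 ∧ gt.2 ≤ M.tMax μ

/-! ### Assumptions -/

/-- Staggered adoption: treated units stay treated. -/
def StaggeredAdoption : Prop :=
  ∀ i, ∀ t ∈ Finset.Icc 2 T, ∀ᵐ ω ∂μ, M.D i (t - 1) ω = true → M.D i t ω = true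

/-- Units treated in the first period have been dropped. -/
def NoneTreatedInitially : Prop := ∀ i, ∀ᵐ ω ∂μ, M.D i 1 ω = false

/-- No anticipation. -/
def NoAnticipation : Prop :=
  ∀ i, ∀ t ∈ Finset.Icc 1 T, ∀ᵐ ω ∂μ, (t : ℕ∞) < M.G i ω → M.Y i t ω = M.Y0 i t ω

/-- The observed data are iid across units. -/
def IIDSampling : Prop :=
  iIndepFun M.obs μ ∧ ∀ i, IdentDistrib (M.obs i) (M.obs 0) μ μ

/-- The interactive fixed effects model `Y_{it}(0) = θ_t + η_i + λ_i' F_t + e_{it}`. -/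
def InteractiveFixedEffects : Prop :=
  ∀ i, ∀ t ∈ Finset.Icc 1 T, ∀ᵐ ω ∂μ,
    M.Y0 i t ω = M.theta t + M.eta i ω + M.lam i ω ⬝ᵥ M.F t + M.e i t ω

/-- The sigma-algebra generated by `(η_i, λ_i)`. -/
abbrev sigmaHet (i : ℕ) : MeasurableSpace Ω :=
  MeasurableSpace.comap (fun ω => (M.eta i ω, M.lam i ω)) inferInstance

/-- The sigma-algebra generated by `(η_i, λ_i, G_i)`. -/
noncomputable abbrev sigmaHetGroup (i : ℕ) : MeasurableSpace Ω :=
  MeasurableSpace.comap (fun ω => (M.eta i ω, M.lam i ω, M.G i ω)) inferInstance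

/-- The errors are idiosyncratic: `E[e_t | η, λ] = 0`. -/
def IdiosyncraticErrors : Prop :=
  ∀ i, ∀ t ∈ Finset.Icc 1 T, Integrable (M.e i t) μ ∧ μ[M.e i t | M.sigmaHet i] =ᵐ[μ] 0

/-- Unconfoundedness given the unobserved heterogeneity:
`E[Y_t(0) | η, λ, G] = E[Y_t(0) | η, λ]`. -/
def Unconfounded : Prop :=
  ∀ i, ∀ t ∈ Finset.Icc 1 T, Integrable (M.Y0 i t) μ ∧
    μ[M.Y0 i t | M.sigmaHetGroup i] =ᵐ[μ] μ[M.Y0 i t | M.sigmaHet i]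

/-- `ΔF^{pre(g)}`, with rows `ΔF_2', …, ΔF_{g-1}'`. -/
def dFpre (g : ℕ) : Matrix (Fin (g - 2)) (Fin R) ℝ :=
  Matrix.of fun j r => M.F (j + 2) r - M.F (j + 1) r

/-- `ℓ^comp(g,t)` for a unit in group `γ`, with the probabilities `q` in the denominators. -/
noncomputable def ell (q : ℕ∞ → ℝ) (t : ℕ) (γ : ℕ∞) : M.comp μ t → ℝ :=
  fun g' => groupInd γ g' / q g'

/-- `Λ^comp(g,t) = E[ℓ^comp(g,t) (1, λ')]`. -/
noncomputable def LamComp (t : ℕ) : Matrix (M.comp μ t) (Fin (R + 1)) ℝ :=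
  Matrix.of fun g' k =>
    ∫ ω, M.ell μ (M.p μ) t (M.G 0 ω) g' * (Fin.cons 1 (M.lam 0 ω) : Fin (R + 1) → ℝ) k ∂μ

/-- Rank condition on the factors, for every `g ∈ 𝒢†`. -/
def FactorRank : Prop := ∀ gt ∈ M.pairs μ, (M.dFpre gt.1).rank = R

/-- Rank condition on the factor loadings, whose means are assumed to exist. -/
def LoadingRank : Prop :=
  Integrable (M.lam 0) μ ∧ ∀ gt ∈ M.pairs μ, (M.LamComp μ gt.2).rank = R + 1

/-! ### Population quantities -/

/-- `ATT(g,t) = E[Y_t(g) - Y_t(0) | G = g]`. -/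
noncomputable def ATT (g t : ℕ) : ℝ :=
  ∫ ω, (M.Ypot 0 t g ω - M.Y0 0 t ω) ∂(μ[|{ω | M.G 0 ω = g}])

variable {g : ℕ} (Om : Matrix (Fin (g - 2)) (Fin R) ℝ) (t : ℕ)

/-- `H^{pre(g)} = (Om' ΔF^{pre(g)})⁻¹ Om'`. -/
noncomputable def Hpre : Matrix (Fin R) (Fin (g - 2)) ℝ := (Omᵀ * M.dFpre g)⁻¹ * Omᵀ

/-- `θ*(g,t) = (θ_t - θ_{g-1}) - (F_t - F_{g-1})' H^{pre(g)} Δθ^{pre(g)}`. -/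
noncomputable def thetaStar : ℝ :=
  (M.theta t - M.theta (g - 1)) - (M.F t - M.F (g - 1)) ⬝ᵥ (M.Hpre Om *ᵥ preDiff g M.theta)

/-- `F*(g,t) = ((F_t - F_{g-1})' (Om' ΔF^{pre(g)})⁻¹)'`. -/
noncomputable def FStar : Fin R → ℝ := (M.F t - M.F (g - 1)) ᵥ* (Omᵀ * M.dFpre g)⁻¹

/-- `δ*(g,t) = (θ*(g,t), F*(g,t)')'`. -/
noncomputable def deltaStar : Fin (R + 1) → ℝ := Fin.cons (M.thetaStar Om t) (M.FStar Om t)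

/-- `v_i(g,t) = (e_{it} - e_{i,g-1}) - (F_t - F_{g-1})' H^{pre(g)} Δe_i^{pre(g)}`. -/
noncomputable def v (i : ℕ) (ω : Ω) : ℝ :=
  (M.e i t ω - M.e i (g - 1) ω) -
    (M.F t - M.F (g - 1)) ⬝ᵥ (M.Hpre Om *ᵥ preDiff g fun s => M.e i s ω)

/-- `Γ(g,t) = E[ℓ^comp(g,t) (1, (Om' ΔY^{pre(g)})')]`. -/
noncomputable def Gam : Matrix (M.comp μ t) (Fin (R + 1)) ℝ :=
  Matrix.of fun g' k =>
    ∫ ω, M.ell μ (M.p μ) t (M.G 0 ω) g' * regressor g Om (M.path 0 ω) k ∂μ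

/-- `E[A(g)]`. -/
noncomputable def meanA : Fin (R + 1) → ℝ :=
  fun k => ∫ ω, regA g Om (M.G 0 ω) (M.path 0 ω) k ∂μ

/-- The outcome change `1{G_i = g} (Y_{it} - Y_{i,g-1})`. -/
noncomputable def dY (g t i : ℕ) (ω : Ω) : ℝ :=
  groupInd (M.G i ω) g * (M.Y i t ω - M.Y i (g - 1) ω)

/-- The influence function `ψ_{igt} = ψ⁽¹⁾ + ψ⁽²⁾ + ψ⁽³⁾ + ψ⁽⁴⁾`. -/
noncomputable def psi (W : Matrix (M.comp μ t) (M.comp μ t) ℝ) (i : ℕ) (ω : Ω) : ℝ :=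
  (M.dY g t i ω - ∫ ω', M.dY g t 0 ω' ∂μ) / M.p μ g
  + -(((M.p μ g)⁻¹ • M.meanA μ Om) ⬝ᵥ
      (gmmMatrix (M.Gam μ Om t) W *ᵥ (M.v Om t i ω • M.ell μ (M.p μ) t (M.G i ω))))
  + -(((M.p μ g)⁻¹ • M.deltaStar Om t) ⬝ᵥ (regA g Om (M.G i ω) (M.path i ω) - M.meanA μ Om))
  + -(M.ATT μ g t / M.p μ g * (groupInd (M.G i ω) g - M.p μ g))

/-! ### Estimators. `q` gives the probabilities in the denominators of `ℓ^comp`. -/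

/-- `p̂_g = E_n[1{G_i = g}]`. -/
noncomputable def phat (n : ℕ) (ω : Ω) (g : ℕ∞) : ℝ :=
  sampleMean n fun i => groupInd (M.G i ω) g

variable (q : ℕ∞ → ℝ) (W : Matrix (M.comp μ t) (M.comp μ t) ℝ) (n : ℕ) (ω : Ω)

/-- `Γ̂(g,t) = E_n[ℓ_i^comp(g,t) (1, (Om' ΔY_i^{pre(g)})')]`. -/
noncomputable def GamHat : Matrix (M.comp μ t) (Fin (R + 1)) ℝ :=
  Matrix.of fun g' k =>
    sampleMean n fun i => M.ell μ q t (M.G i ω) g' * regressor g Om (M.path i ω) k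

/-- `δ̂*(g,t) = (Γ̂' W Γ̂)⁻¹ Γ̂' W E_n[ℓ_i^comp(g,t) (Y_{it} - Y_{i,g-1})]`. -/
noncomputable def deltaHat : Fin (R + 1) → ℝ :=
  gmmMatrix (M.GamHat μ Om t q n ω) W *ᵥ fun g' =>
    sampleMean n fun i => M.ell μ q t (M.G i ω) g' * (M.Y i t ω - M.Y i (g - 1) ω)

/-- `E_n[A_i(g)]`. -/
noncomputable def meanAHat : Fin (R + 1) → ℝ :=
  fun k => sampleMean n fun i => regA g Om (M.G i ω) (M.path i ω) k

/-- The estimator of `ATT(g,t)`: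
`p̂_g⁻¹ {E_n[1{G_i = g} (Y_{it} - Y_{i,g-1})] - E_n[A_i(g)]' δ̂*(g,t)}`. -/
noncomputable def ATTHat : ℝ :=
  (M.phat n ω g)⁻¹ *
    ((sampleMean n fun i => M.dY g t i ω) - M.meanAHat Om n ω ⬝ᵥ M.deltaHat μ Om t q W n ω)

/-- The residual `v̂_i(g,t) = (Y_{it} - Y_{i,g-1}) - (1, (Om' ΔY_i^{pre(g)})') δ̂*(g,t)`. -/
noncomputable def vHat (i : ℕ) : ℝ :=
  (M.Y i t ω - M.Y i (g - 1) ω) - regressor g Om (M.path i ω) ⬝ᵥ M.deltaHat μ Om t q W n ω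

/-- The estimated influence function: `ψ_{igt}` with population parameters replaced by their
estimates. -/
noncomputable def psiHat (i : ℕ) : ℝ :=
  (M.dY g t i ω - sampleMean n fun j => M.dY g t j ω) / M.phat n ω g
  + -(((M.phat n ω g)⁻¹ • M.meanAHat Om n ω) ⬝ᵥ
      (gmmMatrix (M.GamHat μ Om t q n ω) W *ᵥ
        (M.vHat μ Om t q W n ω i • M.ell μ q t (M.G i ω))))
  + -(((M.phat n ω g)⁻¹ • M.deltaHat μ Om t q W n ω) ⬝ᵥ
      (regA g Om (M.G i ω) (M.path i ω) - M.meanAHat Om n ω))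
  + -(M.ATTHat μ Om t q W n ω / M.phat n ω g * (groupInd (M.G i ω) g - M.phat n ω g))

end StaggeredPanel

namespace StaggeredPanel

/-! ### Vectors stacked over the identified pairs `(g,t)` -/

variable {Ω : Type*} [MeasurableSpace Ω] {T R : ℕ} (M : StaggeredPanel Ω T R) (μ : Measure Ω)

/-- `ATT`, stacked over the pairs `(g,t)`. -/
noncomputable def ATTVec : EuclideanSpace ℝ (M.pairs μ) :=
  WithLp.toLp 2 fun a => M.ATT μ a.1.1 a.1.2

/-- `Ψ_i`, the vector of the `ψ_{igt}`. -/
noncomputable def Psi (Om : (g t : ℕ) → Matrix (Fin (g - 2)) (Fin R) ℝ)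
    (W : (g t : ℕ) → Matrix (M.comp μ t) (M.comp μ t) ℝ) (i : ℕ) (ω : Ω) :
    EuclideanSpace ℝ (M.pairs μ) :=
  WithLp.toLp 2 fun a => M.psi μ (Om a.1.1 a.1.2) a.1.2 (W a.1.1 a.1.2) i ω

/-- `E[Ψ Ψ']`. -/
noncomputable def PsiCov (Om : (g t : ℕ) → Matrix (Fin (g - 2)) (Fin R) ℝ)
    (W : (g t : ℕ) → Matrix (M.comp μ t) (M.comp μ t) ℝ) :
    Matrix (M.pairs μ) (M.pairs μ) ℝ :=
  Matrix.of fun a b => ∫ ω, M.Psi μ Om W 0 ω a * M.Psi μ Om W 0 ω b ∂μ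

variable (OmHat : (g t n : ℕ) → Ω → Matrix (Fin (g - 2)) (Fin R) ℝ)
  (WHat : (g t n : ℕ) → Ω → Matrix (M.comp μ t) (M.comp μ t) ℝ) (q : ℕ → Ω → ℕ∞ → ℝ)

/-- The estimator of `ATT` from the units `i < n`. -/
noncomputable def ATTHatVec (n : ℕ) (ω : Ω) : EuclideanSpace ℝ (M.pairs μ) :=
  WithLp.toLp 2 fun a =>
    M.ATTHat μ (OmHat a.1.1 a.1.2 n ω) a.1.2 (q n ω) (WHat a.1.1 a.1.2 n ω) n ω

/-- The vector of estimated influence functions of unit `i`. -/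
noncomputable def PsiHat (n i : ℕ) (ω : Ω) : EuclideanSpace ℝ (M.pairs μ) :=
  WithLp.toLp 2 fun a =>
    M.psiHat μ (OmHat a.1.1 a.1.2 n ω) a.1.2 (q n ω) (WHat a.1.1 a.1.2 n ω) n ω i

/-- The multiplier bootstrap estimate `ATT̂ + n⁻¹ ∑ ζ_i Ψ̂_i`. -/
noncomputable def ATTBoot (ζ : ℕ → Ω → ℝ) (n : ℕ) (ω : Ω) : EuclideanSpace ℝ (M.pairs μ) :=
  M.ATTHatVec μ OmHat WHat q n ω +
    (n : ℝ)⁻¹ • ∑ i ∈ Finset.range n, ζ i ω • M.PsiHat μ OmHat WHat q n i ω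

end StaggeredPanel

/-! Identification. First differences remove `η`, and `H ΔF^pre = 1` turns `H Δy^pre` into the
loadings plus terms in `θ` and `e`. Hence, in any group first treated at `g` or later, `Y_t(0) -
Y_{g-1}` equals `x'δ* + v`. Unconfoundedness gives the errors, and so `v`, mean zero within every
group (`integral_groupInd_mul_e`). Groups untreated at `t` therefore satisfy `E[ℓ (Y_t - Y_{g-1})] =
Γ δ*`. The matrix `Γ` has full column rank because it is the loading matrix times an invertible
matrix (`mulVec_Gam_injective`). Group `g` then yields `E[d] - E[A]'δ* = p_g ATT`.

Linearization. These moment conditions hold at every `Ω` with `Ω'ΔF^pre` invertible, each with its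
own `δ*(Ω)`, while `ATT` does not depend on `Ω`. The estimation error is expanded by an exact
identity around `δ*(Ω̂)`. The result is a sample mean of terms whose expectation is zero when the
estimated coefficients are held fixed. So estimating `Ω` contributes nothing to first order, and
consistency without a rate is enough (`exists_plugIn_ATTHat`).

Plug-ins. Every random coefficient multiplies a fixed square-integrable function of the observation.
In a term `b_n U_i` with `b_n → c` in probability, replacing `b_n` by `c` changes the centred scaled
mean by `(b_n - c)` times `n^{-1/2} ∑ (U_i - E U)`, which is negligible by Chebyshev. The same bound
with `ζ_i U_i` in the sum serves the bootstrap. `PlugIn` packages the closure of such terms under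
addition and consistent coefficients, so no remainder has to be expanded by hand.

Observability. Only the observations are assumed iid, and `ψ` contains the unobserved `v`. But `v`
enters multiplied by `ℓ`, which vanishes outside the groups untreated at `t`, and there `v` is the
regression residual. Hence `ψ` is almost surely a function of the observation (`residPsi_ae_eq`),
and the central limit theorem applies.

Bootstrap. Let `S_n` be the scaled multiplier sum and `S_n'` its version with an independent copy of
the multipliers and the same data. The pair satisfies a joint central limit theorem, and its
cross-covariance vanishes because the multipliers are centred and independent, so the limit is `ν ⊗
ν`. Since `E[E[h(S_n) | data]²] = E[h(S_n) h(S_n')]`, the conditional expectation has mean tending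
to `∫ h dν` and variance tending to zero (`tendstoInBootstrapDistribution_of_multiplier`). -/

/-! ### Independence of pairs -/

/-- If `X` and `Y` are families of independent random elements and the two families are independent
of each other, the pairs `(X i, Y i)` are independent. -/
theorem ProbabilityTheory.iIndepFun.prodMk_of_indepFun {Ω ι : Type*} [MeasurableSpace Ω]
    {μ : Measure Ω} [IsProbabilityMeasure μ] {α β : ι → Type*} [∀ i, MeasurableSpace (α i)]
    [∀ i, MeasurableSpace (β i)] {X : ∀ i, Ω → α i} {Y : ∀ i, Ω → β i}
    (mX : ∀ i, Measurable (X i)) (mY : ∀ i, Measurable (Y i))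
    (hX : iIndepFun X μ) (hY : iIndepFun Y μ)
    (hXY : IndepFun (fun ω i => X i ω) (fun ω i => Y i ω) μ) :
    iIndepFun (fun i ω => (X i ω, Y i ω)) μ := by
  classical
  -- Preimages of measurable rectangles form a π-system generating the sigma-algebra of `(X i, Y
  -- i)`, so the product formula is needed only for them.
  have key : iIndepSets (fun i => {s | ∃ A B, MeasurableSet A ∧ MeasurableSet B ∧
      s = X i ⁻¹' A ∩ Y i ⁻¹' B}) μ := by
    rw [iIndepSets_iff]
    intro S f hf
    choose! A B hA hB hAB using hf
    have h1 : (⋂ i ∈ S, f i) = (⋂ i ∈ S, X i ⁻¹' A i) ∩ ⋂ i ∈ S, Y i ⁻¹' B i := by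
      ext ω
      simp only [Set.mem_iInter, Set.mem_inter_iff]
      constructor
      · intro h
        exact ⟨fun i hi => by have := h i hi; rw [hAB i hi] at this; exact this.1,
          fun i hi => by have := h i hi; rw [hAB i hi] at this; exact this.2⟩
      · intro h i hi
        rw [hAB i hi]
        exact ⟨h.1 i hi, h.2 i hi⟩
    -- Independence of the whole families separates the `X` part from the `Y` part; independence
    -- within each family then factors the two parts.
    have h2 : μ ((⋂ i ∈ S, X i ⁻¹' A i) ∩ ⋂ i ∈ S, Y i ⁻¹' B i) =
        μ (⋂ i ∈ S, X i ⁻¹' A i) * μ (⋂ i ∈ S, Y i ⁻¹' B i) := by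
      have := hXY.measure_inter_preimage_eq_mul (⋂ i ∈ S, (fun x => x i) ⁻¹' A i)
        (⋂ i ∈ S, (fun x => x i) ⁻¹' B i)
        (Finset.measurableSet_biInter _ fun i hi => measurable_pi_apply i (hA i hi))
        (Finset.measurableSet_biInter _ fun i hi => measurable_pi_apply i (hB i hi))
      simp only [Set.preimage_iInter] at this
      exact this
    have h3 : ∀ i ∈ S, μ (f i) = μ (X i ⁻¹' A i) * μ (Y i ⁻¹' B i) := by
      intro i hi
      rw [hAB i hi]
      have := hXY.comp (measurable_pi_apply i) (measurable_pi_apply i)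
      exact this.measure_inter_preimage_eq_mul (A i) (B i) (hA i hi) (hB i hi)
    rw [h1, h2, hX.measure_inter_preimage_eq_mul S hA, hY.measure_inter_preimage_eq_mul S hB,
      Finset.prod_congr rfl h3, Finset.prod_mul_distrib]
  refine iIndepSets.iIndep (fun i => ((mX i).prodMk (mY i)).comap_le) _ ?_ ?_ key
  · rintro i _ ⟨A, B, hA, hB, rfl⟩ _ ⟨A', B', hA', hB', rfl⟩ -
    exact ⟨A ∩ A', B ∩ B', hA.inter hA', hB.inter hB', by
      rw [Set.preimage_inter, Set.preimage_inter, Set.inter_inter_inter_comm]⟩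
  · intro i
    change MeasurableSpace.comap (fun ω => (X i ω, Y i ω)) Prod.instMeasurableSpace = _
    rw [← generateFrom_prod, MeasurableSpace.comap_generateFrom]
    congr 1
    ext s
    simp only [Set.mem_image, Set.mem_image2, Set.mem_ofPred_eq]
    constructor
    · rintro ⟨_, ⟨A, hA, B, hB, rfl⟩, rfl⟩
      exact ⟨A, B, hA, hB, rfl⟩
    · rintro ⟨A, B, hA, hB, rfl⟩
      exact ⟨_, ⟨A, hA, B, hB, rfl⟩, rfl⟩

/-- Transports independence to either coordinate of the product space on which a second copy of the
multipliers is built. -/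
theorem ProbabilityTheory.iIndepFun.comp_measurePreserving {Ω Ω' ι : Type*} [MeasurableSpace Ω]
    [MeasurableSpace Ω'] {μ : Measure Ω} {ν : Measure Ω'} {α : ι → Type*}
    [∀ i, MeasurableSpace (α i)] {X : ∀ i, Ω → α i} (mX : ∀ i, Measurable (X i))
    (hX : iIndepFun X μ) {f : Ω' → Ω} (hf : MeasurePreserving f ν μ) :
    iIndepFun (fun i => X i ∘ f) ν := by
  rw [iIndepFun_iff_measure_inter_preimage_eq_mul] at hX ⊢
  intro S sets hs
  have h1 : (⋂ i ∈ S, (X i ∘ f) ⁻¹' sets i) = f ⁻¹' (⋂ i ∈ S, X i ⁻¹' sets i) := by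
    simp [Set.preimage_iInter, Set.preimage_comp]
  rw [h1, hf.measure_preimage (Finset.measurableSet_biInter _ fun i hi =>
    mX i (hs i hi)).nullMeasurableSet, hX S hs]
  refine Finset.prod_congr rfl fun i hi => ?_
  rw [Set.preimage_comp, hf.measure_preimage (mX i (hs i hi)).nullMeasurableSet]

/-! ### The multivariate central limit theorem -/

/-- Cramér–Wold: in each direction `t` the scalar central limit theorem applies to `⟨X i, t⟩`, and
Lévy's continuity theorem reassembles the directions. The limit is given through its characteristic
function, so that a product of two Gaussians on `E × E` is covered without choosing coordinates. -/
theorem tendstoInDistribution_inv_sqrt_smul_sum {Ω E : Type*} [MeasurableSpace Ω]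
    {μ : Measure Ω} [IsProbabilityMeasure μ] [NormedAddCommGroup E] [InnerProductSpace ℝ E]
    [FiniteDimensional ℝ E] [MeasurableSpace E] [BorelSpace E] {X : ℕ → Ω → E}
    (hindep : iIndepFun X μ) (hident : ∀ i, IdentDistrib (X i) (X 0) μ μ)
    (hL2 : MemLp (X 0) 2 μ) (hmean : ∀ t, ∫ ω, inner ℝ (X 0 ω) t ∂μ = 0)
    {ν : Measure E} [IsProbabilityMeasure ν]
    (hν : ∀ t, charFun ν t = Complex.exp (-((∫ ω, inner ℝ (X 0 ω) t ^ 2 ∂μ : ℝ) : ℂ) / 2)) :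
    TendstoInDistribution (fun (n : ℕ) ω => (√(n : ℝ))⁻¹ • ∑ i ∈ Finset.range n, X i ω)
      atTop id (fun _ => μ) ν where
  forall_aemeasurable n := by
    have := fun i => (hident i).aemeasurable_fst
    fun_prop
  tendsto := by
    refine ProbabilityMeasure.tendsto_iff_tendsto_charFun.2 fun t => ?_
    have mX := fun i => (hident i).aemeasurable_fst
    have hi : Measurable fun x : E => inner ℝ x t := by fun_prop
    have h0 := hmean t
    have hm : MemLp (fun ω => inner ℝ (X 0 ω) t) 2 μ := hL2.inner_const t
    have hvar : Var[fun ω => inner ℝ (X 0 ω) t; μ] = ∫ ω, inner ℝ (X 0 ω) t ^ 2 ∂μ := by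
      rw [variance_eq_sub hm, h0]
      simp
    have hclt := tendstoInDistribution_inv_sqrt_mul_sum_sub (P := μ)
      (P' := gaussianReal 0 (Var[fun ω => inner ℝ (X 0 ω) t; μ]).toNNReal)
      (X := fun i ω => inner ℝ (X i ω) t) (Y := id) HasLaw.id hm
      (hindep.comp (fun _ x => inner ℝ x t) fun _ => hi)
      fun i => (hident i).comp hi
    -- The characteristic function of the vector sum at `t` is that of the scalar sum of the `⟨X i,
    -- t⟩` at `1`.
    have := ProbabilityMeasure.tendsto_iff_tendsto_charFun.1 hclt.tendsto 1
    simp only [ProbabilityMeasure.coe_mk, h0, mul_zero, sub_zero, Measure.map_id,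
      charFun_gaussianReal] at this ⊢
    rw [hν t]
    convert this using 1
    · ext n
      rw [charFun_apply, charFun_apply, integral_map (by fun_prop) (by fun_prop),
        integral_map (by fun_prop) (by fun_prop)]
      simp [real_inner_smul_left, sum_inner]
    · rw [← hvar]
      simp [variance_nonneg, neg_div]

/-! ### Convergence in probability to a constant as convergence along a filter -/

/-- The filter on `ℕ × Ω` of events whose probability tends to one. -/
def probFilter {Ω : Type*} [MeasurableSpace Ω] (μ : Measure Ω) : Filter (ℕ × Ω) where
  sets := {S | Tendsto (fun n => μ {ω | (n, ω) ∉ S}) atTop (𝓝 0)}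
  univ_sets := by simp
  sets_of_superset {S S'} hS h := by
    refine tendsto_of_tendsto_of_tendsto_of_le_of_le tendsto_const_nhds hS (fun _ => zero_le) ?_
    exact fun n => measure_mono fun ω hω hω' => hω (h hω')
  inter_sets {S S'} hS hS' := by
    have : Tendsto (fun n => μ {ω | (n, ω) ∉ S} + μ {ω | (n, ω) ∉ S'}) atTop (𝓝 0) := by
      simpa using Tendsto.add hS hS'
    refine tendsto_of_tendsto_of_tendsto_of_le_of_le tendsto_const_nhds this (fun _ => zero_le) ?_
    intro n
    refine (measure_mono ?_).trans (measure_union_le _ _)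
    intro ω hω
    by_contra h
    simp only [Set.mem_union, Set.mem_ofPred_eq, not_or, not_not] at h
    exact hω h

section probFilter

variable {Ω : Type*} [MeasurableSpace Ω] {μ : Measure Ω}

theorem mem_probFilter {S : Set (ℕ × Ω)} :
    S ∈ probFilter μ ↔ Tendsto (fun n => μ {ω | (n, ω) ∉ S}) atTop (𝓝 0) := Iff.rfl

/-- With a constant limit, convergence in probability is convergence along one filter. Slutsky's
lemma and the continuous mapping theorem become the usual calculus of `Tendsto`, and "with
probability tending to one" becomes `∀ᶠ`. -/
theorem tendstoInMeasure_const_iff {E : Type*} [PseudoMetricSpace E] {X : ℕ → Ω → E} {c : E} :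
    TendstoInMeasure μ X atTop (fun _ => c) ↔
      Tendsto (fun p : ℕ × Ω => X p.1 p.2) (probFilter μ) (𝓝 c) := by
  rw [tendstoInMeasure_iff_dist, Metric.tendsto_nhds]
  simp only [Filter.Eventually, mem_probFilter, Set.mem_ofPred_eq, not_lt]

theorem eventually_probFilter_ge (N : ℕ) : ∀ᶠ q in probFilter μ, N ≤ q.1 := by
  rw [Filter.Eventually, mem_probFilter]
  refine tendsto_const_nhds.congr' ?_
  filter_upwards [eventually_ge_atTop N] with n hn
  simp [hn]

theorem tendstoInMeasure_zero_of_integral_abs [IsFiniteMeasure μ] {f : ℕ → Ω → ℝ}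
    (hf : ∀ n, Integrable (f n) μ) (h : Tendsto (fun n => ∫ ω, |f n ω| ∂μ) atTop (𝓝 0)) :
    TendstoInMeasure μ f atTop (fun _ => 0) := by
  refine tendstoInMeasure_of_tendsto_eLpNorm (p := 1) one_ne_zero
    (fun n => (hf n).aestronglyMeasurable) aestronglyMeasurable_const ?_
  have : ∀ n, eLpNorm (f n - fun _ => 0) 1 μ = ENNReal.ofReal (∫ ω, |f n ω| ∂μ) := by
    intro n
    rw [eLpNorm_one_eq_lintegral_enorm, ← ofReal_integral_norm_eq_lintegral_enorm (by
      simpa using (hf n).sub (integrable_const (0 : ℝ)))]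
    simp
  simp_rw [this]
  simpa using ENNReal.tendsto_ofReal h

/-- The strong law of large numbers, in probability. -/
theorem tendsto_sampleMean_probFilter [IsProbabilityMeasure μ] {U : ℕ → Ω → ℝ}
    (hint : Integrable (U 0) μ) (hindep : iIndepFun U μ)
    (hident : ∀ i, IdentDistrib (U i) (U 0) μ μ) :
    Tendsto (fun p : ℕ × Ω => sampleMean p.1 fun i => U i p.2) (probFilter μ)
      (𝓝 (∫ ω, U 0 ω ∂μ)) := by
  rw [← tendstoInMeasure_const_iff (X := fun n ω => sampleMean n fun i => U i ω)]
  have hm := fun i => (hident i).aemeasurable_fst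
  refine tendstoInMeasure_of_tendsto_ae (fun n => ?_) ?_
  · unfold sampleMean
    exact AEMeasurable.aestronglyMeasurable (by fun_prop)
  · filter_upwards [strong_law_ae U hint (fun i j hij => hindep.indepFun hij) hident] with ω hω
    simpa [sampleMean] using hω

/-- A variable that tends to zero in probability, times a scaled sum of centred iid variables,
tends to zero in probability. -/
theorem tendsto_mul_inv_sqrt_mul_sum_probFilter [IsProbabilityMeasure μ] {U : ℕ → Ω → ℝ}
    (hL2 : MemLp (U 0) 2 μ) (hmean : ∫ ω, U 0 ω ∂μ = 0) (hindep : iIndepFun U μ)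
    (hident : ∀ i, IdentDistrib (U i) (U 0) μ μ) {X : ℕ × Ω → ℝ}
    (hX : Tendsto X (probFilter μ) (𝓝 0)) :
    Tendsto (fun p : ℕ × Ω => X p * ((√(p.1 : ℝ))⁻¹ * ∑ i ∈ Finset.range p.1, U i p.2))
      (probFilter μ) (𝓝 0) := by
  set S : ℕ → Ω → ℝ := fun n ω => (√(n : ℝ))⁻¹ * ∑ i ∈ Finset.range n, U i ω with hS
  set V := Var[U 0; μ] with hV
  have hm : ∀ i, MemLp (U i) 2 μ := fun i => (hident i).memLp_iff.2 hL2
  have hSm : ∀ n, MemLp (S n) 2 μ := fun n =>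
    (memLp_finsetSum _ fun i _ => hm i).const_mul _
  have hS0 : ∀ n, ∫ ω, S n ω ∂μ = 0 := by
    intro n
    rw [hS, integral_const_mul, integral_finsetSum _ fun i _ => (hm i).integrable (by norm_num)]
    simp [(hident _).integral_eq, hmean]
  -- Equality holds for `n ≥ 1`; the inequality also covers `n = 0`, where the sum is empty.
  have hSv : ∀ n, Var[S n; μ] ≤ V := by
    intro n
    have h1 : S n = fun ω => (√(n : ℝ))⁻¹ * (∑ i ∈ Finset.range n, U i) ω := by
      ext ω; simp [hS]
    rw [h1, variance_const_mul, IndepFun.variance_sum (fun i _ => hm i)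
      fun i _ j _ hij => hindep.indepFun hij]
    simp_rw [(hident _).variance_eq]
    rcases Nat.eq_zero_or_pos n with rfl | hn
    · have : 0 ≤ V := variance_nonneg (U 0) μ
      simpa
    · have : (0 : ℝ) < n := by exact_mod_cast hn
      rw [Finset.sum_const, Finset.card_range, nsmul_eq_mul, inv_pow, Real.sq_sqrt this.le,
        inv_mul_cancel_left₀ this.ne']
  have hcheb : ∀ n, ∀ K : ℝ, 0 < K → μ {ω | K ≤ |S n ω|} ≤ ENNReal.ofReal (V / K ^ 2) := by
    intro n K hK
    have := meas_ge_le_variance_div_sq (hSm n) hK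
    simp only [hS0, sub_zero] at this
    exact this.trans (ENNReal.ofReal_le_ofReal (by gcongr; exact hSv n))
  rw [Metric.tendsto_nhds]
  intro ε hε
  rw [Filter.Eventually, mem_probFilter, ENNReal.tendsto_nhds_zero]
  intro δ hδ
  -- By Chebyshev, `K` bounds the scaled sum up to probability `δ / 2` for all `n` at once; it then
  -- suffices that the other factor is below `ε / K`.
  obtain ⟨K, hK, hKδ⟩ : ∃ K : ℝ, 0 < K ∧ ENNReal.ofReal (V / K ^ 2) ≤ δ / 2 := by
    have h1 : Tendsto (fun K : ℝ => ENNReal.ofReal (V / K ^ 2)) atTop (𝓝 0) := by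
      have : Tendsto (fun K : ℝ => V / K ^ 2) atTop (𝓝 0) :=
        tendsto_const_nhds.div_atTop (tendsto_pow_atTop two_ne_zero)
      simpa using ENNReal.tendsto_ofReal this
    have h2 := (ENNReal.tendsto_nhds_zero.1 h1) (δ / 2) (by simpa using hδ.ne')
    obtain ⟨K, h3, h4⟩ := (h2.and (eventually_gt_atTop 0)).exists
    exact ⟨K, h4, h3⟩
  have hXK := (Metric.tendsto_nhds.1 hX) (ε / K) (by positivity)
  rw [Filter.Eventually, mem_probFilter, ENNReal.tendsto_nhds_zero] at hXK
  filter_upwards [hXK (δ / 2) (by simpa using hδ.ne')] with n hn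
  calc _ ≤ μ ({ω | (n, ω) ∉ {x | dist (X x) 0 < ε / K}} ∪ {ω | K ≤ |S n ω|}) := by
        refine measure_mono fun ω hω => ?_
        by_contra h
        simp only [Set.mem_union, Set.mem_ofPred_eq, not_or, not_not, not_le, dist_zero_right,
          Real.norm_eq_abs] at h hω
        refine hω ?_
        rw [abs_mul]
        calc |X (n, ω)| * |S n ω| ≤ |X (n, ω)| * K := by gcongr; exact h.2.le
          _ < ε / K * K := by gcongr; exact h.1
          _ = ε := by field_simp
    _ ≤ _ := measure_union_le _ _
    _ ≤ δ / 2 + δ / 2 := add_le_add hn ((hcheb n K hK).trans hKδ)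
    _ = δ := ENNReal.add_halves δ

end probFilter

/-! ### Conditional expectations given one of two independent random elements -/

/-- Independence makes the conditional distribution of `Y` given `X` the constant kernel at the law
of `Y`, so conditioning on `X` freezes it and averages over `Y`. -/
theorem condExp_comap_prodMk_of_indepFun {Ω α β : Type*} [MeasurableSpace Ω]
    [mα : MeasurableSpace α] [MeasurableSpace β] [StandardBorelSpace β] [Nonempty β]
    {μ : Measure Ω} [IsProbabilityMeasure μ] {X : Ω → α} {Y : Ω → β} (hX : Measurable X)
    (hY : Measurable Y) (hXY : IndepFun X Y μ) {f : α × β → ℝ} (hf : StronglyMeasurable f)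
    (hint : Integrable (fun ω => f (X ω, Y ω)) μ) :
    μ[fun ω => f (X ω, Y ω) | mα.comap X] =ᵐ[μ] fun ω => ∫ ω', f (X ω, Y ω') ∂μ := by
  have h1 := condExp_prod_ae_eq_integral_condDistrib hX hY.aemeasurable hf hint
  have h2 : condDistrib Y X μ =ᵐ[μ.map X] Kernel.const α (μ.map Y) := by
    have := Measure.isProbabilityMeasure_map (μ := μ) hY.aemeasurable
    refine condDistrib_ae_eq_of_measure_eq_compProd X hY.aemeasurable ?_
    rw [(indepFun_iff_map_prod_eq_prod_map_map hX.aemeasurable hY.aemeasurable).1 hXY,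
      Measure.compProd_const]
  filter_upwards [h1, ae_of_ae_map hX.aemeasurable h2] with ω h1 h2
  rw [h1, h2, Kernel.const_apply, integral_map hY.aemeasurable]
  exact (hf.comp_measurable measurable_prodMk_left).aestronglyMeasurable

/-- One factor of the square may be replaced by the variable itself, and the other averages over a
fresh copy of `Y`. The second moment of a conditional expectation thus becomes an unconditional
expectation, which a joint limit theorem can evaluate. -/
theorem integral_condExp_comap_sq_of_indepFun {Ω α β : Type*} [MeasurableSpace Ω]
    [mα : MeasurableSpace α] [MeasurableSpace β] [StandardBorelSpace β] [Nonempty β]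
    {μ : Measure Ω} [IsProbabilityMeasure μ] {X : Ω → α} {Y : Ω → β} (hX : Measurable X)
    (hY : Measurable Y) (hXY : IndepFun X Y μ) {f : α × β → ℝ} (hf : StronglyMeasurable f)
    {C : ℝ} (hC : ∀ x, |f x| ≤ C) :
    ∫ ω, (μ[fun ω => f (X ω, Y ω) | mα.comap X]) ω ^ 2 ∂μ =
      ∫ p, f (X p.1, Y p.1) * f (X p.1, Y p.2) ∂(μ.prod μ) := by
  have hfm : Measurable f := hf.measurable
  have hint : Integrable (fun ω => f (X ω, Y ω)) μ :=
    .of_bound (hf.comp_measurable (hX.prodMk hY)).aestronglyMeasurable C (ae_of_all _ fun _ => hC _)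
  have hc := condExp_comap_prodMk_of_indepFun hX hY hXY hf hint
  set g := fun ω => f (X ω, Y ω) with hg
  set V := μ[g | mα.comap X] with hV
  have hVg : Integrable (V * g) μ := by
    refine Integrable.mul_bdd (c := C) integrable_condExp
      (hf.comp_measurable (hX.prodMk hY)).aestronglyMeasurable (ae_of_all _ fun _ => hC _)
  -- The factor `V` is measurable for the conditioning sigma-algebra, so `E[V g | X] = V²`.
  have h1 : ∫ ω, V ω ^ 2 ∂μ = ∫ ω, V ω * g ω ∂μ := by
    have h2 := condExp_mul_of_stronglyMeasurable_left (μ := μ) (m := mα.comap X) (f := V) (g := g)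
      stronglyMeasurable_condExp hVg hint
    calc ∫ ω, V ω ^ 2 ∂μ = ∫ ω, (μ[V * g | mα.comap X]) ω ∂μ := by
          refine integral_congr_ae ?_
          filter_upwards [h2] with ω hω
          rw [hω, Pi.mul_apply, sq]
      _ = _ := integral_condExp hX.comap_le
  have h3 : Integrable (fun p : Ω × Ω => f (X p.1, Y p.1) * f (X p.1, Y p.2)) (μ.prod μ) := by
    refine .of_bound (Measurable.aestronglyMeasurable (by fun_prop)) (C * C) (ae_of_all _ fun p => ?_)
    rw [norm_mul]
    exact mul_le_mul (hC _) (hC _) (norm_nonneg _) ((abs_nonneg _).trans (hC (X p.1, Y p.1)))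
  rw [h1, integral_prod _ h3]
  refine integral_congr_ae ?_
  filter_upwards [hc] with ω hω
  rw [hω, integral_const_mul, mul_comm]

/-! ### The multiplier bootstrap -/

section Multiplier

variable {Ω : Type*} [MeasurableSpace Ω] {μ : Measure Ω} [IsProbabilityMeasure μ]

/-- Independence factors the second moment of the product, so two moments of each factor suffice. -/
theorem ProbabilityTheory.IndepFun.memLp_two_smul {E : Type*} [NormedAddCommGroup E]
    [NormedSpace ℝ E] [MeasurableSpace E] [BorelSpace E] [SecondCountableTopology E]
    {ξ : Ω → ℝ} {U : Ω → E} (h : IndepFun ξ U μ) (hξ : MemLp ξ 2 μ) (hU : MemLp U 2 μ) :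
    MemLp (fun ω => ξ ω • U ω) 2 μ := by
  refine (memLp_two_iff_integrable_sq_norm (by exact hξ.1.smul hU.1)).2 ?_
  have h1 : IndepFun (fun ω => ξ ω ^ 2) (fun ω => ‖U ω‖ ^ 2) μ :=
    h.comp (φ := fun x => x ^ 2) (ψ := fun x => ‖x‖ ^ 2) (by fun_prop) (by fun_prop)
  have h2 := h1.integrable_mul ((memLp_two_iff_integrable_sq hξ.1).1 hξ)
    ((memLp_two_iff_integrable_sq_norm hU.1).1 hU)
  refine h2.congr (ae_of_all _ fun ω => ?_)
  simp [norm_smul, mul_pow]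

theorem TendstoInDistribution.tendsto_integral_comp {E : Type*} [TopologicalSpace E]
    [MeasurableSpace E] [OpensMeasurableSpace E] {Ω' : Type*} [MeasurableSpace Ω'] {ν : Measure Ω'}
    [IsProbabilityMeasure ν] {X : ℕ → Ω → E} {Z : Ω' → E}
    (h : TendstoInDistribution X atTop Z (fun _ => μ) ν) (f : E →ᵇ ℝ) :
    Tendsto (fun n => ∫ ω, f (X n ω) ∂μ) atTop (𝓝 (∫ ω, f (Z ω) ∂ν)) := by
  have := (ProbabilityMeasure.tendsto_iff_forall_integral_tendsto.1 h.tendsto) f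
  simp only [ProbabilityMeasure.coe_mk] at this
  rw [integral_map h.aemeasurable_limit f.continuous.measurable.aestronglyMeasurable] at this
  refine this.congr fun n => ?_
  rw [integral_map (h.forall_aemeasurable n) f.continuous.measurable.aestronglyMeasurable]

/-- Bounded continuous functions of two asymptotically equivalent sequences, one of which converges
in distribution, are close in mean. -/
theorem tendsto_integral_abs_sub_of_tendstoInMeasure_sub {E : Type*} [NormedAddCommGroup E]
    [SecondCountableTopology E] [MeasurableSpace E] [BorelSpace E] {ν : Measure E}
    [IsProbabilityMeasure ν] {X Y : ℕ → Ω → E}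
    (hX : TendstoInDistribution X atTop id (fun _ => μ) ν)
    (hY : ∀ n, AEMeasurable (Y n) μ)
    (hXY : TendstoInMeasure μ (fun n ω => Y n ω - X n ω) atTop (fun _ => 0)) (h : E →ᵇ ℝ) :
    Tendsto (fun n => ∫ ω, |h (Y n ω) - h (X n ω)| ∂μ) atTop (𝓝 0) := by
  have h1 := hX.prodMk_of_tendstoInMeasure_const X (fun n ω => Y n ω - X n ω) id hXY
    fun n => (hY n).sub (hX.forall_aemeasurable n)
  -- The test function `(x, d) ↦ |h (x + d) - h x|` is bounded and continuous and vanishes at `d =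
  -- 0`, while `(X n, Y n - X n)` converges jointly with second component zero.
  let F : E × E →ᵇ ℝ := BoundedContinuousFunction.ofNormedAddCommGroup
    (fun p => |h (p.1 + p.2) - h p.1|) (by fun_prop) (‖h‖ + ‖h‖) fun p => by
      rw [Real.norm_eq_abs, abs_abs]
      exact (abs_sub _ _).trans (add_le_add (h.norm_coe_le_norm _) (h.norm_coe_le_norm _))
  have h2 := TendstoInDistribution.tendsto_integral_comp h1 F
  simpa [F] using h2

/-- The conditional distribution, given the data, of a scaled sum with iid multipliers converges
weakly in probability to the Gaussian limit of the scaled sum, and so does that of any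
asymptotically equivalent sequence. -/
theorem tendstoInBootstrapDistribution_of_multiplier {O E : Type*} [MeasurableSpace O]
    [NormedAddCommGroup E] [InnerProductSpace ℝ E] [FiniteDimensional ℝ E] [MeasurableSpace E]
    [BorelSpace E] {X : ℕ → Ω → O} (mX : ∀ i, Measurable (X i)) (hX : iIndepFun X μ)
    (hXid : ∀ i, IdentDistrib (X i) (X 0) μ μ)
    {ζ : ℕ → Ω → ℝ} (mζ : ∀ i, Measurable (ζ i)) (hζ : iIndepFun ζ μ)
    (hζid : ∀ i, IdentDistrib (ζ i) (ζ 0) μ μ) (hζL2 : MemLp (ζ 0) 2 μ)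
    (hζmean : ∫ ω, ζ 0 ω ∂μ = 0) (hζvar : ∫ ω, ζ 0 ω ^ 2 ∂μ = 1)
    (hζX : IndepFun (fun ω i => ζ i ω) (fun ω i => X i ω) μ)
    {ψ : O → E} (mψ : Measurable ψ) (hψ : MemLp (fun ω => ψ (X 0 ω)) 2 μ)
    {ν : Measure E} [IsProbabilityMeasure ν]
    (hν : ∀ t, charFun ν t =
      Complex.exp (-((∫ ω, inner ℝ (ψ (X 0 ω)) t ^ 2 ∂μ : ℝ) : ℂ) / 2))
    {Z : ℕ → Ω → E} (mZ : ∀ n, AEMeasurable (Z n) μ)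
    (hZ : TendstoInMeasure μ (fun n ω => Z n ω -
      (√(n : ℝ))⁻¹ • ∑ i ∈ Finset.range n, ζ i ω • ψ (X i ω)) atTop (fun _ => 0)) :
    TendstoInBootstrapDistribution μ
      (fun n => MeasurableSpace.comap (fun ω (i : Fin n) => X i ω) inferInstance) Z ν := by
  have hind : ∀ i, IndepFun (ζ i) (X i) μ := fun i =>
    hζX.comp (φ := fun x : ℕ → ℝ => x i) (ψ := fun x : ℕ → O => x i) (by fun_prop) (by fun_prop)
  have hind0 : IndepFun (ζ 0) (fun ω => ψ (X 0 ω)) μ := (hind 0).comp measurable_id mψ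
  -- two independent copies of the multipliers
  let P : Measure (Ω × Ω) := μ.prod μ
  have hfst : MeasurePreserving (Prod.fst : Ω × Ω → Ω) P μ := measurePreserving_fst
  have hsnd : MeasurePreserving (Prod.snd : Ω × Ω → Ω) P μ := measurePreserving_snd
  -- The first coordinate supplies the data and one set of multipliers, the second only another set
  -- of multipliers. Both copies of the sum therefore see the same data.
  let A : ℕ → Ω × Ω → (ℝ × O) × ℝ := fun i p => ((ζ i p.1, X i p.1), ζ i p.2)
  have hA1 : iIndepFun (fun i (p : Ω × Ω) => (ζ i p.1, X i p.1)) P :=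
    (hζ.prodMk_of_indepFun mζ mX hX hζX).comp_measurePreserving
      (fun i => (mζ i).prodMk (mX i)) hfst
  have hA2 : iIndepFun (fun i (p : Ω × Ω) => ζ i p.2) P := hζ.comp_measurePreserving mζ hsnd
  have hA12 : IndepFun (fun (p : Ω × Ω) i => (ζ i p.1, X i p.1)) (fun p i => ζ i p.2) P :=
    indepFun_prod (μ := μ) (ν := μ) (X := fun ω i => (ζ i ω, X i ω)) (Y := fun ω i => ζ i ω)
      (by fun_prop) (by fun_prop)
  have hA : iIndepFun A P :=
    hA1.prodMk_of_indepFun (fun i => by fun_prop) (fun i => by fun_prop) hA2 hA12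
  have hAid : ∀ i, IdentDistrib (A i) (A 0) P P := by
    intro i
    have h1 : IdentDistrib (fun ω => (ζ i ω, X i ω)) (fun ω => (ζ 0 ω, X 0 ω)) μ μ :=
      (hζid i).prodMk (hXid i) (hind i) (hind 0)
    have h2 : IdentDistrib (fun p : Ω × Ω => (ζ i p.1, X i p.1))
        (fun p : Ω × Ω => (ζ 0 p.1, X 0 p.1)) P P :=
      ⟨by fun_prop, by fun_prop, by
        have := h1.map_eq
        rw [← hfst.map_eq, Measure.map_map (by fun_prop) (by fun_prop),
          Measure.map_map (by fun_prop) (by fun_prop)] at this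
        exact this⟩
    have h3 : IdentDistrib (fun p : Ω × Ω => ζ i p.2) (fun p : Ω × Ω => ζ 0 p.2) P P :=
      ⟨by fun_prop, by fun_prop, by
        have := (hζid i).map_eq
        rw [← hsnd.map_eq, Measure.map_map (by fun_prop) (by fun_prop),
          Measure.map_map (by fun_prop) (by fun_prop)] at this
        exact this⟩
    exact h2.prodMk h3
      (hA12.comp (φ := fun x : ℕ → ℝ × O => x i) (ψ := fun x : ℕ → ℝ => x i)
        (by fun_prop) (by fun_prop))
      (hA12.comp (φ := fun x : ℕ → ℝ × O => x 0) (ψ := fun x : ℕ → ℝ => x 0)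
        (by fun_prop) (by fun_prop))
  -- The `L²` product makes `E × E` an inner product space, so the two sums form a single iid vector
  -- sum.
  let B : (ℝ × O) × ℝ → WithLp 2 (E × E) :=
    fun a => WithLp.toLp 2 (a.1.1 • ψ a.1.2, a.2 • ψ a.1.2)
  have mB : Measurable B := by fun_prop
  have hs1 : MemLp (fun ω => ζ 0 ω • ψ (X 0 ω)) 2 μ := hind0.memLp_two_smul hζL2 hψ
  have hcross : IndepFun (fun p : Ω × Ω => ζ 0 p.2) (fun p : Ω × Ω => ψ (X 0 p.1)) P :=
    (indepFun_prod (μ := μ) (ν := μ) (X := fun ω => ψ (X 0 ω)) (Y := ζ 0)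
      (by fun_prop) (by fun_prop)).symm
  have hL1 : MemLp (fun p : Ω × Ω => ζ 0 p.1 • ψ (X 0 p.1)) 2 P :=
    hs1.comp_measurePreserving hfst
  have hL2 : MemLp (fun p : Ω × Ω => ζ 0 p.2 • ψ (X 0 p.1)) 2 P :=
    hcross.memLp_two_smul (hζL2.comp_measurePreserving hsnd) (hψ.comp_measurePreserving hfst)
  have hBL2 : MemLp (fun p => B (A 0 p)) 2 P := by
    rw [memLp_two_iff_integrable_sq_norm (Measurable.aestronglyMeasurable (by fun_prop))]
    simp_rw [WithLp.prod_norm_sq_eq_of_L2]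
    exact ((memLp_two_iff_integrable_sq_norm hL1.1).1 hL1).add
      ((memLp_two_iff_integrable_sq_norm hL2.1).1 hL2)
  have hmean1 : ∀ t : E, ∫ ω, ζ 0 ω * inner ℝ (ψ (X 0 ω)) t ∂μ = 0 := by
    intro t
    have : IndepFun (ζ 0) (fun ω => inner ℝ (ψ (X 0 ω)) t) μ :=
      hind0.comp (φ := id) (ψ := fun x => inner ℝ x t) (by fun_prop) (by fun_prop)
    have := this.integral_fun_mul_eq_mul_integral
      (Measurable.aestronglyMeasurable (by fun_prop))
      (Measurable.aestronglyMeasurable (by fun_prop))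
    rw [this, hζmean, zero_mul]
  have hvar1 : ∀ t : E, ∫ ω, (ζ 0 ω * inner ℝ (ψ (X 0 ω)) t) ^ 2 ∂μ =
      ∫ ω, inner ℝ (ψ (X 0 ω)) t ^ 2 ∂μ := by
    intro t
    have : IndepFun (fun ω => ζ 0 ω ^ 2) (fun ω => inner ℝ (ψ (X 0 ω)) t ^ 2) μ :=
      hind0.comp (φ := fun x => x ^ 2) (ψ := fun x => inner ℝ x t ^ 2) (by fun_prop) (by fun_prop)
    have := this.integral_fun_mul_eq_mul_integral
      (Measurable.aestronglyMeasurable (by fun_prop))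
      (Measurable.aestronglyMeasurable (by fun_prop))
    simp_rw [mul_pow]
    rw [this, hζvar, one_mul]
  have hinner : ∀ (t : WithLp 2 (E × E)) (p : Ω × Ω), inner ℝ (B (A 0 p)) t =
      ζ 0 p.1 * inner ℝ (ψ (X 0 p.1)) t.fst + ζ 0 p.2 * inner ℝ (ψ (X 0 p.1)) t.snd := by
    intro t p
    simp [A, B, WithLp.prod_inner_apply, real_inner_smul_left]
  have hi1 : ∀ t : E, MemLp (fun p : Ω × Ω => ζ 0 p.1 * inner ℝ (ψ (X 0 p.1)) t) 2 P := by
    intro t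
    simpa [real_inner_smul_left] using hL1.inner_const (𝕜 := ℝ) t
  have hi2 : ∀ t : E, MemLp (fun p : Ω × Ω => ζ 0 p.2 * inner ℝ (ψ (X 0 p.1)) t) 2 P := by
    intro t
    simpa [real_inner_smul_left] using hL2.inner_const (𝕜 := ℝ) t
  have hfstint : ∀ f : Ω → ℝ, ∫ p : Ω × Ω, f p.1 ∂P = ∫ ω, f ω ∂μ := by
    intro f
    simp [P, integral_fun_fst]
  have hBmean : ∀ t, ∫ p, inner ℝ (B (A 0 p)) t ∂P = 0 := by
    intro t
    simp_rw [hinner]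
    rw [integral_add ((hi1 _).integrable (by norm_num)) ((hi2 _).integrable (by norm_num)),
      hfstint fun ω => ζ 0 ω * inner ℝ (ψ (X 0 ω)) t.fst, hmean1]
    simp_rw [mul_comm (ζ 0 _)]
    rw [integral_prod_mul (fun ω => inner ℝ (ψ (X 0 ω)) t.snd) (ζ 0), hζmean, mul_zero, zero_add]
  -- The cross term vanishes because the second multiplier is centred and independent of everything
  -- in the first coordinate. This makes the two sums asymptotically independent although they share
  -- the data.
  have hBvar : ∀ t, ∫ p, inner ℝ (B (A 0 p)) t ^ 2 ∂P =
      ∫ ω, inner ℝ (ψ (X 0 ω)) t.fst ^ 2 ∂μ + ∫ ω, inner ℝ (ψ (X 0 ω)) t.snd ^ 2 ∂μ := by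
    intro t
    have e : ∀ p : Ω × Ω, inner ℝ (B (A 0 p)) t ^ 2 =
        (ζ 0 p.1 * inner ℝ (ψ (X 0 p.1)) t.fst) ^ 2 +
        2 * ((ζ 0 p.1 * inner ℝ (ψ (X 0 p.1)) t.fst) * (ζ 0 p.2 * inner ℝ (ψ (X 0 p.1)) t.snd)) +
        (ζ 0 p.2 * inner ℝ (ψ (X 0 p.1)) t.snd) ^ 2 := by
      intro p; rw [hinner]; ring
    simp_rw [e]
    have i1 : Integrable (fun p : Ω × Ω => 2 * ((ζ 0 p.1 * inner ℝ (ψ (X 0 p.1)) t.fst) *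
        (ζ 0 p.2 * inner ℝ (ψ (X 0 p.1)) t.snd))) P :=
      ((hi1 _).integrable_mul (hi2 _)).const_mul 2
    have i2 := (hi1 t.fst).integrable_sq.add i1
    simp only [Pi.add_def] at i2
    rw [integral_add i2 (hi2 _).integrable_sq, integral_add (hi1 _).integrable_sq i1,
      hfstint fun ω => (ζ 0 ω * inner ℝ (ψ (X 0 ω)) t.fst) ^ 2, hvar1, integral_const_mul]
    have e1 : ∀ p : Ω × Ω, (ζ 0 p.1 * inner ℝ (ψ (X 0 p.1)) t.fst) *
        (ζ 0 p.2 * inner ℝ (ψ (X 0 p.1)) t.snd) =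
        (ζ 0 p.1 * inner ℝ (ψ (X 0 p.1)) t.fst * inner ℝ (ψ (X 0 p.1)) t.snd) * ζ 0 p.2 := by
      intro p; ring
    have e2 : ∀ p : Ω × Ω, (ζ 0 p.2 * inner ℝ (ψ (X 0 p.1)) t.snd) ^ 2 =
        inner ℝ (ψ (X 0 p.1)) t.snd ^ 2 * ζ 0 p.2 ^ 2 := by
      intro p; ring
    simp_rw [e1, e2]
    rw [integral_prod_mul
        (fun ω => ζ 0 ω * inner ℝ (ψ (X 0 ω)) t.fst * inner ℝ (ψ (X 0 ω)) t.snd) (ζ 0), hζmean,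
      integral_prod_mul (fun ω => inner ℝ (ψ (X 0 ω)) t.snd ^ 2) (fun ω => ζ 0 ω ^ 2), hζvar]
    ring
  let ν2 : Measure (WithLp 2 (E × E)) := (ν.prod ν).map (WithLp.toLp 2)
  have : IsProbabilityMeasure ν2 := Measure.isProbabilityMeasure_map (by fun_prop)
  have hjoint := tendstoInDistribution_inv_sqrt_smul_sum (μ := P) (X := fun i p => B (A i p))
    (hA.comp (fun _ => B) fun _ => mB) (fun i => (hAid i).comp mB) hBL2 hBmean (ν := ν2) (by
      intro t
      rw [charFun_prod, hν, hν, hBvar, ← Complex.exp_add]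
      simp only [WithLp.ofLp_fst, WithLp.ofLp_snd]
      congr 1
      push_cast
      ring)
  -- the first copy alone
  set S : ℕ → Ω → E := fun n ω => (√(n : ℝ))⁻¹ • ∑ i ∈ Finset.range n, ζ i ω • ψ (X i ω) with hS
  have hS1 : TendstoInDistribution S atTop id (fun _ => μ) ν := by
    refine tendstoInDistribution_inv_sqrt_smul_sum (X := fun i ω => ζ i ω • ψ (X i ω)) ?_ ?_ hs1
      (fun t => ?_) fun t => ?_
    · exact (hζ.prodMk_of_indepFun mζ mX hX hζX).comp (fun _ x => x.1 • ψ x.2) (by fun_prop)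
    · intro i
      exact ((hζid i).prodMk (hXid i) (hind i) (hind 0)).comp
        (u := fun x => x.1 • ψ x.2) (by fun_prop)
    · simp_rw [real_inner_smul_left]
      exact hmean1 t
    · simp_rw [real_inner_smul_left]
      rw [hvar1, hν]
  intro h
  set c := ∫ x, h x ∂ν with hc
  let 𝒟 : ℕ → MeasurableSpace Ω :=
    fun n => MeasurableSpace.comap (fun ω (i : Fin n) => X i ω) inferInstance
  have h𝒟 : ∀ n, 𝒟 n ≤ ‹MeasurableSpace Ω› :=
    fun n => Measurable.comap_le (by fun_prop)
  have hbd : ∀ (Y : Ω → E), AEMeasurable Y μ → Integrable (fun ω => h (Y ω)) μ := fun Y hY =>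
    .of_bound (h.continuous.measurable.comp_aemeasurable hY).aestronglyMeasurable ‖h‖
      (ae_of_all _ fun _ => h.norm_coe_le_norm _)
  have mS : ∀ n, AEMeasurable (S n) μ := hS1.forall_aemeasurable
  -- replacing `Z n` by `S n` is harmless
  have hrep : TendstoInMeasure μ (fun n => μ[fun ω => h (Z n ω) | 𝒟 n] -
      μ[fun ω => h (S n ω) | 𝒟 n]) atTop (fun _ => 0) := by
    refine tendstoInMeasure_zero_of_integral_abs
      (fun n => integrable_condExp.sub integrable_condExp) ?_
    refine squeeze_zero (fun n => integral_nonneg fun _ => abs_nonneg _) (fun n => ?_)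
      (tendsto_integral_abs_sub_of_tendstoInMeasure_sub hS1 mZ hZ h)
    have h1 := condExp_sub (hbd _ (mZ n)) (hbd _ (mS n)) (𝒟 n)
    calc _ = ∫ ω, |(μ[(fun ω => h (Z n ω)) - (fun ω => h (S n ω)) | 𝒟 n]) ω| ∂μ := by
          refine integral_congr_ae ?_
          filter_upwards [h1] with ω hω
          rw [hω]
      _ ≤ _ := integral_abs_condExp_le _
  -- Expanding the square leaves `E V² - 2c E V + c²` for the conditional expectation `V`. It tends
  -- to zero once `E V² → c²` and `E V → c`.
  have hsq : TendstoInMeasure μ (fun n ω => ((μ[fun ω => h (S n ω) | 𝒟 n]) ω - c) ^ 2) atTop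
      (fun _ => 0) := by
    have hV : ∀ n, ∀ᵐ ω ∂μ, |(μ[fun ω => h (S n ω) | 𝒟 n]) ω| ≤ ‖h‖ := by
      intro n
      exact ae_bdd_abs_condExp_of_ae_bdd_abs (ae_of_all _ fun _ => h.norm_coe_le_norm _)
    have hVi : ∀ n, Integrable (fun ω => (μ[fun ω => h (S n ω) | 𝒟 n]) ω ^ 2) μ := by
      intro n
      refine .of_bound (integrable_condExp.1.pow 2) (‖h‖ ^ 2) ?_
      filter_upwards [hV n] with ω hω
      rw [norm_pow]
      exact pow_le_pow_left₀ (norm_nonneg _) hω 2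
    have e : ∀ n, (fun ω => ((μ[fun ω => h (S n ω) | 𝒟 n]) ω - c) ^ 2) = fun ω =>
        (μ[fun ω => h (S n ω) | 𝒟 n]) ω ^ 2 - 2 * c * (μ[fun ω => h (S n ω) | 𝒟 n]) ω + c ^ 2 := by
      intro n; ext ω; ring
    refine tendstoInMeasure_zero_of_integral_abs (fun n => ?_) ?_
    · rw [e]
      exact ((hVi n).sub (integrable_condExp.const_mul _)).add (integrable_const _)
    simp_rw [abs_sq]
    have e2 : ∀ n, ∫ ω, ((μ[fun ω => h (S n ω) | 𝒟 n]) ω - c) ^ 2 ∂μ =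
        ∫ ω, (μ[fun ω => h (S n ω) | 𝒟 n]) ω ^ 2 ∂μ - 2 * c * ∫ ω, h (S n ω) ∂μ + c ^ 2 := by
      intro n
      have i1 := (hVi n).sub (((integrable_condExp (μ := μ) (m := 𝒟 n)
        (f := fun ω => h (S n ω)))).const_mul (2 * c))
      simp only [Pi.sub_def] at i1
      rw [e, integral_add i1 (integrable_const _), integral_sub (hVi n) (integrable_condExp.const_mul _), integral_const_mul,
        integral_condExp (h𝒟 n)]
      simp
    have h1 : Tendsto (fun n => ∫ ω, h (S n ω) ∂μ) atTop (𝓝 c) :=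
      TendstoInDistribution.tendsto_integral_comp hS1 h
    -- Here `E V²` is the mean of `h(S_n) h(S_n')` over the two copies, and the product limit turns
    -- it into `(∫ h dν)²`.
    have h2 : Tendsto (fun n => ∫ ω, (μ[fun ω => h (S n ω) | 𝒟 n]) ω ^ 2 ∂μ) atTop
        (𝓝 (c ^ 2)) := by
      let F : WithLp 2 (E × E) →ᵇ ℝ := BoundedContinuousFunction.ofNormedAddCommGroup
        (fun p => h p.fst * h p.snd) (by fun_prop) (‖h‖ * ‖h‖) fun p => by
          rw [norm_mul]
          gcongr <;> exact h.norm_coe_le_norm _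
      have h3 := TendstoInDistribution.tendsto_integral_comp hjoint F
      have h4 : ∫ x, F (id x) ∂ν2 = c ^ 2 := by
        change ∫ x, F x ∂((ν.prod ν).map (WithLp.toLp 2)) = _
        rw [integral_map (by fun_prop) F.continuous.measurable.aestronglyMeasurable, sq, hc,
          ← integral_prod_mul]
        rfl
      rw [h4] at h3
      refine h3.congr fun n => ?_
      -- The sum is written as a function of the first `n` observations, which are conditioned on,
      -- and of the multiplier sequence, which is copied.
      let f : (Fin n → O) × (ℕ → ℝ) → ℝ :=
        fun x => h ((√(n : ℝ))⁻¹ • ∑ i : Fin n, x.2 i • ψ (x.1 i))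
      have hf : StronglyMeasurable f := by
        refine Measurable.stronglyMeasurable ?_
        have := h.continuous.measurable
        fun_prop
      have h5 := integral_condExp_comap_sq_of_indepFun (μ := μ) (X := fun ω (i : Fin n) => X i ω)
        (Y := fun ω i => ζ i ω) (by fun_prop) (by fun_prop)
        (hζX.symm.comp (φ := fun (x : ℕ → O) (i : Fin n) => x i) (ψ := id) (by fun_prop) measurable_id)
        hf (C := ‖h‖) fun x => h.norm_coe_le_norm _
      have h6 : ∀ ω ω', f ((fun (i : Fin n) => X i ω), fun i => ζ i ω') =
          h ((√(n : ℝ))⁻¹ • ∑ i ∈ Finset.range n, ζ i ω' • ψ (X i ω)) := by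
        intro ω ω'
        simp only [f]
        rw [Finset.sum_range fun i => ζ i ω' • ψ (X i ω)]
      simp_rw [h6] at h5
      rw [hS]
      refine Eq.trans ?_ h5.symm
      refine integral_congr_ae (ae_of_all _ fun p => ?_)
      have h7 : ∀ (s : Finset ℕ) (a b : ℕ → E), ∑ i ∈ s, WithLp.toLp 2 (a i, b i) =
          WithLp.toLp 2 (∑ i ∈ s, a i, ∑ i ∈ s, b i) := by
        intro s a b
        induction s using Finset.cons_induction with
        | empty => rfl
        | cons j s hj ih => rw [Finset.sum_cons, Finset.sum_cons, Finset.sum_cons, ih]; rfl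
      simp only [B, A, F, h7]
      rfl
    simp_rw [e2]
    have h3 := (h2.sub (h1.const_mul (2 * c))).add_const (c ^ 2)
    convert h3 using 2
    ring
  rw [tendstoInMeasure_const_iff] at hsq hrep ⊢
  rw [tendsto_iff_norm_sub_tendsto_zero]
  have h1 : Tendsto (fun p : ℕ × Ω => |(μ[fun ω => h (S p.1 ω) | 𝒟 p.1]) p.2 - c|)
      (probFilter μ) (𝓝 0) := by
    have := (Real.continuous_sqrt.tendsto 0).comp hsq
    simpa [Function.comp_def, Real.sqrt_sq_eq_abs] using this
  have h2 := hrep.norm.add h1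
  simp only [norm_zero, add_zero] at h2
  refine squeeze_zero (fun _ => norm_nonneg _) (fun p => ?_) h2
  refine le_trans (le_of_eq ?_) (norm_add_le _ _)
  rw [Pi.sub_apply]
  congr 1
  ring

end Multiplier

/-! ### Statistics that are linear in features of the observations -/

/-- `U i` is a square-integrable function of the `i`-th observation, the same for all `i`. -/
def IsFeature {Ω O : Type*} [MeasurableSpace Ω] [MeasurableSpace O] (μ : Measure Ω) (X : ℕ → Ω → O)
    (U : ℕ → Ω → ℝ) : Prop :=
  MemLp (U 0) 2 μ ∧ ∃ f : O → ℝ, Measurable f ∧ ∀ i ω, U i ω = f (X i ω)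

/-- `PlugIn μ X V U m` says that `U` is a linear combination of features of the observations, that
`V n` is the same combination with the coefficients replaced by consistent estimates, and that
`m n` is the mean of this combination when the estimated coefficients are held fixed. -/
inductive PlugIn {Ω O : Type*} [MeasurableSpace Ω] [MeasurableSpace O] (μ : Measure Ω)
    (X : ℕ → Ω → O) : (ℕ → ℕ → Ω → ℝ) → (ℕ → Ω → ℝ) → (ℕ → Ω → ℝ) → Prop
  | mul {b : ℕ → Ω → ℝ} {c : ℝ} {U : ℕ → Ω → ℝ}
      (hb : Tendsto (fun p : ℕ × Ω => b p.1 p.2) (probFilter μ) (𝓝 c)) (hU : IsFeature μ X U) :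
      PlugIn μ X (fun n i ω => b n ω * U i ω) (fun i ω => c * U i ω)
        (fun n ω => b n ω * ∫ ω', U 0 ω' ∂μ)
  | add {V V' : ℕ → ℕ → Ω → ℝ} {U U' : ℕ → Ω → ℝ} {m m' : ℕ → Ω → ℝ}
      (h : PlugIn μ X V U m) (h' : PlugIn μ X V' U' m') :
      PlugIn μ X (fun n i ω => V n i ω + V' n i ω) (fun i ω => U i ω + U' i ω)
        (fun n ω => m n ω + m' n ω)

theorem sampleMean_add (n : ℕ) (f f' : ℕ → ℝ) :
    sampleMean n (fun i => f i + f' i) = sampleMean n f + sampleMean n f' := by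
  simp [sampleMean, Finset.sum_add_distrib, mul_add]

theorem sampleMean_const_mul (n : ℕ) (c : ℝ) (f : ℕ → ℝ) :
    sampleMean n (fun i => c * f i) = c * sampleMean n f := by
  simp only [sampleMean, ← Finset.mul_sum]
  ring

theorem sampleMean_sub (n : ℕ) (f f' : ℕ → ℝ) :
    sampleMean n (fun i => f i - f' i) = sampleMean n f - sampleMean n f' := by
  simp [sampleMean, Finset.sum_sub_distrib, mul_sub]

theorem sampleMean_sum {κ : Type*} (s : Finset κ) (n : ℕ) (f : κ → ℕ → ℝ) :
    sampleMean n (fun i => ∑ k ∈ s, f k i) = ∑ k ∈ s, sampleMean n (f k) := by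
  simp only [sampleMean, Finset.mul_sum]
  rw [Finset.sum_comm]

theorem sampleMean_dotProduct {κ : Type*} [Fintype κ] (n : ℕ) (c : κ → ℝ) (f : ℕ → κ → ℝ) :
    sampleMean n (fun i => c ⬝ᵥ f i) = c ⬝ᵥ fun k => sampleMean n fun i => f i k := by
  simp only [dotProduct]
  rw [sampleMean_sum]
  simp_rw [sampleMean_const_mul]

section Features

variable {Ω O : Type*} [MeasurableSpace Ω] [MeasurableSpace O] {μ : Measure Ω} {X : ℕ → Ω → O}

namespace IsFeature

variable {U U' : ℕ → Ω → ℝ}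

theorem add (h : IsFeature μ X U) (h' : IsFeature μ X U') :
    IsFeature μ X fun i ω => U i ω + U' i ω := by
  obtain ⟨h1, f, hf, hU⟩ := h
  obtain ⟨h1', f', hf', hU'⟩ := h'
  exact ⟨h1.add h1', fun x => f x + f' x, by fun_prop, fun i ω => by simp only [hU, hU']⟩

theorem const_mul (c : ℝ) (h : IsFeature μ X U) : IsFeature μ X fun i ω => c * U i ω := by
  obtain ⟨h1, f, hf, hU⟩ := h
  exact ⟨h1.const_mul c, fun x => c * f x, by fun_prop, fun i ω => by simp only [hU]⟩

theorem sub (h : IsFeature μ X U) (h' : IsFeature μ X U') :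
    IsFeature μ X fun i ω => U i ω - U' i ω := by
  simpa [sub_eq_add_neg] using h.add (h'.const_mul (-1))

theorem const [IsFiniteMeasure μ] (c : ℝ) : IsFeature μ X fun _ _ => c :=
  ⟨memLp_const c, fun _ => c, measurable_const, fun _ _ => rfl⟩

theorem memLp (h : IsFeature μ X U) : MemLp (U 0) 2 μ := h.1

theorem integrable [IsFiniteMeasure μ] (h : IsFeature μ X U) : Integrable (U 0) μ :=
  h.1.integrable (by norm_num)

theorem iIndepFun (h : IsFeature μ X U) (hX : iIndepFun X μ) : iIndepFun U μ := by
  obtain ⟨-, f, hf, hU⟩ := h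
  have : U = fun i => f ∘ X i := funext fun i => funext (hU i)
  rw [this]
  exact hX.comp (fun _ => f) fun _ => hf

theorem identDistrib (h : IsFeature μ X U) (hX : ∀ i, IdentDistrib (X i) (X 0) μ μ) (i : ℕ) :
    IdentDistrib (U i) (U 0) μ μ := by
  obtain ⟨-, f, hf, hU⟩ := h
  have : U = fun i => f ∘ X i := funext fun i => funext (hU i)
  rw [this]
  exact (hX i).comp hf

end IsFeature

namespace PlugIn

variable {V V' : ℕ → ℕ → Ω → ℝ} {U U' : ℕ → Ω → ℝ} {m m' : ℕ → Ω → ℝ}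

theorem of_isFeature (hU : IsFeature μ X U) :
    PlugIn μ X (fun _ i ω => U i ω) U fun _ _ => ∫ ω, U 0 ω ∂μ := by
  simpa using PlugIn.mul (b := fun _ _ => 1) tendsto_const_nhds hU

theorem const_mul {b : ℕ → Ω → ℝ} {c : ℝ}
    (hb : Tendsto (fun p : ℕ × Ω => b p.1 p.2) (probFilter μ) (𝓝 c)) (h : PlugIn μ X V U m) :
    PlugIn μ X (fun n i ω => b n ω * V n i ω) (fun i ω => c * U i ω)
      (fun n ω => b n ω * m n ω) := by
  induction h with
  | mul hb' hU =>
    simp_rw [← mul_assoc]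
    exact .mul (hb.mul hb') hU
  | add _ _ ih ih' =>
    simp_rw [mul_add]
    exact ih.add ih'

theorem const [IsFiniteMeasure μ] {b : ℕ → Ω → ℝ} {c : ℝ}
    (hb : Tendsto (fun p : ℕ × Ω => b p.1 p.2) (probFilter μ) (𝓝 c)) :
    PlugIn μ X (fun n _ ω => b n ω) (fun _ _ => c) fun n ω => b n ω * ∫ _, (1 : ℝ) ∂μ := by
  simpa using PlugIn.const_mul hb (of_isFeature (IsFeature.const (μ := μ) (X := X) 1))

theorem neg (h : PlugIn μ X V U m) :
    PlugIn μ X (fun n i ω => -V n i ω) (fun i ω => -U i ω) (fun n ω => -m n ω) := by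
  simpa using PlugIn.const_mul (b := fun _ _ => -1) tendsto_const_nhds h

theorem sub (h : PlugIn μ X V U m) (h' : PlugIn μ X V' U' m') :
    PlugIn μ X (fun n i ω => V n i ω - V' n i ω) (fun i ω => U i ω - U' i ω)
      (fun n ω => m n ω - m' n ω) := by
  simpa [sub_eq_add_neg] using h.add h'.neg

theorem sum [IsFiniteMeasure μ] {κ : Type*} (s : Finset κ) {V : κ → ℕ → ℕ → Ω → ℝ}
    {U : κ → ℕ → Ω → ℝ} {m : κ → ℕ → Ω → ℝ} (h : ∀ k, PlugIn μ X (V k) (U k) (m k)) :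
    PlugIn μ X (fun n i ω => ∑ k ∈ s, V k n i ω) (fun i ω => ∑ k ∈ s, U k i ω)
      (fun n ω => ∑ k ∈ s, m k n ω) := by
  induction s using Finset.cons_induction with
  | empty => simpa using of_isFeature (IsFeature.const (μ := μ) (X := X) 0)
  | cons j s hj ih =>
    simp_rw [Finset.sum_cons]
    exact (h j).add ih

theorem dotProduct [IsFiniteMeasure μ] {κ : Type*} [Fintype κ] {b : ℕ → Ω → κ → ℝ} {c : κ → ℝ}
    (hb : ∀ k, Tendsto (fun p : ℕ × Ω => b p.1 p.2 k) (probFilter μ) (𝓝 (c k)))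
    {V : ℕ → ℕ → Ω → κ → ℝ} {U : ℕ → Ω → κ → ℝ} {m : ℕ → Ω → κ → ℝ}
    (h : ∀ k, PlugIn μ X (fun n i ω => V n i ω k) (fun i ω => U i ω k) fun n ω => m n ω k) :
    PlugIn μ X (fun n i ω => b n ω ⬝ᵥ V n i ω) (fun i ω => c ⬝ᵥ U i ω)
      (fun n ω => b n ω ⬝ᵥ m n ω) :=
  PlugIn.sum Finset.univ fun k => const_mul (hb k) (h k)

theorem mulVec [IsFiniteMeasure μ] {κ κ' : Type*} [Fintype κ] {b : ℕ → Ω → Matrix κ' κ ℝ}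
    {c : Matrix κ' κ ℝ}
    (hb : ∀ j k, Tendsto (fun p : ℕ × Ω => b p.1 p.2 j k) (probFilter μ) (𝓝 (c j k)))
    {V : ℕ → ℕ → Ω → κ → ℝ} {U : ℕ → Ω → κ → ℝ} {m : ℕ → Ω → κ → ℝ}
    (h : ∀ k, PlugIn μ X (fun n i ω => V n i ω k) (fun i ω => U i ω k) fun n ω => m n ω k)
    (j : κ') :
    PlugIn μ X (fun n i ω => (b n ω *ᵥ V n i ω) j) (fun i ω => (c *ᵥ U i ω) j)
      (fun n ω => (b n ω *ᵥ m n ω) j) :=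
  dotProduct (b := fun n ω k => b n ω j k) (c := fun k => c j k) (m := m) (hb j) h

theorem isFeature (h : PlugIn μ X V U m) : IsFeature μ X U := by
  induction h with
  | mul _ hU => exact hU.const_mul _
  | add _ _ ih ih' => exact ih.add ih'

variable [IsProbabilityMeasure μ]

/-- The estimated coefficients do not vary with `i`, so they factor out of the average and the law
of large numbers is applied to features only. -/
theorem tendsto_sampleMean (h : PlugIn μ X V U m) (hX : iIndepFun X μ)
    (hXid : ∀ i, IdentDistrib (X i) (X 0) μ μ) :
    Tendsto (fun p : ℕ × Ω => sampleMean p.1 fun i => V p.1 i p.2) (probFilter μ)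
      (𝓝 (∫ ω, U 0 ω ∂μ)) := by
  induction h with
  | mul hb hU =>
    simp_rw [sampleMean_const_mul]
    rw [integral_const_mul]
    exact hb.mul (tendsto_sampleMean_probFilter hU.integrable (hU.iIndepFun hX)
      (hU.identDistrib hXid))
  | add h h' ih ih' =>
    simp_rw [sampleMean_add]
    rw [integral_add h.isFeature.integrable h'.isFeature.integrable]
    exact ih.add ih'

/-- Replacing a plug-in by its limit changes the centred and scaled sample mean negligibly. -/
theorem tendsto_sqrt_mul_sampleMean_sub (h : PlugIn μ X V U m) (hX : iIndepFun X μ)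
    (hXid : ∀ i, IdentDistrib (X i) (X 0) μ μ) :
    Tendsto (fun p : ℕ × Ω => (√(p.1 : ℝ)) * (((sampleMean p.1 fun i => V p.1 i p.2) - m p.1 p.2) -
      ((sampleMean p.1 fun i => U i p.2) - ∫ ω, U 0 ω ∂μ))) (probFilter μ) (𝓝 0) := by
  induction h with
  | @mul b c U hb hU =>
    have hU' : IsFeature μ X fun i ω => U i ω - ∫ ω', U 0 ω' ∂μ := hU.sub (.const _)
    -- The mean `m` carries the same random coefficient `b`, so the difference is exactly `b - c`
    -- times a centred scaled sum.
    have h1 := tendsto_mul_inv_sqrt_mul_sum_probFilter hU'.memLp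
      (by rw [integral_sub hU.integrable (integrable_const _)]; simp) (hU'.iIndepFun hX)
      (hU'.identDistrib hXid) (X := fun p => b p.1 p.2 - c)
      (by simpa using hb.sub_const c)
    refine h1.congr' ?_
    filter_upwards [eventually_probFilter_ge 1] with p hp
    have hp' : (0 : ℝ) < p.1 := by exact_mod_cast hp
    have hs : (√(p.1 : ℝ))⁻¹ = √(p.1 : ℝ) * (p.1 : ℝ)⁻¹ := by
      have := Real.sq_sqrt hp'.le
      have h0 : √(p.1 : ℝ) ≠ 0 := (Real.sqrt_pos.2 hp').ne'
      field_simp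
      exact this.symm
    simp_rw [sampleMean_const_mul]
    rw [integral_const_mul, hs, Finset.sum_sub_distrib, Finset.sum_const, Finset.card_range,
      nsmul_eq_mul]
    simp only [sampleMean]
    field_simp
  | add h h' ih ih' =>
    simp_rw [sampleMean_add]
    rw [integral_add h.isFeature.integrable h'.isFeature.integrable]
    refine (by simpa using ih.add ih' : Tendsto _ _ (𝓝 (0 : ℝ))).congr fun p => ?_
    ring

/-- Replacing a plug-in by its limit changes a scaled sum with iid multipliers negligibly. -/
theorem tendsto_inv_sqrt_mul_sum_multiplier (h : PlugIn μ X V U m) (mX : ∀ i, Measurable (X i))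
    (hX : iIndepFun X μ) (hXid : ∀ i, IdentDistrib (X i) (X 0) μ μ)
    {ζ : ℕ → Ω → ℝ} (mζ : ∀ i, Measurable (ζ i)) (hζ : iIndepFun ζ μ)
    (hζid : ∀ i, IdentDistrib (ζ i) (ζ 0) μ μ) (hζL2 : MemLp (ζ 0) 2 μ)
    (hζmean : ∫ ω, ζ 0 ω ∂μ = 0)
    (hζX : IndepFun (fun ω i => ζ i ω) (fun ω i => X i ω) μ) :
    Tendsto (fun p : ℕ × Ω => (√(p.1 : ℝ))⁻¹ *
      ∑ i ∈ Finset.range p.1, ζ i p.2 * (V p.1 i p.2 - U i p.2)) (probFilter μ) (𝓝 0) := by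
  induction h with
  | @mul b c U hb hU =>
    obtain ⟨hL2, f, hf, hUf⟩ := hU
    have hind : ∀ i, IndepFun (ζ i) (X i) μ := fun i =>
      hζX.comp (φ := fun x : ℕ → ℝ => x i) (ψ := fun x : ℕ → O => x i) (by fun_prop) (by fun_prop)
    have hU0 : U 0 = fun ω => f (X 0 ω) := funext (hUf 0)
    rw [hU0] at hL2
    have hind0 : IndepFun (ζ 0) (fun ω => f (X 0 ω)) μ := (hind 0).comp measurable_id hf
    -- No centring of the feature is needed: the products `ζ i * f (X i)` have mean zero through the
    -- multipliers.
    have h1 := tendsto_mul_inv_sqrt_mul_sum_probFilter (μ := μ) (U := fun i ω => ζ i ω * f (X i ω))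
      (by simpa using hind0.memLp_two_smul hζL2 hL2)
      (by rw [hind0.integral_fun_mul_eq_mul_integral hζL2.1 hL2.1, hζmean, zero_mul])
      ((hζ.prodMk_of_indepFun mζ mX hX hζX).comp (fun _ x => x.1 * f x.2) (by fun_prop))
      (fun i => ((hζid i).prodMk (hXid i) (hind i) (hind 0)).comp
        (u := fun x : ℝ × O => x.1 * f x.2) (by fun_prop))
      (X := fun p => b p.1 p.2 - c) (by simpa using hb.sub_const c)
    refine h1.congr fun p => ?_
    rw [mul_left_comm, Finset.mul_sum]
    congr 1
    refine Finset.sum_congr rfl fun i _ => ?_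
    simp only [hUf]
    ring
  | add h h' ih ih' =>
    refine (by simpa using ih.add ih' : Tendsto _ _ (𝓝 (0 : ℝ))).congr fun p => ?_
    rw [← mul_add, ← Finset.sum_add_distrib]
    congr 1
    refine Finset.sum_congr rfl fun i _ => ?_
    ring

end PlugIn

end Features

/-- The characteristic function of a centred Gaussian whose covariance matrix is a matrix of second
moments. -/
theorem charFun_multivariateGaussian_secondMoment {Ω ι : Type*} [MeasurableSpace Ω] [Fintype ι]
    [DecidableEq ι] {μ : Measure Ω} {U : Ω → EuclideanSpace ℝ ι} (hU : MemLp U 2 μ)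
    (t : EuclideanSpace ℝ ι) :
    charFun (multivariateGaussian 0 (Matrix.of fun a b => ∫ ω, U ω a * U ω b ∂μ)) t =
      Complex.exp (-((∫ ω, inner ℝ (U ω) t ^ 2 ∂μ : ℝ) : ℂ) / 2) := by
  have hc : ∀ a, MemLp (fun ω => U ω a) 2 μ := fun a =>
    (EuclideanSpace.proj (𝕜 := ℝ) a).comp_memLp' hU
  have hint : ∀ a b, Integrable (fun ω => U ω a * U ω b) μ := fun a b =>
    (hc a).integrable_mul (hc b)
  -- The quadratic form is the second moment of a linear functional. This gives positive
  -- semidefiniteness and also the exponent of the characteristic function.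
  have hquad : ∀ x : ι → ℝ, x ⬝ᵥ (Matrix.of fun a b => ∫ ω, U ω a * U ω b ∂μ) *ᵥ x =
      ∫ ω, (∑ a, U ω a * x a) ^ 2 ∂μ := by
    intro x
    have : ∀ ω, (∑ a, U ω a * x a) ^ 2 = ∑ a, ∑ b, x a * x b * (U ω a * U ω b) := by
      intro ω
      rw [sq, Finset.sum_mul_sum]
      exact Finset.sum_congr rfl fun a _ => Finset.sum_congr rfl fun b _ => by ring
    simp_rw [this]
    rw [integral_finsetSum _ fun a _ => integrable_finsetSum _ fun b _ => (hint a b).const_mul _]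
    simp only [_root_.dotProduct, Matrix.mulVec, Matrix.of_apply]
    refine Finset.sum_congr rfl fun a _ => ?_
    rw [integral_finsetSum _ fun b _ => (hint a b).const_mul _, Finset.mul_sum]
    refine Finset.sum_congr rfl fun b _ => ?_
    rw [integral_const_mul]
    ring
  have hpsd : (Matrix.of fun a b => ∫ ω, U ω a * U ω b ∂μ).PosSemidef := by
    refine Matrix.PosSemidef.of_dotProduct_mulVec_nonneg ?_ fun x => ?_
    · ext a b
      simp [Matrix.conjTranspose_apply, mul_comm]
    · rw [star_trivial, hquad]
      exact integral_nonneg fun _ => sq_nonneg _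
  rw [charFun_multivariateGaussian hpsd, hquad]
  simp [PiLp.inner_apply, mul_comm, neg_div]

namespace StaggeredPanel

/-! ### Measurability and features of the observed data -/

section Measurability

variable {Ω : Type*} [MeasurableSpace Ω] {T R : ℕ} (M : StaggeredPanel Ω T R)

/-- The group factors through the finitely many treatment histories, and every function on a finite
discrete space is measurable. -/
theorem measurable_G (i : ℕ) : Measurable (M.G i) := by
  let φ : (Finset.Icc 1 T → Bool) → ℕ∞ := fun d =>
    (Finset.univ.filter fun t => d t = true).inf fun t => ((t : ℕ) : ℕ∞)
  have h : M.G i = φ ∘ fun ω t => M.D i t ω := by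
    ext1 ω
    simp only [G, φ, Function.comp_apply]
    apply le_antisymm
    · simp only [Finset.le_inf_iff, Finset.mem_filter, Finset.mem_univ, true_and]
      intro t ht
      exact Finset.inf_le (f := fun t : ℕ => (t : ℕ∞)) (Finset.mem_filter.2 ⟨t.2, ht⟩)
    · simp only [Finset.le_inf_iff, Finset.mem_filter]
      rintro t ⟨ht, hd⟩
      exact Finset.inf_le (f := fun t : Finset.Icc 1 T => ((t : ℕ) : ℕ∞))
        (b := ⟨t, ht⟩) (by simpa using hd)
  rw [h]
  exact (measurable_of_finite φ).comp (measurable_pi_lambda _ fun t => M.measurable_D i t)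

/-- A random group may be substituted into the potential outcomes because `ℕ∞` is countable. -/
theorem measurable_Y (i t : ℕ) : Measurable (M.Y i t) := by
  have h : Measurable fun p : ℕ∞ × Ω => M.Ypot i t p.1 p.2 :=
    measurable_from_prod_countable_right fun γ => M.measurable_Ypot i t γ
  exact h.comp ((M.measurable_G i).prodMk measurable_id)

theorem measurable_obs (i : ℕ) : Measurable (M.obs i) :=
  Measurable.prodMk (f := fun ω (t : Finset.Icc 1 T) => M.Y i t ω)
    (measurable_pi_lambda _ fun t => M.measurable_Y i t) (M.measurable_G i)

theorem measurable_groupInd (γ : ℕ∞) : Measurable fun γ' => groupInd γ' γ :=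
  measurable_from_top

end Measurability

variable {Ω : Type*} [MeasurableSpace Ω] {μ : Measure Ω} [IsProbabilityMeasure μ] {T R : ℕ}
  {M : StaggeredPanel Ω T R}

theorem groupInd_eq_indicator (γ : ℕ∞) (f : Ω → ℝ) (i : ℕ) :
    (fun ω => groupInd (M.G i ω) γ * f ω) = {ω | M.G i ω = γ}.indicator f := by
  ext ω
  by_cases h : M.G i ω = γ <;> simp [groupInd, h]

theorem measurableSet_G_eq (i : ℕ) (γ : ℕ∞) : MeasurableSet {ω | M.G i ω = γ} :=
  M.measurable_G i (measurableSet_singleton γ)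

theorem integrable_groupInd_mul {f : Ω → ℝ} (hf : Integrable f μ) (i : ℕ) (γ : ℕ∞) :
    Integrable (fun ω => groupInd (M.G i ω) γ * f ω) μ := by
  rw [groupInd_eq_indicator]
  exact hf.indicator (measurableSet_G_eq i γ)

theorem integral_groupInd_mul (f : Ω → ℝ) (i : ℕ) (γ : ℕ∞) :
    ∫ ω, groupInd (M.G i ω) γ * f ω ∂μ = ∫ ω in {ω | M.G i ω = γ}, f ω ∂μ := by
  rw [groupInd_eq_indicator, integral_indicator (measurableSet_G_eq i γ)]

theorem integral_groupInd (γ : ℕ∞) : ∫ ω, groupInd (M.G 0 ω) γ ∂μ = M.p μ γ := by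
  have := integral_groupInd_mul (M := M) (μ := μ) (fun _ => 1) 0 γ
  simpa [p] using this

theorem isFeature_groupInd (γ : ℕ∞) : IsFeature μ M.obs fun i ω => groupInd (M.G i ω) γ := by
  refine ⟨?_, fun o => groupInd o.2 γ, (measurable_groupInd γ).comp measurable_snd,
    fun i ω => rfl⟩
  refine .of_bound ((measurable_groupInd γ).comp (M.measurable_G 0)).aestronglyMeasurable 1
    (ae_of_all _ fun ω => ?_)
  simp only [groupInd]
  split_ifs <;> simp

theorem isFeature_groupInd_mul (hmom : ∀ t ∈ Finset.Icc 1 T, MemLp (M.Y 0 t) 4 μ) (γ : ℕ∞) {t : ℕ}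
    (ht : t ∈ Finset.Icc 1 T) :
    IsFeature μ M.obs fun i ω => groupInd (M.G i ω) γ * M.Y i t ω := by
  refine ⟨?_, fun o => groupInd o.2 γ * o.1 ⟨t, ht⟩, ?_, fun i ω => rfl⟩
  · change MemLp (fun ω => groupInd (M.G 0 ω) γ * M.Y 0 t ω) 2 μ
    rw [groupInd_eq_indicator]
    exact ((hmom t ht).mono_exponent (by norm_num)).indicator (measurableSet_G_eq 0 γ)
  · exact ((measurable_groupInd γ).comp measurable_snd).mul
      ((measurable_pi_apply _).comp measurable_fst)

theorem isFeature_groupInd_mul_sub (hmom : ∀ t ∈ Finset.Icc 1 T, MemLp (M.Y 0 t) 4 μ) (γ : ℕ∞)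
    {t s : ℕ} (ht : t ∈ Finset.Icc 1 T) (hs : s ∈ Finset.Icc 1 T) :
    IsFeature μ M.obs fun i ω => groupInd (M.G i ω) γ * (M.Y i t ω - M.Y i s ω) := by
  simpa only [mul_sub] using (isFeature_groupInd_mul hmom γ ht).sub (isFeature_groupInd_mul hmom γ hs)

theorem isFeature_groupInd_mul_preDiff (hmom : ∀ t ∈ Finset.Icc 1 T, MemLp (M.Y 0 t) 4 μ)
    (γ : ℕ∞) {g : ℕ} (hg : g ≤ T) (j : Fin (g - 2)) :
    IsFeature μ M.obs fun i ω => groupInd (M.G i ω) γ * preDiff g (M.path i ω) j :=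
  isFeature_groupInd_mul_sub hmom γ (Finset.mem_Icc.2 (by omega)) (Finset.mem_Icc.2 (by omega))

theorem regressor_succ {g : ℕ} (Om : Matrix (Fin (g - 2)) (Fin R) ℝ) (y : ℕ → ℝ) (r : Fin R) :
    regressor g Om y r.succ = ∑ j, Om j r * preDiff g y j := rfl

theorem groupInd_mul_regressor_succ {g : ℕ} (Om : Matrix (Fin (g - 2)) (Fin R) ℝ) (y : ℕ → ℝ)
    (r : Fin R) (γ γ' : ℕ∞) :
    groupInd γ γ' * regressor g Om y r.succ =
      ∑ j, Om j r * (groupInd γ γ' * preDiff g y j) := by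
  rw [regressor_succ, Finset.mul_sum]
  exact Finset.sum_congr rfl fun j _ => by ring

/-- The regressor is linear in the entries of `Om`, so these serve as the estimated coefficients.
The mean is kept as an integral with `OmH n ω` frozen, so that population moment conditions can be
evaluated at the estimate. -/
theorem plugIn_groupInd_mul_regressor (hmom : ∀ t ∈ Finset.Icc 1 T, MemLp (M.Y 0 t) 4 μ)
    {g : ℕ} (hg : g ≤ T) {OmH : ℕ → Ω → Matrix (Fin (g - 2)) (Fin R) ℝ}
    {Om : Matrix (Fin (g - 2)) (Fin R) ℝ}
    (hOm : ∀ j k, Tendsto (fun p : ℕ × Ω => OmH p.1 p.2 j k) (probFilter μ) (𝓝 (Om j k)))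
    (γ : ℕ∞) (k : Fin (R + 1)) :
    PlugIn μ M.obs
      (fun n i ω => groupInd (M.G i ω) γ * regressor g (OmH n ω) (M.path i ω) k)
      (fun i ω => groupInd (M.G i ω) γ * regressor g Om (M.path i ω) k)
      (fun n ω => ∫ ω', groupInd (M.G 0 ω') γ * regressor g (OmH n ω) (M.path 0 ω') k ∂μ) := by
  refine Fin.cases ?_ (fun r => ?_) k
  · simpa [regressor] using PlugIn.of_isFeature (isFeature_groupInd (μ := μ) (M := M) γ)
  · simp_rw [groupInd_mul_regressor_succ]
    have hf := isFeature_groupInd_mul_preDiff hmom γ hg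
    have : ∀ n ω, ∫ ω', ∑ j, OmH n ω j r * (groupInd (M.G 0 ω') γ * preDiff g (M.path 0 ω') j) ∂μ =
        ∑ j, OmH n ω j r * ∫ ω', groupInd (M.G 0 ω') γ * preDiff g (M.path 0 ω') j ∂μ := by
      intro n ω
      rw [integral_finsetSum _ fun j _ => (hf j).integrable.const_mul _]
      simp_rw [integral_const_mul]
    simp_rw [this]
    exact PlugIn.sum _ fun j => .mul (hOm j r) (hf j)

/-! ### Identification -/

/-- Under unconfoundedness the idiosyncratic errors have mean zero in every group. -/
theorem integral_groupInd_mul_e (h_ife : M.InteractiveFixedEffects μ)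
    (h_errors : M.IdiosyncraticErrors μ) (h_unconf : M.Unconfounded μ) (γ : ℕ∞) {t : ℕ}
    (ht : t ∈ Finset.Icc 1 T) : ∫ ω, groupInd (M.G 0 ω) γ * M.e 0 t ω ∂μ = 0 := by
  obtain ⟨he, he0⟩ := h_errors 0 t ht
  obtain ⟨hY, hYc⟩ := h_unconf 0 t ht
  set Z : Ω → ℝ := fun ω => M.theta t + M.eta 0 ω + M.lam 0 ω ⬝ᵥ M.F t with hZ
  have hYZ : M.Y0 0 t =ᵐ[μ] Z + M.e 0 t := h_ife 0 t ht
  -- The systematic part is integrable as a difference of integrable variables; `η` alone need not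
  -- be examined.
  have hZi : Integrable Z μ := by
    refine (hY.sub he).congr ?_
    filter_upwards [hYZ] with ω hω
    simp [hω]
  have hle : M.sigmaHet 0 ≤ ‹MeasurableSpace Ω› :=
    ((M.measurable_eta 0).prodMk (M.measurable_lam 0)).comap_le
  have hle' : M.sigmaHetGroup 0 ≤ ‹MeasurableSpace Ω› :=
    ((M.measurable_eta 0).prodMk ((M.measurable_lam 0).prodMk (M.measurable_G 0))).comap_le
  have hZm : StronglyMeasurable[M.sigmaHet 0] Z := by
    have h1 : Measurable fun x : ℝ × (Fin R → ℝ) => M.theta t + x.1 + x.2 ⬝ᵥ M.F t := by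
      unfold dotProduct
      fun_prop
    exact (h1.comp (comap_measurable fun ω => (M.eta 0 ω, M.lam 0 ω))).stronglyMeasurable
  have h1 : μ[M.Y0 0 t | M.sigmaHet 0] =ᵐ[μ] Z := by
    have h2 := condExp_congr_ae (m := M.sigmaHet 0) hYZ
    have h3 := condExp_add (μ := μ) hZi he (M.sigmaHet 0)
    rw [condExp_of_stronglyMeasurable hle hZm hZi] at h3
    filter_upwards [h2, h3, he0] with ω a b c
    rw [a, b, Pi.add_apply, c]
    simp
  have hS : MeasurableSet[M.sigmaHetGroup 0] {ω | M.G 0 ω = γ} :=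
    ⟨{x | x.2.2 = γ}, measurable_snd.comp measurable_snd (measurableSet_singleton γ), rfl⟩
  rw [integral_groupInd_mul]
  -- Both conditional expectations of `Y0` equal `Z`. Integrating the one that also conditions on
  -- the group over `{G = γ}` shows that `Y0` and `Z` have the same integral there, which leaves
  -- zero for the error.
  have h4 := setIntegral_condExp hle' hY hS
  have h5 : ∫ ω in {ω | M.G 0 ω = γ}, (μ[M.Y0 0 t | M.sigmaHetGroup 0]) ω ∂μ =
      ∫ ω in {ω | M.G 0 ω = γ}, Z ω ∂μ :=
    integral_congr_ae (ae_restrict_of_ae (hYc.trans h1))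
  have h6 : ∫ ω in {ω | M.G 0 ω = γ}, M.Y0 0 t ω ∂μ =
      ∫ ω in {ω | M.G 0 ω = γ}, Z ω ∂μ + ∫ ω in {ω | M.G 0 ω = γ}, M.e 0 t ω ∂μ := by
    rw [← integral_add hZi.integrableOn he.integrableOn]
    exact integral_congr_ae (ae_restrict_of_ae hYZ)
  linarith

/-- Differencing cancels `η`. Only periods before `g` enter, so the model is needed only where the
unit is untreated. -/
theorem preDiff_add_mulVec {g : ℕ} {y θ e : ℕ → ℝ} {η : ℝ} {l : Fin R → ℝ}
    (hy : ∀ s ∈ Finset.Icc 1 (g - 1), y s = θ s + η + l ⬝ᵥ M.F s + e s) :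
    preDiff g y = preDiff g θ + M.dFpre g *ᵥ l + preDiff g e := by
  ext j
  have h1 := hy (j + 2) (Finset.mem_Icc.2 (by omega))
  have h2 := hy (j + 1) (Finset.mem_Icc.2 (by omega))
  have h3 : (M.dFpre g *ᵥ l) j = l ⬝ᵥ M.F (j + 2) - l ⬝ᵥ M.F (j + 1) := by
    rw [← dotProduct_sub, dotProduct_comm]
    rfl
  simp only [Pi.add_apply, h3, preDiff, h1, h2]
  ring

/-- Algebra of the interactive fixed effects model: the outcome change is a linear function of the
regressors up to `v`. -/
theorem sub_regressor_dotProduct_deltaStar {g t : ℕ} (hg : 2 ≤ g)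
    {Om : Matrix (Fin (g - 2)) (Fin R) ℝ} (hOm : IsUnit (Omᵀ * M.dFpre g).det) {y : ℕ → ℝ} {ω : Ω}
    (hpre : ∀ s ∈ Finset.Icc 1 (g - 1),
      y s = M.theta s + M.eta 0 ω + M.lam 0 ω ⬝ᵥ M.F s + M.e 0 s ω)
    (ht : y t = M.theta t + M.eta 0 ω + M.lam 0 ω ⬝ᵥ M.F t + M.e 0 t ω) :
    (y t - y (g - 1)) - regressor g Om y ⬝ᵥ M.deltaStar Om t = M.v Om t 0 ω := by
  have h1 := preDiff_add_mulVec (M := M) (g := g) (e := fun s => M.e 0 s ω) hpre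
  have h2 := hpre (g - 1) (Finset.mem_Icc.2 (by omega))
  have h3 : regressor g Om y ⬝ᵥ M.deltaStar Om t =
      M.thetaStar Om t + (M.F t - M.F (g - 1)) ⬝ᵥ (M.Hpre Om *ᵥ preDiff g y) := by
    simp only [regressor, deltaStar, dotProduct, Fin.sum_univ_succ, Fin.cons_zero, Fin.cons_succ,
      one_mul]
    congr 1
    change (Omᵀ *ᵥ preDiff g y) ⬝ᵥ M.FStar Om t =
      (M.F t - M.F (g - 1)) ⬝ᵥ (M.Hpre Om *ᵥ preDiff g y)
    rw [FStar, dotProduct_comm, ← Matrix.dotProduct_mulVec, Hpre, Matrix.mulVec_mulVec]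
  -- `Hpre` is a left inverse of `dFpre`: this is how the pre-treatment differences recover the
  -- loadings.
  have h4 : M.Hpre Om *ᵥ (M.dFpre g *ᵥ M.lam 0 ω) = M.lam 0 ω := by
    rw [Matrix.mulVec_mulVec, Hpre, Matrix.mul_assoc, Matrix.nonsing_inv_mul _ hOm,
      Matrix.one_mulVec]
  rw [h3, h1, Matrix.mulVec_add, Matrix.mulVec_add, h4, dotProduct_add, dotProduct_add, thetaStar,
    v, h2, ht, sub_dotProduct _ _ (M.lam 0 ω), dotProduct_comm (M.F t) (M.lam 0 ω),
    dotProduct_comm (M.F (g - 1)) (M.lam 0 ω)]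
  ring

theorem ae_groupInd_mul_pre (h_ant : M.NoAnticipation μ) (h_ife : M.InteractiveFixedEffects μ)
    {t : ℕ} (ht : t ≤ T) : ∀ᵐ ω ∂μ, ∀ s ∈ Finset.Icc 1 t, (s : ℕ∞) < M.G 0 ω →
      M.Y 0 s ω = M.theta s + M.eta 0 ω + M.lam 0 ω ⬝ᵥ M.F s + M.e 0 s ω := by
  rw [ae_all_iff]
  intro s
  rw [ae_all_iff]
  intro hs
  have hs' : s ∈ Finset.Icc 1 T := Finset.mem_Icc.2 (by have := Finset.mem_Icc.1 hs; omega)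
  filter_upwards [h_ant 0 s hs', h_ife 0 s hs'] with ω h1 h2 h3
  rw [h1 h3, h2]

/-- `v` is a fixed linear combination of the errors, so integrability and zero group means both pass
to it. -/
theorem integrable_v (h_errors : M.IdiosyncraticErrors μ) {g t : ℕ} (hg : 2 ≤ g) (hgT : g ≤ T)
    (ht : t ∈ Finset.Icc 1 T) (Om : Matrix (Fin (g - 2)) (Fin R) ℝ) :
    Integrable (M.v Om t 0) μ ∧
      ((∀ s ∈ Finset.Icc 1 T, ∀ γ, ∫ ω, groupInd (M.G 0 ω) γ * M.e 0 s ω ∂μ = 0) →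
        ∀ γ, ∫ ω, groupInd (M.G 0 ω) γ * M.v Om t 0 ω ∂μ = 0) := by
  have he : ∀ s ∈ Finset.Icc 1 T, Integrable (M.e 0 s) μ := fun s hs => (h_errors 0 s hs).1
  have hg1 : g - 1 ∈ Finset.Icc 1 T := Finset.mem_Icc.2 (by omega)
  have hj2 : ∀ j : Fin (g - 2), (j : ℕ) + 2 ∈ Finset.Icc 1 T := fun j =>
    Finset.mem_Icc.2 (by omega)
  have hj1 : ∀ j : Fin (g - 2), (j : ℕ) + 1 ∈ Finset.Icc 1 T := fun j =>
    Finset.mem_Icc.2 (by omega)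
  have hv : ∀ ω, M.v Om t 0 ω = (M.e 0 t ω - M.e 0 (g - 1) ω) -
      ∑ j, ((M.F t - M.F (g - 1)) ᵥ* M.Hpre Om) j * (M.e 0 (j + 2) ω - M.e 0 (j + 1) ω) := by
    intro ω
    rw [v, Matrix.dotProduct_mulVec]
    rfl
  refine ⟨?_, fun h0 γ => ?_⟩
  · have : M.v Om t 0 = fun ω => _ := funext hv
    rw [this]
    exact ((he t ht).sub (he _ hg1)).sub (integrable_finsetSum _ fun j _ =>
      ((he _ (hj2 j)).sub (he _ (hj1 j))).const_mul _)
  · have e1 : ∀ ω, groupInd (M.G 0 ω) γ * M.v Om t 0 ω =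
        (groupInd (M.G 0 ω) γ * M.e 0 t ω - groupInd (M.G 0 ω) γ * M.e 0 (g - 1) ω) -
        ∑ j, ((M.F t - M.F (g - 1)) ᵥ* M.Hpre Om) j * (groupInd (M.G 0 ω) γ * M.e 0 (j + 2) ω -
          groupInd (M.G 0 ω) γ * M.e 0 (j + 1) ω) := by
      intro ω
      rw [hv, mul_sub, mul_sub, Finset.mul_sum]
      congr 1
      exact Finset.sum_congr rfl fun j _ => by ring
    have hi : ∀ s ∈ Finset.Icc 1 T, Integrable (fun ω => groupInd (M.G 0 ω) γ * M.e 0 s ω) μ :=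
      fun s hs => integrable_groupInd_mul (he s hs) 0 γ
    have hi2 : ∀ j : Fin (g - 2), Integrable (fun ω =>
        ((M.F t - M.F (g - 1)) ᵥ* M.Hpre Om) j * (groupInd (M.G 0 ω) γ * M.e 0 (j + 2) ω -
          groupInd (M.G 0 ω) γ * M.e 0 (j + 1) ω)) μ := fun j =>
      ((hi _ (hj2 j)).sub (hi _ (hj1 j))).const_mul _
    simp_rw [e1]
    rw [integral_sub (by exact (hi t ht).sub (hi _ hg1)) (integrable_finsetSum _ fun j _ => hi2 j),
      integral_sub (hi t ht) (hi _ hg1), h0 t ht, h0 _ hg1,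
      integral_finsetSum _ fun j _ => hi2 j]
    simp only [integral_const_mul, sub_self, zero_sub, neg_eq_zero]
    refine Finset.sum_eq_zero fun j _ => ?_
    rw [integral_sub (hi _ (hj2 j)) (hi _ (hj1 j)), h0 _ (hj2 j), h0 _ (hj1 j)]
    simp

/-- In groups treated no earlier than `g`, the outcome change net of the regression function
is the treatment effect plus `v`. -/
theorem ae_groupInd_mul_sub_regressor (h_ant : M.NoAnticipation μ)
    (h_ife : M.InteractiveFixedEffects μ) {g t : ℕ} (hg : 2 ≤ g) (hgT : g ≤ T)
    (hgt : g ≤ t) (ht : t ∈ Finset.Icc 1 T) {Om : Matrix (Fin (g - 2)) (Fin R) ℝ}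
    (hOm : IsUnit (Omᵀ * M.dFpre g).det) {γ : ℕ∞} (hγ : (g : ℕ∞) ≤ γ) :
    ∀ᵐ ω ∂μ, groupInd (M.G 0 ω) γ *
      ((M.Y 0 t ω - M.Y 0 (g - 1) ω) - regressor g Om (M.path 0 ω) ⬝ᵥ M.deltaStar Om t) =
      groupInd (M.G 0 ω) γ * (M.Y 0 t ω - M.Y0 0 t ω) +
        groupInd (M.G 0 ω) γ * M.v Om t 0 ω := by
  filter_upwards [ae_groupInd_mul_pre h_ant h_ife (t := g - 1) (by omega), h_ife 0 t ht]
    with ω hpre h0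
  by_cases hG : M.G 0 ω = γ
  swap; · simp [groupInd, hG]
  have hlt : ∀ s ∈ Finset.Icc 1 (g - 1), (s : ℕ∞) < M.G 0 ω := by
    intro s hs
    have : s < g := by have := Finset.mem_Icc.1 hs; omega
    rw [hG]
    exact lt_of_lt_of_le (by exact_mod_cast this) hγ
  -- The hybrid path is untreated at `t` and observed elsewhere. As `t ≥ g`, changing period `t`
  -- affects neither the pre-treatment differences nor the base period `g - 1`, so one argument
  -- serves both group `g` and the comparison groups.
  let y : ℕ → ℝ := fun s => if s = t then M.Y0 0 t ω else M.Y 0 s ω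
  have hne : ∀ s ∈ Finset.Icc 1 (g - 1), s ≠ t := fun s hs => by
    have := Finset.mem_Icc.1 hs; omega
  have h1 := sub_regressor_dotProduct_deltaStar (M := M) (t := t) hg hOm (y := y)
    (ω := ω) (fun s hs => by simp only [y, if_neg (hne s hs)]; exact hpre s hs (hlt s hs))
    (by simpa [y] using h0)
  have h2 : preDiff g y = preDiff g (M.path 0 ω) := by
    ext j
    simp only [preDiff, y, path]
    rw [if_neg (hne _ (Finset.mem_Icc.2 (by omega))),
      if_neg (hne _ (Finset.mem_Icc.2 (by omega)))]
  have h3 : regressor g Om y = regressor g Om (M.path 0 ω) := by rw [regressor, regressor, h2]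
  rw [h3] at h1
  simp only [y, if_true, if_neg (hne (g - 1) (Finset.mem_Icc.2 (by omega)))] at h1
  simp only [groupInd, hG, if_true, one_mul, ← h1]
  ring

end StaggeredPanel

namespace StaggeredPanel

variable {Ω : Type*} [MeasurableSpace Ω] {μ : Measure Ω} [IsProbabilityMeasure μ] {T R : ℕ}
  {M : StaggeredPanel Ω T R}

theorem isFeature_groupInd_mul_regressor (hmom : ∀ t ∈ Finset.Icc 1 T, MemLp (M.Y 0 t) 4 μ)
    {g : ℕ} (hg : g ≤ T) (Om : Matrix (Fin (g - 2)) (Fin R) ℝ) (γ : ℕ∞) (k : Fin (R + 1)) :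
    IsFeature μ M.obs fun i ω => groupInd (M.G i ω) γ * regressor g Om (M.path i ω) k :=
  (plugIn_groupInd_mul_regressor hmom hg (OmH := fun _ _ => Om) (Om := Om)
    (fun _ _ => tendsto_const_nhds) γ k).isFeature

/-- The moment conditions, for any valid weighting of the pre-treatment periods. -/
theorem integral_groupInd_mul_sub_regressor (h_ant : M.NoAnticipation μ)
    (h_ife : M.InteractiveFixedEffects μ) (h_errors : M.IdiosyncraticErrors μ)
    (h_unconf : M.Unconfounded μ) (hmom : ∀ t ∈ Finset.Icc 1 T, MemLp (M.Y 0 t) 4 μ)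
    {g t : ℕ} (hg : 2 ≤ g) (hgT : g ≤ T) (hgt : g ≤ t) (ht : t ∈ Finset.Icc 1 T)
    {Om : Matrix (Fin (g - 2)) (Fin R) ℝ} (hOm : IsUnit (Omᵀ * M.dFpre g).det) {γ : ℕ∞}
    (hγ : (g : ℕ∞) ≤ γ) :
    ∫ ω, groupInd (M.G 0 ω) γ * (M.Y 0 t ω - M.Y 0 (g - 1) ω) ∂μ -
      (fun k => ∫ ω, groupInd (M.G 0 ω) γ * regressor g Om (M.path 0 ω) k ∂μ) ⬝ᵥ
        M.deltaStar Om t = ∫ ω, groupInd (M.G 0 ω) γ * (M.Y 0 t ω - M.Y0 0 t ω) ∂μ := by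
  have hg1 : g - 1 ∈ Finset.Icc 1 T := Finset.mem_Icc.2 (by omega)
  have hi1 := (isFeature_groupInd_mul_sub hmom γ ht hg1).integrable
  have hi2 := fun k => (isFeature_groupInd_mul_regressor hmom hgT Om γ k).integrable
  have hi3 : Integrable (fun ω => groupInd (M.G 0 ω) γ * (M.Y 0 t ω - M.Y0 0 t ω)) μ :=
    integrable_groupInd_mul (((hmom t ht).integrable (by norm_num)).sub (h_unconf 0 t ht).1) 0 γ
  obtain ⟨hv, hv0⟩ := integrable_v (M := M) h_errors hg hgT ht Om
  have hi4 := integrable_groupInd_mul (M := M) hv 0 γ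
  have h0 := hv0 (fun s hs γ => integral_groupInd_mul_e h_ife h_errors h_unconf γ hs) γ
  have h1 := integral_congr_ae
    (ae_groupInd_mul_sub_regressor h_ant h_ife hg hgT hgt ht hOm hγ)
  rw [integral_add hi3 hi4, h0, add_zero] at h1
  rw [← h1]
  have e : ∀ ω, groupInd (M.G 0 ω) γ *
      ((M.Y 0 t ω - M.Y 0 (g - 1) ω) - regressor g Om (M.path 0 ω) ⬝ᵥ M.deltaStar Om t) =
      groupInd (M.G 0 ω) γ * (M.Y 0 t ω - M.Y 0 (g - 1) ω) -
        ∑ k, groupInd (M.G 0 ω) γ * regressor g Om (M.path 0 ω) k * M.deltaStar Om t k := by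
    intro ω
    rw [mul_sub, dotProduct, Finset.mul_sum]
    simp_rw [mul_assoc]
  simp_rw [e]
  rw [integral_sub hi1 (integrable_finsetSum _ fun k _ => (hi2 k).mul_const _),
    integral_finsetSum _ fun k _ => (hi2 k).mul_const _]
  simp_rw [integral_mul_const]
  rfl

theorem integral_groupInd_mul_effect_of_lt (h_ant : M.NoAnticipation μ) {t : ℕ}
    (ht : t ∈ Finset.Icc 1 T) {γ : ℕ∞} (hγ : (t : ℕ∞) < γ) :
    ∫ ω, groupInd (M.G 0 ω) γ * (M.Y 0 t ω - M.Y0 0 t ω) ∂μ = 0 := by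
  rw [integral_eq_zero_of_ae]
  filter_upwards [h_ant 0 t ht] with ω hω
  by_cases hG : M.G 0 ω = γ
  · simp [hω (hG ▸ hγ)]
  · simp [groupInd, hG]

theorem integral_groupInd_mul_effect {g t : ℕ} (hp : 0 < M.p μ g) :
    ∫ ω, groupInd (M.G 0 ω) g * (M.Y 0 t ω - M.Y0 0 t ω) ∂μ = M.p μ g * M.ATT μ g t := by
  rw [integral_groupInd_mul, ATT, ProbabilityTheory.cond, integral_smul_measure]
  have h1 : ∫ ω in {ω | M.G 0 ω = g}, (M.Y 0 t ω - M.Y0 0 t ω) ∂μ =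
      ∫ ω in {ω | M.G 0 ω = g}, (M.Ypot 0 t g ω - M.Y0 0 t ω) ∂μ := by
    refine setIntegral_congr_fun (measurableSet_G_eq 0 g) fun ω hω => ?_
    simp only [Set.mem_ofPred_eq] at hω
    simp only [Y, hω]
  rw [h1, ENNReal.toReal_inv, smul_eq_mul, ← mul_assoc]
  change _ = M.p μ g * (M.p μ g)⁻¹ * _
  rw [mul_inv_cancel₀ hp.ne', one_mul]

theorem Gam_apply {g : ℕ} (Om : Matrix (Fin (g - 2)) (Fin R) ℝ) (t : ℕ) (g' : M.comp μ t)
    (k : Fin (R + 1)) : M.Gam μ Om t g' k =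
      (M.p μ g')⁻¹ * ∫ ω, groupInd (M.G 0 ω) g' * regressor g Om (M.path 0 ω) k ∂μ := by
  rw [← integral_const_mul, Gam, Matrix.of_apply]
  refine integral_congr_ae (ae_of_all _ fun ω => ?_)
  simp only [ell]
  ring

theorem lt_of_mem_comp {t : ℕ} {γ : ℕ∞} (h : γ ∈ M.comp μ t) : (t : ℕ∞) < γ :=
  (Finset.mem_filter.1 h).2

theorem p_pos_of_mem_comp {t : ℕ} {γ : ℕ∞} (h : γ ∈ M.comp μ t) : 0 < M.p μ γ :=
  (Finset.mem_filter.1 (Finset.mem_filter.1 h).1).2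

theorem integral_ell_mul_sub (h_ant : M.NoAnticipation μ)
    (h_ife : M.InteractiveFixedEffects μ) (h_errors : M.IdiosyncraticErrors μ)
    (h_unconf : M.Unconfounded μ) (hmom : ∀ t ∈ Finset.Icc 1 T, MemLp (M.Y 0 t) 4 μ)
    {g t : ℕ} (hg : 2 ≤ g) (hgT : g ≤ T) (hgt : g ≤ t) (ht : t ∈ Finset.Icc 1 T)
    {Om : Matrix (Fin (g - 2)) (Fin R) ℝ} (hOm : IsUnit (Omᵀ * M.dFpre g).det)
    (g' : M.comp μ t) :
    ∫ ω, groupInd (M.G 0 ω) g' * (M.Y 0 t ω - M.Y 0 (g - 1) ω) ∂μ =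
      (fun k => ∫ ω, groupInd (M.G 0 ω) g' * regressor g Om (M.path 0 ω) k ∂μ) ⬝ᵥ
        M.deltaStar Om t := by
  have hlt := lt_of_mem_comp g'.2
  have hle : (g : ℕ∞) ≤ g' := le_trans (by exact_mod_cast hgt) hlt.le
  have := integral_groupInd_mul_sub_regressor h_ant h_ife h_errors h_unconf hmom hg hgT hgt ht hOm
    hle
  rw [integral_groupInd_mul_effect_of_lt h_ant ht hlt] at this
  linarith

theorem integral_dY_sub (h_ant : M.NoAnticipation μ)
    (h_ife : M.InteractiveFixedEffects μ) (h_errors : M.IdiosyncraticErrors μ)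
    (h_unconf : M.Unconfounded μ) (hmom : ∀ t ∈ Finset.Icc 1 T, MemLp (M.Y 0 t) 4 μ)
    {g t : ℕ} (hg : 2 ≤ g) (hgT : g ≤ T) (hgt : g ≤ t) (ht : t ∈ Finset.Icc 1 T)
    {Om : Matrix (Fin (g - 2)) (Fin R) ℝ} (hOm : IsUnit (Omᵀ * M.dFpre g).det)
    (hp : 0 < M.p μ g) :
    ∫ ω, M.dY g t 0 ω ∂μ - M.meanA μ Om ⬝ᵥ M.deltaStar Om t = M.p μ g * M.ATT μ g t := by
  rw [← integral_groupInd_mul_effect hp]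
  exact integral_groupInd_mul_sub_regressor h_ant h_ife h_errors h_unconf hmom hg hgT hgt ht hOm
    le_rfl

/-! ### The moment matrix has full column rank -/

theorem LamComp_apply (t : ℕ) (g' : M.comp μ t) (k : Fin (R + 1)) : M.LamComp μ t g' k =
      (M.p μ g')⁻¹ * ∫ ω, groupInd (M.G 0 ω) g' * (Fin.cons 1 (M.lam 0 ω) : Fin (R + 1) → ℝ) k ∂μ
      := by
  rw [← integral_const_mul, LamComp, Matrix.of_apply]
  refine integral_congr_ae (ae_of_all _ fun ω => ?_)
  simp only [ell]
  ring

/-- The errors average out within the group, so observed pre-treatment differences have means affine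
in the loading means. This ties `Gam` to `LamComp`. -/
theorem integral_groupInd_mul_preDiff (h_ant : M.NoAnticipation μ)
    (h_ife : M.InteractiveFixedEffects μ) (h_errors : M.IdiosyncraticErrors μ)
    (h_unconf : M.Unconfounded μ) (hlam : Integrable (M.lam 0) μ)
    {g : ℕ} (hgT : g ≤ T) {γ : ℕ∞} (hγ : (g : ℕ∞) ≤ γ) (j : Fin (g - 2)) :
    ∫ ω, groupInd (M.G 0 ω) γ * preDiff g (M.path 0 ω) j ∂μ =
      preDiff g M.theta j * M.p μ γ +
        ∑ s, M.dFpre g j s * ∫ ω, groupInd (M.G 0 ω) γ * M.lam 0 ω s ∂μ := by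
  have hj2 : (j : ℕ) + 2 ∈ Finset.Icc 1 T := Finset.mem_Icc.2 (by omega)
  have hj1 : (j : ℕ) + 1 ∈ Finset.Icc 1 T := Finset.mem_Icc.2 (by omega)
  have hae : ∀ᵐ ω ∂μ, groupInd (M.G 0 ω) γ * preDiff g (M.path 0 ω) j =
      preDiff g M.theta j * groupInd (M.G 0 ω) γ +
      ∑ s, M.dFpre g j s * (groupInd (M.G 0 ω) γ * M.lam 0 ω s) +
      (groupInd (M.G 0 ω) γ * M.e 0 (j + 2) ω - groupInd (M.G 0 ω) γ * M.e 0 (j + 1) ω) := by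
    filter_upwards [ae_groupInd_mul_pre h_ant h_ife (t := g - 1) (by omega)] with ω hpre
    by_cases hG : M.G 0 ω = γ
    swap; · simp [groupInd, hG]
    have h1 := preDiff_add_mulVec (M := M) (g := g) (y := M.path 0 ω) (e := fun s => M.e 0 s ω)
      (fun s hs => hpre s hs (by
        have : s < g := by have := Finset.mem_Icc.1 hs; omega
        rw [hG]
        exact lt_of_lt_of_le (by exact_mod_cast this) hγ))
    have h2 := congrFun h1 j
    simp only [Pi.add_apply, Matrix.mulVec, dotProduct] at h2
    simp only [groupInd, hG, if_true, one_mul, mul_one]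
    rw [h2]
    simp [preDiff]
  have hG := (isFeature_groupInd (μ := μ) (M := M) γ).integrable
  have hl : ∀ s, Integrable (fun ω => groupInd (M.G 0 ω) γ * M.lam 0 ω s) μ := fun s =>
    integrable_groupInd_mul (hlam.eval s) 0 γ
  have he2 := integrable_groupInd_mul (M := M) (h_errors 0 _ hj2).1 0 γ
  have he1 := integrable_groupInd_mul (M := M) (h_errors 0 _ hj1).1 0 γ
  rw [integral_congr_ae hae, integral_add (by
      exact (hG.const_mul _).add (integrable_finsetSum _ fun s _ => (hl s).const_mul _))
      (by exact he2.sub he1),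
    integral_add (hG.const_mul _) (integrable_finsetSum _ fun s _ => (hl s).const_mul _),
    integral_const_mul, integral_groupInd, integral_finsetSum _ fun s _ => (hl s).const_mul _,
    integral_sub he2 he1, integral_groupInd_mul_e h_ife h_errors h_unconf γ hj2,
    integral_groupInd_mul_e h_ife h_errors h_unconf γ hj1]
  simp_rw [integral_const_mul]
  ring

theorem mulVec_injective_of_rank_eq {κ : Type*} [Fintype κ] {k : ℕ} {A : Matrix κ (Fin k) ℝ}
    (h : A.rank = k) : Function.Injective A.mulVec := by
  rw [Matrix.mulVec_injective_iff]
  rw [linearIndependent_iff_card_eq_finrank_span, Set.finrank, ← Matrix.rank_eq_finrank_span_cols, h,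
    Fintype.card_fin]

/-- `Gam` factors as `LamComp` times a triangular matrix with diagonal blocks `1` and `(Omᵀ *
dFpre)ᵀ`. The first factor is injective by the loading condition, the second because `Omᵀ * dFpre`
is invertible. -/
theorem mulVec_Gam_injective (h_ant : M.NoAnticipation μ)
    (h_ife : M.InteractiveFixedEffects μ) (h_errors : M.IdiosyncraticErrors μ)
    (h_unconf : M.Unconfounded μ) (hmom : ∀ t ∈ Finset.Icc 1 T, MemLp (M.Y 0 t) 4 μ)
    (hlam : Integrable (M.lam 0) μ) {g t : ℕ} (hrank : (M.LamComp μ t).rank = R + 1)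
    (hgT : g ≤ T) (hgt : g ≤ t)
    {Om : Matrix (Fin (g - 2)) (Fin R) ℝ} (hOm : IsUnit (Omᵀ * M.dFpre g).det) :
    Function.Injective (M.Gam μ Om t).mulVec := by
  have hLam := mulVec_injective_of_rank_eq hrank
  -- `L` rewrites coefficients on `(1, Om'ΔY^pre)` as coefficients on `(1, λ)`: the intercept
  -- absorbs the time effects, the slopes pass through `(Om'ΔF^pre)'`.
  let L : (Fin (R + 1) → ℝ) → Fin (R + 1) → ℝ := fun x =>
    Fin.cons (x 0 + ∑ r : Fin R, (Omᵀ *ᵥ preDiff g M.theta) r * x r.succ)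
      ((Omᵀ * M.dFpre g)ᵀ *ᵥ fun r => x r.succ)
  have hGam0 : ∀ g' : M.comp μ t, M.Gam μ Om t g' 0 = 1 := by
    intro g'
    rw [Gam_apply]
    simp only [regressor, Fin.cons_zero, mul_one]
    rw [integral_groupInd, inv_mul_cancel₀ (p_pos_of_mem_comp g'.2).ne']
  have hLam0 : ∀ g' : M.comp μ t, M.LamComp μ t g' 0 = 1 := by
    intro g'
    rw [LamComp_apply]
    simp only [Fin.cons_zero, mul_one]
    rw [integral_groupInd, inv_mul_cancel₀ (p_pos_of_mem_comp g'.2).ne']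
  have hGamS : ∀ (g' : M.comp μ t) (r : Fin R), M.Gam μ Om t g' r.succ =
      (Omᵀ *ᵥ preDiff g M.theta) r + ∑ s : Fin R, (Omᵀ * M.dFpre g) r s *
        M.LamComp μ t g' s.succ := by
    intro g' r
    have hle : (g : ℕ∞) ≤ g' := le_trans (by exact_mod_cast hgt) (lt_of_mem_comp g'.2).le
    have hp := (p_pos_of_mem_comp g'.2).ne'
    rw [Gam_apply]
    simp_rw [groupInd_mul_regressor_succ]
    rw [integral_finsetSum _ fun j _ =>
      (isFeature_groupInd_mul_preDiff hmom (g' : ℕ∞) hgT j).integrable.const_mul _]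
    simp_rw [integral_const_mul,
      integral_groupInd_mul_preDiff h_ant h_ife h_errors h_unconf hlam hgT hle, LamComp_apply,
      Fin.cons_succ, Matrix.mulVec, dotProduct, Matrix.mul_apply, Matrix.transpose_apply]
    simp_rw [mul_add, Finset.sum_add_distrib, mul_add, Finset.mul_sum, Finset.sum_mul]
    congr 1
    · refine Finset.sum_congr rfl fun j _ => ?_
      field_simp
    · rw [Finset.sum_comm]
      refine Finset.sum_congr rfl fun s _ => Finset.sum_congr rfl fun j _ => ?_
      ring
  have hmul : ∀ x, M.Gam μ Om t *ᵥ x = M.LamComp μ t *ᵥ L x := by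
    intro x
    ext g'
    simp only [Matrix.mulVec, dotProduct, Fin.sum_univ_succ, hGam0, hLam0, hGamS, L,
      Fin.cons_zero, Fin.cons_succ, one_mul, add_mul, Finset.sum_add_distrib, add_assoc,
      Matrix.transpose_apply, Finset.sum_mul, Finset.mul_sum]
    congr 2
    rw [Finset.sum_comm]
    exact Finset.sum_congr rfl fun s _ => Finset.sum_congr rfl fun r _ => by ring
  intro x x' hx
  have hL : L x = L x' := hLam (by
    change M.LamComp μ t *ᵥ L x = M.LamComp μ t *ᵥ L x'
    rw [← hmul, ← hmul]
    exact hx)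
  have hunit : IsUnit (Omᵀ * M.dFpre g)ᵀ := by
    rw [Matrix.isUnit_iff_isUnit_det, Matrix.det_transpose]
    exact hOm
  -- The triangular form is solved from the slopes, which determine the intercept.
  have hS : (fun r : Fin R => x r.succ) = fun r => x' r.succ := by
    refine Matrix.mulVec_injective_of_isUnit hunit ?_
    ext s
    have := congrFun hL s.succ
    simpa [L] using this
  have h0 := congrFun hL 0
  simp only [L, Fin.cons_zero] at h0
  have hS' : ∀ r : Fin R, x r.succ = x' r.succ := congrFun hS
  simp_rw [hS'] at h0
  ext k
  refine Fin.cases ?_ hS' k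
  linarith

theorem isUnit_det_transpose_mul_mul {κ : Type*} [Fintype κ] {k : ℕ} {A : Matrix κ (Fin k) ℝ}
    {W : Matrix κ κ ℝ} (hW : W.PosDef) (hA : Function.Injective A.mulVec) :
    IsUnit (Aᵀ * W * A).det := by
  have h := hW.conjTranspose_mul_mul_same hA
  rw [Matrix.conjTranspose_eq_transpose_of_trivial] at h
  exact (Matrix.isUnit_iff_isUnit_det _).1 h.isUnit

theorem gmmMatrix_mul {κ : Type*} [Fintype κ] {k : ℕ} {A : Matrix κ (Fin k) ℝ}
    {W : Matrix κ κ ℝ} (h : IsUnit (Aᵀ * W * A).det) : gmmMatrix A W * A = 1 := by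
  rw [gmmMatrix, Matrix.mul_assoc, Matrix.mul_assoc, ← Matrix.mul_assoc Aᵀ,
    Matrix.nonsing_inv_mul _ h]

end StaggeredPanel

/-! ### Limits of matrices and of plug-in means -/

theorem tendsto_matrix_iff {ι a b : Type*} {l : Filter ι} {A : ι → Matrix a b ℝ}
    {A₀ : Matrix a b ℝ} :
    Tendsto A l (𝓝 A₀) ↔ ∀ j k, Tendsto (fun i => A i j k) l (𝓝 (A₀ j k)) := by
  refine tendsto_pi_nhds.trans (forall_congr' fun j => ?_)
  exact tendsto_pi_nhds

theorem Filter.Tendsto.matrix_mul {ι a b c : Type*} [Fintype b] {l : Filter ι}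
    {A : ι → Matrix a b ℝ} {A₀ : Matrix a b ℝ} {B : ι → Matrix b c ℝ} {B₀ : Matrix b c ℝ}
    (hA : Tendsto A l (𝓝 A₀)) (hB : Tendsto B l (𝓝 B₀)) :
    Tendsto (fun i => A i * B i) l (𝓝 (A₀ * B₀)) :=
  ((by fun_prop : Continuous fun p : Matrix a b ℝ × Matrix b c ℝ => p.1 * p.2).tendsto
    (A₀, B₀)).comp (hA.prodMk_nhds hB)

theorem Filter.Tendsto.matrix_mulVec {ι a b : Type*} [Fintype b] {l : Filter ι}
    {A : ι → Matrix a b ℝ} {A₀ : Matrix a b ℝ} {x : ι → b → ℝ} {x₀ : b → ℝ}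
    (hA : Tendsto A l (𝓝 A₀)) (hx : Tendsto x l (𝓝 x₀)) :
    Tendsto (fun i => A i *ᵥ x i) l (𝓝 (A₀ *ᵥ x₀)) :=
  ((by fun_prop : Continuous fun p : Matrix a b ℝ × (b → ℝ) => p.1 *ᵥ p.2).tendsto
    (A₀, x₀)).comp (hA.prodMk_nhds hx)

theorem Filter.Tendsto.dotProduct {ι b : Type*} [Fintype b] {l : Filter ι}
    {x y : ι → b → ℝ} {x₀ y₀ : b → ℝ} (hx : Tendsto x l (𝓝 x₀)) (hy : Tendsto y l (𝓝 y₀)) :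
    Tendsto (fun i => x i ⬝ᵥ y i) l (𝓝 (x₀ ⬝ᵥ y₀)) :=
  ((by fun_prop : Continuous fun p : (b → ℝ) × (b → ℝ) => p.1 ⬝ᵥ p.2).tendsto
    (x₀, y₀)).comp (hx.prodMk_nhds hy)

/-- The inverse is `det⁻¹` times the adjugate, which is continuous where the determinant is nonzero;
the default value at singular matrices plays no part in the limit. -/
theorem Filter.Tendsto.matrix_inv {ι a : Type*} [Fintype a] [DecidableEq a] {l : Filter ι}
    {A : ι → Matrix a a ℝ} {A₀ : Matrix a a ℝ} (hA : Tendsto A l (𝓝 A₀)) (h : IsUnit A₀.det) :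
    Tendsto (fun i => (A i)⁻¹) l (𝓝 A₀⁻¹) := by
  simp_rw [Matrix.inv_def, Ring.inverse_eq_inv']
  refine Tendsto.smul (Tendsto.inv₀ ?_ h.ne_zero) ?_
  · exact ((by fun_prop : Continuous fun B : Matrix a a ℝ => B.det).tendsto _).comp hA
  · exact ((by fun_prop : Continuous fun B : Matrix a a ℝ => B.adjugate).tendsto _).comp hA

theorem Filter.Tendsto.matrix_transpose {ι a b : Type*} {l : Filter ι}
    {A : ι → Matrix a b ℝ} {A₀ : Matrix a b ℝ} (hA : Tendsto A l (𝓝 A₀)) :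
    Tendsto (fun i => (A i)ᵀ) l (𝓝 A₀ᵀ) :=
  ((by fun_prop : Continuous fun B : Matrix a b ℝ => Bᵀ).tendsto _).comp hA

theorem Filter.Tendsto.eventually_isUnit_det {ι a : Type*} [Fintype a] [DecidableEq a]
    {l : Filter ι} {A : ι → Matrix a a ℝ} {A₀ : Matrix a a ℝ} (hA : Tendsto A l (𝓝 A₀))
    (h : IsUnit A₀.det) : ∀ᶠ i in l, IsUnit (A i).det := by
  have := ((by fun_prop : Continuous fun B : Matrix a a ℝ => B.det).tendsto _).comp hA
  filter_upwards [this.eventually_ne h.ne_zero] with i hi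
  exact isUnit_iff_ne_zero.2 hi

/-- Gives uniqueness of limits in probability, from which the mean of the influence function is
later read off. -/
instance probFilter_neBot {Ω : Type*} [MeasurableSpace Ω] {μ : Measure Ω}
    [IsProbabilityMeasure μ] : (probFilter μ).NeBot := by
  refine ⟨fun h => ?_⟩
  have : (∅ : Set (ℕ × Ω)) ∈ probFilter μ := h ▸ mem_bot
  rw [mem_probFilter] at this
  simp only [Set.mem_empty_iff_false, not_false_eq_true, Set.ofPred_true, measure_univ] at this
  exact one_ne_zero (tendsto_nhds_unique tendsto_const_nhds this)

/-- If the frozen-coefficient means vanish with probability tending to one, this limit forces the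
limiting combination to be centred. -/
theorem PlugIn.tendsto_mean {Ω O : Type*} [MeasurableSpace Ω] [MeasurableSpace O] {μ : Measure Ω}
    [IsProbabilityMeasure μ] {X : ℕ → Ω → O} {V : ℕ → ℕ → Ω → ℝ} {U : ℕ → Ω → ℝ}
    {m : ℕ → Ω → ℝ} (h : PlugIn μ X V U m) :
    Tendsto (fun p : ℕ × Ω => m p.1 p.2) (probFilter μ) (𝓝 (∫ ω, U 0 ω ∂μ)) := by
  induction h with
  | mul hb hU =>
    rw [integral_const_mul]
    exact hb.mul_const _
  | add h h' ih ih' =>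
    rw [integral_add h.isFeature.integrable h'.isFeature.integrable]
    exact ih.add ih'

theorem PlugIn.dotProduct_mulVec {Ω O κ κ' : Type*} [MeasurableSpace Ω] [MeasurableSpace O]
    [Fintype κ] [Fintype κ'] {μ : Measure Ω} [IsFiniteMeasure μ] {X : ℕ → Ω → O}
    {aH : ℕ → Ω → κ' → ℝ} {a : κ' → ℝ}
    (ha : Tendsto (fun p : ℕ × Ω => aH p.1 p.2) (probFilter μ) (𝓝 a))
    {BH : ℕ → Ω → Matrix κ' κ ℝ} {B : Matrix κ' κ ℝ}
    (hB : Tendsto (fun p : ℕ × Ω => BH p.1 p.2) (probFilter μ) (𝓝 B))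
    {V : ℕ → ℕ → Ω → κ → ℝ} {U : ℕ → Ω → κ → ℝ} {m : ℕ → Ω → κ → ℝ}
    (h : ∀ k, PlugIn μ X (fun n i ω => V n i ω k) (fun i ω => U i ω k) fun n ω => m n ω k) :
    PlugIn μ X (fun n i ω => aH n ω ⬝ᵥ (BH n ω *ᵥ V n i ω)) (fun i ω => a ⬝ᵥ (B *ᵥ U i ω))
      (fun n ω => aH n ω ⬝ᵥ (BH n ω *ᵥ m n ω)) :=
  PlugIn.dotProduct (V := fun n i ω => BH n ω *ᵥ V n i ω) (U := fun i ω => B *ᵥ U i ω)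
    (m := fun n ω => BH n ω *ᵥ m n ω) (tendsto_pi_nhds.1 ha) fun k =>
    PlugIn.mulVec (tendsto_matrix_iff.1 hB) h k

/-! ### Regular pairs and consistency of the estimators. -/

namespace StaggeredPanel

variable {Ω : Type*} [MeasurableSpace Ω] {μ : Measure Ω} [IsProbabilityMeasure μ] {T R : ℕ}
  {M : StaggeredPanel Ω T R}

/-- The assumptions of the theory for one pair `(g,t)`, with the consequences of the rank
conditions. -/
structure RegularPair (M : StaggeredPanel Ω T R) (μ : Measure Ω) (g t : ℕ)
    (Om : Matrix (Fin (g - 2)) (Fin R) ℝ) (OmH : ℕ → Ω → Matrix (Fin (g - 2)) (Fin R) ℝ)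
    (W : Matrix (M.comp μ t) (M.comp μ t) ℝ) (WH : ℕ → Ω → Matrix (M.comp μ t) (M.comp μ t) ℝ)
    (q : ℕ → Ω → ℕ∞ → ℝ) : Prop where
  anticipation : M.NoAnticipation μ
  ife : M.InteractiveFixedEffects μ
  errors : M.IdiosyncraticErrors μ
  unconfounded : M.Unconfounded μ
  indep : iIndepFun M.obs μ
  ident : ∀ i, IdentDistrib (M.obs i) (M.obs 0) μ μ
  moments : ∀ t ∈ Finset.Icc 1 T, MemLp (M.Y 0 t) 4 μ
  two_le : 2 ≤ g
  le_T : g ≤ T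
  le_t : g ≤ t
  t_mem : t ∈ Finset.Icc 1 T
  p_pos : 0 < M.p μ g
  isUnit_Om : IsUnit (Omᵀ * M.dFpre g).det
  Gam_injective : Function.Injective (M.Gam μ Om t).mulVec
  posDef : W.PosDef
  tendsto_Om : Tendsto (fun p : ℕ × Ω => OmH p.1 p.2) (probFilter μ) (𝓝 Om)
  tendsto_W : Tendsto (fun p : ℕ × Ω => WH p.1 p.2) (probFilter μ) (𝓝 W)
  tendsto_q : ∀ γ, Tendsto (fun p : ℕ × Ω => q p.1 p.2 γ) (probFilter μ) (𝓝 (M.p μ γ))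

/-- The influence function as a function of the observed data, with the coefficients as
parameters. -/
noncomputable def obsPsi (M : StaggeredPanel Ω T R) (μ : Measure Ω) {g : ℕ}
    (Om : Matrix (Fin (g - 2)) (Fin R) ℝ) (t : ℕ) (q : ℕ∞ → ℝ) (pg mD : ℝ)
    (mA : Fin (R + 1) → ℝ) (B : Matrix (Fin (R + 1)) (M.comp μ t) ℝ) (δ : Fin (R + 1) → ℝ)
    (att : ℝ) (i : ℕ) (ω : Ω) : ℝ :=
  (M.dY g t i ω - mD) / pg
  + -((pg⁻¹ • mA) ⬝ᵥ (B *ᵥ (((M.Y i t ω - M.Y i (g - 1) ω) - regressor g Om (M.path i ω) ⬝ᵥ δ) •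
      M.ell μ q t (M.G i ω))))
  + -((pg⁻¹ • δ) ⬝ᵥ (regA g Om (M.G i ω) (M.path i ω) - mA))
  + -(att / pg * (groupInd (M.G i ω) g - pg))

/-- The influence function with `v` replaced by the observable regression residual. -/
noncomputable def residPsi (M : StaggeredPanel Ω T R) (μ : Measure Ω) {g : ℕ}
    (Om : Matrix (Fin (g - 2)) (Fin R) ℝ) (t : ℕ) (W : Matrix (M.comp μ t) (M.comp μ t) ℝ)
    (i : ℕ) (ω : Ω) : ℝ :=
  M.obsPsi μ Om t (M.p μ) (M.p μ g) (∫ ω', M.dY g t 0 ω' ∂μ) (M.meanA μ Om)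
    (gmmMatrix (M.Gam μ Om t) W) (M.deltaStar Om t) (M.ATT μ g t) i ω

namespace RegularPair

variable {g t : ℕ} {Om : Matrix (Fin (g - 2)) (Fin R) ℝ}
  {OmH : ℕ → Ω → Matrix (Fin (g - 2)) (Fin R) ℝ} {W : Matrix (M.comp μ t) (M.comp μ t) ℝ}
  {WH : ℕ → Ω → Matrix (M.comp μ t) (M.comp μ t) ℝ} {q : ℕ → Ω → ℕ∞ → ℝ}

theorem pre_mem (h : RegularPair M μ g t Om OmH W WH q) : g - 1 ∈ Finset.Icc 1 T := by
  have := h.two_le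
  have := h.le_T
  exact Finset.mem_Icc.2 (by omega)

theorem isFeature_dY (h : RegularPair M μ g t Om OmH W WH q) (γ : ℕ∞) :
    IsFeature μ M.obs fun i ω => groupInd (M.G i ω) γ * (M.Y i t ω - M.Y i (g - 1) ω) :=
  isFeature_groupInd_mul_sub h.moments γ h.t_mem h.pre_mem

theorem plugIn_regressor (h : RegularPair M μ g t Om OmH W WH q) (γ : ℕ∞) (k : Fin (R + 1)) :
    PlugIn μ M.obs
      (fun n i ω => groupInd (M.G i ω) γ * regressor g (OmH n ω) (M.path i ω) k)
      (fun i ω => groupInd (M.G i ω) γ * regressor g Om (M.path i ω) k)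
      (fun n ω => ∫ ω', groupInd (M.G 0 ω') γ * regressor g (OmH n ω) (M.path 0 ω') k ∂μ) :=
  plugIn_groupInd_mul_regressor h.moments h.le_T (tendsto_matrix_iff.1 h.tendsto_Om) γ k

theorem tendsto_phat (h : RegularPair M μ g t Om OmH W WH q) (γ : ℕ∞) :
    Tendsto (fun p : ℕ × Ω => M.phat p.1 p.2 γ) (probFilter μ) (𝓝 (M.p μ γ)) := by
  rw [← integral_groupInd]
  exact (PlugIn.of_isFeature (isFeature_groupInd γ)).tendsto_sampleMean h.indep h.ident

theorem tendsto_sampleMean_dY (h : RegularPair M μ g t Om OmH W WH q) :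
    Tendsto (fun p : ℕ × Ω => sampleMean p.1 fun i => M.dY g t i p.2) (probFilter μ)
      (𝓝 (∫ ω, M.dY g t 0 ω ∂μ)) :=
  (PlugIn.of_isFeature (h.isFeature_dY g)).tendsto_sampleMean h.indep h.ident

theorem tendsto_meanAHat (h : RegularPair M μ g t Om OmH W WH q) :
    Tendsto (fun p : ℕ × Ω => M.meanAHat (OmH p.1 p.2) p.1 p.2) (probFilter μ)
      (𝓝 (M.meanA μ Om)) :=
  tendsto_pi_nhds.2 fun k => (h.plugIn_regressor g k).tendsto_sampleMean h.indep h.ident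

theorem GamHat_apply (Om : Matrix (Fin (g - 2)) (Fin R) ℝ) (q : ℕ∞ → ℝ) (n : ℕ) (ω : Ω)
    (g' : M.comp μ t) (k : Fin (R + 1)) : M.GamHat μ Om t q n ω g' k =
      (q g')⁻¹ * sampleMean n fun i =>
        groupInd (M.G i ω) g' * regressor g Om (M.path i ω) k := by
  rw [← sampleMean_const_mul, GamHat, Matrix.of_apply]
  congr 1
  ext i
  simp only [ell]
  ring

theorem tendsto_q_inv (h : RegularPair M μ g t Om OmH W WH q) (g' : M.comp μ t) :
    Tendsto (fun p : ℕ × Ω => (q p.1 p.2 g')⁻¹) (probFilter μ) (𝓝 (M.p μ g')⁻¹) :=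
  (h.tendsto_q g').inv₀ (p_pos_of_mem_comp g'.2).ne'

theorem tendsto_GamHat (h : RegularPair M μ g t Om OmH W WH q) :
    Tendsto (fun p : ℕ × Ω => M.GamHat μ (OmH p.1 p.2) t (q p.1 p.2) p.1 p.2) (probFilter μ)
      (𝓝 (M.Gam μ Om t)) := by
  refine tendsto_matrix_iff.2 fun g' k => ?_
  simp_rw [GamHat_apply, Gam_apply]
  exact (h.tendsto_q_inv g').mul
    ((h.plugIn_regressor g' k).tendsto_sampleMean h.indep h.ident)

theorem isUnit_gmm (h : RegularPair M μ g t Om OmH W WH q) :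
    IsUnit ((M.Gam μ Om t)ᵀ * W * M.Gam μ Om t).det :=
  isUnit_det_transpose_mul_mul h.posDef h.Gam_injective

theorem tendsto_gmm_inner (h : RegularPair M μ g t Om OmH W WH q) :
    Tendsto (fun p : ℕ × Ω => (M.GamHat μ (OmH p.1 p.2) t (q p.1 p.2) p.1 p.2)ᵀ * WH p.1 p.2 *
      M.GamHat μ (OmH p.1 p.2) t (q p.1 p.2) p.1 p.2) (probFilter μ)
      (𝓝 ((M.Gam μ Om t)ᵀ * W * M.Gam μ Om t)) :=
  (h.tendsto_GamHat.matrix_transpose.matrix_mul h.tendsto_W).matrix_mul h.tendsto_GamHat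

theorem tendsto_gmmMatrix (h : RegularPair M μ g t Om OmH W WH q) :
    Tendsto (fun p : ℕ × Ω =>
      gmmMatrix (M.GamHat μ (OmH p.1 p.2) t (q p.1 p.2) p.1 p.2) (WH p.1 p.2)) (probFilter μ)
      (𝓝 (gmmMatrix (M.Gam μ Om t) W)) :=
  ((h.tendsto_gmm_inner.matrix_inv h.isUnit_gmm).matrix_mul
    h.tendsto_GamHat.matrix_transpose).matrix_mul h.tendsto_W

/-- The population moments lie exactly in the range of `Gam`, so every positive definite weighting
recovers the same `δ*`. -/
theorem integral_ell_mul (h : RegularPair M μ g t Om OmH W WH q) :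
    (fun g' : M.comp μ t => (M.p μ g')⁻¹ *
      ∫ ω, groupInd (M.G 0 ω) g' * (M.Y 0 t ω - M.Y 0 (g - 1) ω) ∂μ) =
      M.Gam μ Om t *ᵥ M.deltaStar Om t := by
  ext g'
  rw [integral_ell_mul_sub h.anticipation h.ife h.errors h.unconfounded h.moments h.two_le h.le_T
    h.le_t h.t_mem h.isUnit_Om g']
  simp only [dotProduct, Matrix.mulVec, Gam_apply, Finset.mul_sum, mul_assoc]

theorem tendsto_deltaHat (h : RegularPair M μ g t Om OmH W WH q) :
    Tendsto (fun p : ℕ × Ω =>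
      M.deltaHat μ (OmH p.1 p.2) t (q p.1 p.2) (WH p.1 p.2) p.1 p.2) (probFilter μ)
      (𝓝 (M.deltaStar Om t)) := by
  have h1 : Tendsto (fun (p : ℕ × Ω) (g' : M.comp μ t) => sampleMean p.1 fun i =>
      M.ell μ (q p.1 p.2) t (M.G i p.2) g' * (M.Y i t p.2 - M.Y i (g - 1) p.2)) (probFilter μ)
      (𝓝 (M.Gam μ Om t *ᵥ M.deltaStar Om t)) := by
    rw [← h.integral_ell_mul]
    refine tendsto_pi_nhds.2 fun g' => ?_
    have h2 := (h.tendsto_q_inv g').mul ((PlugIn.of_isFeature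
      (h.isFeature_dY g')).tendsto_sampleMean h.indep h.ident)
    refine h2.congr fun p => ?_
    rw [← sampleMean_const_mul]
    congr 1
    ext i
    simp only [ell]
    ring
  have h2 := h.tendsto_gmmMatrix.matrix_mulVec h1
  rwa [Matrix.mulVec_mulVec, gmmMatrix_mul h.isUnit_gmm, Matrix.one_mulVec] at h2

theorem dY_sub_meanA (h : RegularPair M μ g t Om OmH W WH q) :
    ∫ ω, M.dY g t 0 ω ∂μ - M.meanA μ Om ⬝ᵥ M.deltaStar Om t = M.p μ g * M.ATT μ g t :=
  integral_dY_sub h.anticipation h.ife h.errors h.unconfounded h.moments h.two_le h.le_T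
    h.le_t h.t_mem h.isUnit_Om h.p_pos

theorem tendsto_ATTHat (h : RegularPair M μ g t Om OmH W WH q) :
    Tendsto (fun p : ℕ × Ω =>
      M.ATTHat μ (OmH p.1 p.2) t (q p.1 p.2) (WH p.1 p.2) p.1 p.2) (probFilter μ)
      (𝓝 (M.ATT μ g t)) := by
  have h1 := ((h.tendsto_phat g).inv₀ h.p_pos.ne').mul
    (h.tendsto_sampleMean_dY.sub (h.tendsto_meanAHat.dotProduct h.tendsto_deltaHat))
  rwa [h.dY_sub_meanA, inv_mul_cancel_left₀ h.p_pos.ne'] at h1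

/-- Regression residuals interacted with `ℓ`. -/
theorem plugIn_resid (h : RegularPair M μ g t Om OmH W WH q) {δH : ℕ → Ω → Fin (R + 1) → ℝ}
    {δ : Fin (R + 1) → ℝ} (hδ : Tendsto (fun p : ℕ × Ω => δH p.1 p.2) (probFilter μ) (𝓝 δ))
    (g' : M.comp μ t) :
    PlugIn μ M.obs
      (fun n i ω => (((M.Y i t ω - M.Y i (g - 1) ω) -
        regressor g (OmH n ω) (M.path i ω) ⬝ᵥ δH n ω) • M.ell μ (q n ω) t (M.G i ω)) g')
      (fun i ω => (((M.Y i t ω - M.Y i (g - 1) ω) -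
        regressor g Om (M.path i ω) ⬝ᵥ δ) • M.ell μ (M.p μ) t (M.G i ω)) g')
      (fun n ω => (q n ω g')⁻¹ *
        (∫ ω', groupInd (M.G 0 ω') g' * (M.Y 0 t ω' - M.Y 0 (g - 1) ω') ∂μ -
        δH n ω ⬝ᵥ fun k =>
          ∫ ω', groupInd (M.G 0 ω') g' * regressor g (OmH n ω) (M.path 0 ω') k ∂μ)) := by
  -- Regrouping attaches the indicator to every outcome term and separates the estimated factors
  -- `q⁻¹`, `OmH` and `δH`, which is the form of a plug-in.
  have e : ∀ (y x : ℝ) (c z d : Fin (R + 1) → ℝ) (γ : ℕ∞) (Q : ℕ∞ → ℝ),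
      ((y - z ⬝ᵥ d) • M.ell μ Q t γ) g' =
        (Q g')⁻¹ * (groupInd γ g' * y - d ⬝ᵥ fun k => groupInd γ g' * z k) := by
    intro y x c z d γ Q
    have : (d ⬝ᵥ fun k => groupInd γ g' * z k) = groupInd γ g' * z ⬝ᵥ d := by
      simp only [dotProduct, Finset.mul_sum]
      exact Finset.sum_congr rfl fun k _ => by ring
    rw [this, Pi.smul_apply, smul_eq_mul]
    simp only [ell]
    ring
  simp_rw [e _ 0 0]
  exact .const_mul (h.tendsto_q_inv g') (.sub (.of_isFeature (h.isFeature_dY g'))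
    (.dotProduct (tendsto_pi_nhds.1 hδ) fun k => h.plugIn_regressor g' k))

end RegularPair

end StaggeredPanel

/-! ### Asymptotically linear expansion of the estimator. -/

theorem PlugIn.congr {Ω O : Type*} [MeasurableSpace Ω] [MeasurableSpace O] {μ : Measure Ω}
    {X : ℕ → Ω → O} {V V' : ℕ → ℕ → Ω → ℝ} {U U' : ℕ → Ω → ℝ} {m : ℕ → Ω → ℝ}
    (h : PlugIn μ X V U m) (hV : ∀ n i ω, V' n i ω = V n i ω) (hU : ∀ i ω, U' i ω = U i ω) :
    PlugIn μ X V' U' m := by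
  rw [show V' = V from funext fun n => funext fun i => funext (hV n i),
    show U' = U from funext fun i => funext (hU i)]
  exact h

namespace StaggeredPanel

variable {Ω : Type*} [MeasurableSpace Ω] {μ : Measure Ω} [IsProbabilityMeasure μ] {T R : ℕ}
  {M : StaggeredPanel Ω T R}

theorem sampleMean_resid_smul_ell {g : ℕ} (Om : Matrix (Fin (g - 2)) (Fin R) ℝ) (t : ℕ)
    (q : ℕ∞ → ℝ) (δ : Fin (R + 1) → ℝ) (n : ℕ) (ω : Ω) :
    (fun g' => sampleMean n fun i => (((M.Y i t ω - M.Y i (g - 1) ω) -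
        regressor g Om (M.path i ω) ⬝ᵥ δ) • M.ell μ q t (M.G i ω)) g') =
      (fun g' => sampleMean n fun i =>
        M.ell μ q t (M.G i ω) g' * (M.Y i t ω - M.Y i (g - 1) ω)) -
      M.GamHat μ Om t q n ω *ᵥ δ := by
  ext g'
  have h1 : (M.GamHat μ Om t q n ω *ᵥ δ) g' = sampleMean n fun i =>
      δ ⬝ᵥ fun k => M.ell μ q t (M.G i ω) g' * regressor g Om (M.path i ω) k := by
    rw [sampleMean_dotProduct, dotProduct_comm]
    rfl
  rw [Pi.sub_apply, h1, ← sampleMean_sub]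
  congr 1
  ext i
  simp only [Pi.smul_apply, smul_eq_mul, sub_mul, dotProduct, Finset.sum_mul]
  congr 1
  · ring
  · exact Finset.sum_congr rfl fun k _ => by ring

/-- The estimation error, expanded around arbitrary coefficients `δ`. -/
theorem ATTHat_sub_eq_sampleMean {g : ℕ} {Om : Matrix (Fin (g - 2)) (Fin R) ℝ} {t : ℕ}
    {q : ℕ∞ → ℝ} {W : Matrix (M.comp μ t) (M.comp μ t) ℝ} {n : ℕ} {ω : Ω}
    (hB : gmmMatrix (M.GamHat μ Om t q n ω) W * M.GamHat μ Om t q n ω = 1)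
    (hp : M.phat n ω g ≠ 0) (δ : Fin (R + 1) → ℝ) (att : ℝ) :
    M.ATTHat μ Om t q W n ω - att = sampleMean n fun i => (M.phat n ω g)⁻¹ *
      (groupInd (M.G i ω) g * (M.Y i t ω - M.Y i (g - 1) ω) -
        δ ⬝ᵥ regA g Om (M.G i ω) (M.path i ω) - att * groupInd (M.G i ω) g -
        M.meanAHat Om n ω ⬝ᵥ (gmmMatrix (M.GamHat μ Om t q n ω) W *ᵥ
          (((M.Y i t ω - M.Y i (g - 1) ω) - regressor g Om (M.path i ω) ⬝ᵥ δ) •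
            M.ell μ q t (M.G i ω)))) := by
  have h1 : (sampleMean n fun i => M.meanAHat Om n ω ⬝ᵥ (gmmMatrix (M.GamHat μ Om t q n ω) W *ᵥ
      (((M.Y i t ω - M.Y i (g - 1) ω) - regressor g Om (M.path i ω) ⬝ᵥ δ) •
        M.ell μ q t (M.G i ω)))) =
      M.meanAHat Om n ω ⬝ᵥ M.deltaHat μ Om t q W n ω - M.meanAHat Om n ω ⬝ᵥ δ := by
    rw [sampleMean_dotProduct, ← dotProduct_sub]
    congr 1
    -- Because `B̂ Γ̂ = 1`, this is an exact identity for every `δ`, with no remainder.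
    have h2 : M.deltaHat μ Om t q W n ω - δ = gmmMatrix (M.GamHat μ Om t q n ω) W *ᵥ
        fun g' => sampleMean n fun i => (((M.Y i t ω - M.Y i (g - 1) ω) -
        regressor g Om (M.path i ω) ⬝ᵥ δ) • M.ell μ q t (M.G i ω)) g' := by
      rw [sampleMean_resid_smul_ell, Matrix.mulVec_sub, Matrix.mulVec_mulVec, hB, Matrix.one_mulVec]
      rfl
    rw [h2]
    ext k
    exact sampleMean_dotProduct _ _ _
  have h3 : (sampleMean n fun i => δ ⬝ᵥ regA g Om (M.G i ω) (M.path i ω)) =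
      M.meanAHat Om n ω ⬝ᵥ δ := by
    rw [sampleMean_dotProduct, dotProduct_comm]
    rfl
  rw [sampleMean_const_mul, sampleMean_sub, sampleMean_sub, sampleMean_sub, sampleMean_const_mul,
    h1, h3, ATTHat]
  change _ = (M.phat n ω g)⁻¹ * (_ - _ - att * M.phat n ω g - _)
  simp only [dY]
  field_simp
  ring

namespace RegularPair

variable {g t : ℕ} {Om : Matrix (Fin (g - 2)) (Fin R) ℝ}
  {OmH : ℕ → Ω → Matrix (Fin (g - 2)) (Fin R) ℝ} {W : Matrix (M.comp μ t) (M.comp μ t) ℝ}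
  {WH : ℕ → Ω → Matrix (M.comp μ t) (M.comp μ t) ℝ} {q : ℕ → Ω → ℕ∞ → ℝ}

/-- Needed at two coefficient estimates: `δ̂` in the estimated influence function, and `δ*(Ω̂)` in
the expansion of the estimation error. -/
theorem plugIn_gmm_resid (h : RegularPair M μ g t Om OmH W WH q)
    {δH : ℕ → Ω → Fin (R + 1) → ℝ} {δ : Fin (R + 1) → ℝ}
    (hδ : Tendsto (fun p : ℕ × Ω => δH p.1 p.2) (probFilter μ) (𝓝 δ))
    {aH : ℕ → Ω → Fin (R + 1) → ℝ} {a : Fin (R + 1) → ℝ}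
    (ha : Tendsto (fun p : ℕ × Ω => aH p.1 p.2) (probFilter μ) (𝓝 a)) :
    PlugIn μ M.obs
      (fun n i ω => aH n ω ⬝ᵥ (gmmMatrix (M.GamHat μ (OmH n ω) t (q n ω) n ω) (WH n ω) *ᵥ
        (((M.Y i t ω - M.Y i (g - 1) ω) - regressor g (OmH n ω) (M.path i ω) ⬝ᵥ δH n ω) •
          M.ell μ (q n ω) t (M.G i ω))))
      (fun i ω => a ⬝ᵥ (gmmMatrix (M.Gam μ Om t) W *ᵥ
        (((M.Y i t ω - M.Y i (g - 1) ω) - regressor g Om (M.path i ω) ⬝ᵥ δ) •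
          M.ell μ (M.p μ) t (M.G i ω))))
      (fun n ω => aH n ω ⬝ᵥ (gmmMatrix (M.GamHat μ (OmH n ω) t (q n ω) n ω) (WH n ω) *ᵥ
        fun g' => (q n ω g')⁻¹ *
        (∫ ω', groupInd (M.G 0 ω') g' * (M.Y 0 t ω' - M.Y 0 (g - 1) ω') ∂μ -
        δH n ω ⬝ᵥ fun k =>
          ∫ ω', groupInd (M.G 0 ω') g' * regressor g (OmH n ω) (M.path 0 ω') k ∂μ))) :=
  PlugIn.dotProduct_mulVec (aH := aH) ha
    (BH := fun n ω => gmmMatrix (M.GamHat μ (OmH n ω) t (q n ω) n ω) (WH n ω)) h.tendsto_gmmMatrix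
    (V := fun n i ω => (((M.Y i t ω - M.Y i (g - 1) ω) -
        regressor g (OmH n ω) (M.path i ω) ⬝ᵥ δH n ω) • M.ell μ (q n ω) t (M.G i ω)))
    (U := fun i ω => (((M.Y i t ω - M.Y i (g - 1) ω) -
        regressor g Om (M.path i ω) ⬝ᵥ δ) • M.ell μ (M.p μ) t (M.G i ω)))
    fun g' => h.plugIn_resid hδ g'

/-- The estimated influence function is a plug-in. -/
theorem plugIn_psiHat (h : RegularPair M μ g t Om OmH W WH q) :
    ∃ m, PlugIn μ M.obs
      (fun n i ω => M.psiHat μ (OmH n ω) t (q n ω) (WH n ω) n ω i) (M.residPsi μ Om t W) m := by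
  -- The four terms of the influence function are treated separately. The mean `m` stays
  -- unspecified, since the multipliers do the centring in the bootstrap.
  have hp := (h.tendsto_phat g).inv₀ h.p_pos.ne'
  have h1 := PlugIn.const_mul (b := fun n ω => (M.phat n ω g)⁻¹) hp
    ((PlugIn.of_isFeature (h.isFeature_dY g)).sub
      (.const (b := fun n ω => sampleMean n fun i => M.dY g t i ω) h.tendsto_sampleMean_dY))
  have h2 := (h.plugIn_gmm_resid
    (δH := fun n ω => M.deltaHat μ (OmH n ω) t (q n ω) (WH n ω) n ω) h.tendsto_deltaHat
    (aH := fun n ω => (M.phat n ω g)⁻¹ • M.meanAHat (OmH n ω) n ω)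
    (hp.smul h.tendsto_meanAHat)).neg
  have h3 := (PlugIn.dotProduct
    (b := fun n ω => (M.phat n ω g)⁻¹ • M.deltaHat μ (OmH n ω) t (q n ω) (WH n ω) n ω)
    (tendsto_pi_nhds.1 (hp.smul h.tendsto_deltaHat))
    (V := fun n i ω => regA g (OmH n ω) (M.G i ω) (M.path i ω) - M.meanAHat (OmH n ω) n ω)
    (U := fun i ω => regA g Om (M.G i ω) (M.path i ω) - M.meanA μ Om)
    (m := fun n ω k => ∫ ω', groupInd (M.G 0 ω') g * regressor g (OmH n ω) (M.path 0 ω') k ∂μ -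
      M.meanAHat (OmH n ω) n ω k * ∫ _, (1 : ℝ) ∂μ)
    fun k => (h.plugIn_regressor g k).sub
      (.const (b := fun n ω => M.meanAHat (OmH n ω) n ω k)
        (tendsto_pi_nhds.1 h.tendsto_meanAHat k))).neg
  have h4 := (PlugIn.const_mul
    (b := fun n ω => M.ATTHat μ (OmH n ω) t (q n ω) (WH n ω) n ω * (M.phat n ω g)⁻¹)
    (h.tendsto_ATTHat.mul hp)
    ((PlugIn.of_isFeature (isFeature_groupInd (μ := μ) (M := M) g)).sub
      (.const (b := fun n ω => M.phat n ω g) (h.tendsto_phat g)))).neg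
  refine ⟨_, (((h1.add h2).add h3).add h4).congr (fun n i ω => ?_) fun i ω => ?_⟩
  · simp only [psiHat, div_eq_inv_mul, mul_comm (M.phat n ω g)⁻¹ (M.ATTHat μ _ t _ _ n ω)]
    rfl
  · simp only [residPsi, obsPsi, div_eq_inv_mul, mul_comm (M.p μ g)⁻¹ (M.ATT μ g t)]
    rfl

/-- `δ*` is a continuous function of `Om` where `Om'ΔF^pre` is invertible. This justifies `δ*(Ω̂)`
as a random centre for the expansion. -/
theorem tendsto_deltaStar (h : RegularPair M μ g t Om OmH W WH q) :
    Tendsto (fun p : ℕ × Ω => M.deltaStar (OmH p.1 p.2) t) (probFilter μ)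
      (𝓝 (M.deltaStar Om t)) := by
  have h1 : Tendsto (fun p : ℕ × Ω => ((OmH p.1 p.2)ᵀ * M.dFpre g)⁻¹) (probFilter μ)
      (𝓝 (Omᵀ * M.dFpre g)⁻¹) :=
    (h.tendsto_Om.matrix_transpose.matrix_mul tendsto_const_nhds).matrix_inv h.isUnit_Om
  have h2 : Tendsto (fun p : ℕ × Ω => M.thetaStar (OmH p.1 p.2) t) (probFilter μ)
      (𝓝 (M.thetaStar Om t)) :=
    tendsto_const_nhds.sub (tendsto_const_nhds.dotProduct
      ((h1.matrix_mul h.tendsto_Om.matrix_transpose).matrix_mulVec tendsto_const_nhds))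
  have h3 : Tendsto (fun p : ℕ × Ω => M.FStar (OmH p.1 p.2) t) (probFilter μ)
      (𝓝 (M.FStar Om t)) :=
    ((by fun_prop : Continuous fun B : Matrix (Fin R) (Fin R) ℝ =>
      (M.F t - M.F (g - 1)) ᵥ* B).tendsto _).comp h1
  refine tendsto_pi_nhds.2 fun k => ?_
  refine Fin.cases ?_ (fun r => ?_) k
  · simpa [deltaStar] using h2
  · simpa [deltaStar] using tendsto_pi_nhds.1 h3 r

/-- The estimation error is, with probability tending to one, a sample mean of plug-ins of the
influence function that are centred given the estimated coefficients. -/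
theorem exists_plugIn_ATTHat (h : RegularPair M μ g t Om OmH W WH q) :
    ∃ V m, PlugIn μ M.obs V (M.residPsi μ Om t W) m ∧
      (∀ᶠ p in probFilter μ, m p.1 p.2 = 0) ∧
      ∀ᶠ p in probFilter μ, M.ATTHat μ (OmH p.1 p.2) t (q p.1 p.2) (WH p.1 p.2) p.1 p.2 -
        M.ATT μ g t = sampleMean p.1 fun i => V p.1 i p.2 := by
  -- The expansion point is `δ*` at the estimated `OmH`, not at its limit. This choice makes the
  -- frozen-coefficient means vanish and removes any effect of the error in `OmH`.
  have h1 := PlugIn.dotProduct (b := fun n ω => M.deltaStar (OmH n ω) t)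
    (tendsto_pi_nhds.1 h.tendsto_deltaStar)
    (V := fun n i ω => regA g (OmH n ω) (M.G i ω) (M.path i ω))
    (U := fun i ω => regA g Om (M.G i ω) (M.path i ω))
    (m := fun n ω k => ∫ ω', groupInd (M.G 0 ω') g * regressor g (OmH n ω) (M.path 0 ω') k ∂μ)
    fun k => h.plugIn_regressor g k
  have h2 := ((PlugIn.of_isFeature (h.isFeature_dY g)).sub h1).sub
    (PlugIn.const_mul (b := fun _ _ => M.ATT μ g t) tendsto_const_nhds
      (PlugIn.of_isFeature (isFeature_groupInd (μ := μ) (M := M) g)))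
  have h3 := PlugIn.const_mul (b := fun n ω => (M.phat n ω g)⁻¹)
    ((h.tendsto_phat g).inv₀ h.p_pos.ne') (h2.sub (h.plugIn_gmm_resid
      (δH := fun n ω => M.deltaStar (OmH n ω) t) h.tendsto_deltaStar
      (aH := fun n ω => M.meanAHat (OmH n ω) n ω) h.tendsto_meanAHat))
  have hunit : ∀ᶠ p : ℕ × Ω in probFilter μ, IsUnit ((OmH p.1 p.2)ᵀ * M.dFpre g).det :=
    (h.tendsto_Om.matrix_transpose.matrix_mul tendsto_const_nhds).eventually_isUnit_det h.isUnit_Om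
  refine ⟨_, _, h3.congr (fun _ _ _ => rfl) fun i ω => ?_, ?_, ?_⟩
  -- The centring constants of `residPsi` cancel by `E[d] - E[A]'δ* = p_g ATT`, so its four terms
  -- collapse into the single expression of the expansion.
  · have h4 := h.dY_sub_meanA
    have hp0 := h.p_pos.ne'
    have e : ∀ D mD A a X att I P : ℝ, P ≠ 0 → mD - a = P * att →
        P⁻¹ * (D - A - att * I - X) = (D - mD) / P + -(P⁻¹ * X) + -(P⁻¹ * (A - a)) +
          -(att / P * (I - P)) := by
      intro D mD A a X att I P hP hm
      have : mD = P * att + a := by linarith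
      rw [this]
      field_simp
      ring
    rw [e _ _ _ _ _ _ _ _ hp0 h4]
    simp only [residPsi, obsPsi, smul_dotProduct, smul_eq_mul, dotProduct_sub,
      dotProduct_comm (M.meanA μ Om) (M.deltaStar Om t)]
    simp only [dY, mul_sub]
  -- Whenever `OmH' ΔF^pre` is invertible, the population moment conditions hold at `OmH` itself, so
  -- the treated-group and comparison-group parts of the mean vanish separately.
  · filter_upwards [hunit] with p hu
    have h4 := integral_dY_sub h.anticipation h.ife h.errors h.unconfounded h.moments h.two_le
      h.le_T h.le_t h.t_mem hu h.p_pos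
    have h5 := fun g' => integral_ell_mul_sub h.anticipation h.ife h.errors h.unconfounded
      h.moments h.two_le h.le_T h.le_t h.t_mem hu g'
    have h6 : ∀ g' : M.comp μ t, (q p.1 p.2 g')⁻¹ *
        (∫ ω', groupInd (M.G 0 ω') g' * (M.Y 0 t ω' - M.Y 0 (g - 1) ω') ∂μ -
        M.deltaStar (OmH p.1 p.2) t ⬝ᵥ fun k =>
          ∫ ω', groupInd (M.G 0 ω') g' * regressor g (OmH p.1 p.2) (M.path 0 ω') k ∂μ) = 0 := by
      intro g'
      rw [h5, dotProduct_comm, sub_self, mul_zero]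
    simp_rw [h6]
    have h7 : (fun _ : M.comp μ t => (0 : ℝ)) = 0 := rfl
    rw [h7, Matrix.mulVec_zero, dotProduct_zero, sub_zero, integral_groupInd, dotProduct_comm]
    have h8 : ∫ ω, groupInd (M.G 0 ω) g * (M.Y 0 t ω - M.Y 0 (g - 1) ω) ∂μ -
        (fun k => ∫ ω, groupInd (M.G 0 ω) g * regressor g (OmH p.1 p.2) (M.path 0 ω) k ∂μ) ⬝ᵥ
          M.deltaStar (OmH p.1 p.2) t = M.p μ g * M.ATT μ g t := h4
    rw [h8]
    ring
  -- The expansion is exact off the vanishing event where the GMM matrix is singular or the group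
  -- share is zero.
  · filter_upwards [h.tendsto_gmm_inner.eventually_isUnit_det h.isUnit_gmm,
      (h.tendsto_phat g).eventually_ne h.p_pos.ne'] with p hgmm hp0
    obtain ⟨n, ω⟩ := p
    exact ATTHat_sub_eq_sampleMean (gmmMatrix_mul hgmm) hp0 _ _

end RegularPair

end StaggeredPanel

/-! ### Measurability of the estimates -/

section MatrixMeasurability

variable {Ω a b c : Type*} [MeasurableSpace Ω]

theorem measurable_dotProduct_apply [Fintype b] {x y : Ω → b → ℝ}
    (hx : ∀ k, Measurable fun ω => x ω k) (hy : ∀ k, Measurable fun ω => y ω k) :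
    Measurable fun ω => x ω ⬝ᵥ y ω :=
  Finset.measurable_fun_sum _ fun k _ => (hx k).mul (hy k)

theorem measurable_mulVec_apply [Fintype b] {A : Ω → Matrix a b ℝ} {x : Ω → b → ℝ}
    (hA : ∀ j k, Measurable fun ω => A ω j k) (hx : ∀ k, Measurable fun ω => x ω k) (j : a) :
    Measurable fun ω => (A ω *ᵥ x ω) j :=
  measurable_dotProduct_apply (x := fun ω => A ω j) (hA j) hx

theorem measurable_matrix_mul_apply [Fintype b] {A : Ω → Matrix a b ℝ} {B : Ω → Matrix b c ℝ}
    (hA : ∀ j k, Measurable fun ω => A ω j k) (hB : ∀ j k, Measurable fun ω => B ω j k)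
    (j : a) (k : c) : Measurable fun ω => (A ω * B ω) j k := by
  simp_rw [Matrix.mul_apply]
  exact Finset.measurable_fun_sum _ fun l _ => (hA j l).mul (hB l k)

theorem measurable_matrix_det [Fintype a] [DecidableEq a] {A : Ω → Matrix a a ℝ}
    (hA : ∀ j k, Measurable fun ω => A ω j k) : Measurable fun ω => (A ω).det := by
  simp_rw [Matrix.det_apply]
  exact Finset.measurable_fun_sum _ fun σ _ =>
    (Finset.measurable_fun_prod _ fun i _ => hA (σ i) i).const_smul _

/-- The formula `det⁻¹` times adjugate includes the default value at singular matrices, so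
measurability needs no restriction to invertible ones. -/
theorem measurable_matrix_inv_apply [Fintype a] [DecidableEq a] {A : Ω → Matrix a a ℝ}
    (hA : ∀ j k, Measurable fun ω => A ω j k) (j k : a) :
    Measurable fun ω => (A ω)⁻¹ j k := by
  simp_rw [Matrix.inv_def, Ring.inverse_eq_inv', Matrix.smul_apply, smul_eq_mul,
    Matrix.adjugate_apply]
  refine (measurable_matrix_det hA).inv.mul (measurable_matrix_det fun i l => ?_)
  simp_rw [Matrix.updateRow_apply]
  split_ifs
  · exact measurable_const
  · exact hA i l

theorem measurable_gmmMatrix_apply [Fintype a] {k : ℕ} {A : Ω → Matrix a (Fin k) ℝ}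
    {W : Ω → Matrix a a ℝ} (hA : ∀ j k, Measurable fun ω => A ω j k)
    (hW : ∀ j k, Measurable fun ω => W ω j k) (i : Fin k) (j : a) :
    Measurable fun ω => gmmMatrix (A ω) (W ω) i j := by
  have hAt : ∀ i j, Measurable fun ω => (A ω)ᵀ i j := fun i j => hA j i
  exact measurable_matrix_mul_apply (measurable_matrix_mul_apply (measurable_matrix_inv_apply
    (measurable_matrix_mul_apply (measurable_matrix_mul_apply hAt hW) hA)) hAt) hW i j

theorem measurable_sampleMean (n : ℕ) {f : Ω → ℕ → ℝ} (hf : ∀ i, Measurable fun ω => f ω i) :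
    Measurable fun ω => sampleMean n (f ω) :=
  (Finset.measurable_fun_sum _ fun i _ => hf i).const_mul _

end MatrixMeasurability

namespace StaggeredPanel

variable {Ω : Type*} [MeasurableSpace Ω] {μ : Measure Ω} {T R : ℕ}
  {M : StaggeredPanel Ω T R}

section Estimates

variable {g : ℕ} {t : ℕ} {Om : Ω → Matrix (Fin (g - 2)) (Fin R) ℝ}
  {W : Ω → Matrix (M.comp μ t) (M.comp μ t) ℝ} {q : Ω → ℕ∞ → ℝ}

theorem measurable_groupInd_G (i : ℕ) (γ : ℕ∞) : Measurable fun ω => groupInd (M.G i ω) γ :=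
  (measurable_groupInd γ).comp (M.measurable_G i)

theorem measurable_phat (n : ℕ) (γ : ℕ∞) : Measurable fun ω => M.phat n ω γ :=
  measurable_sampleMean n fun i => measurable_groupInd_G i γ

theorem measurable_Y_sub (t s i : ℕ) : Measurable fun ω => M.Y i t ω - M.Y i s ω :=
  (M.measurable_Y i t).sub (M.measurable_Y i s)

theorem measurable_dY (g t i : ℕ) : Measurable (M.dY g t i) :=
  (measurable_groupInd_G i g).mul (measurable_Y_sub t (g - 1) i)

theorem measurable_regressor (hOm : ∀ j k, Measurable fun ω => Om ω j k) (i : ℕ)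
    (k : Fin (R + 1)) : Measurable fun ω => regressor g (Om ω) (M.path i ω) k := by
  refine Fin.cases ?_ (fun r => ?_) k
  · simp [regressor]
  · simp_rw [regressor_succ]
    exact Finset.measurable_fun_sum _ fun j _ => (hOm j r).mul (measurable_Y_sub _ _ i)

theorem measurable_regA (hOm : ∀ j k, Measurable fun ω => Om ω j k) (i : ℕ)
    (k : Fin (R + 1)) : Measurable fun ω => regA g (Om ω) (M.G i ω) (M.path i ω) k :=
  (measurable_groupInd_G i g).mul (measurable_regressor hOm i k)

theorem measurable_meanAHat (hOm : ∀ j k, Measurable fun ω => Om ω j k) (n : ℕ)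
    (k : Fin (R + 1)) : Measurable fun ω => M.meanAHat (Om ω) n ω k :=
  measurable_sampleMean n fun i => measurable_regA hOm i k

theorem measurable_ell (hq : ∀ γ, Measurable fun ω => q ω γ) (i : ℕ) (g' : M.comp μ t) :
    Measurable fun ω => M.ell μ (q ω) t (M.G i ω) g' :=
  (measurable_groupInd_G i g').div (hq g')

theorem measurable_GamHat (hOm : ∀ j k, Measurable fun ω => Om ω j k)
    (hq : ∀ γ, Measurable fun ω => q ω γ) (n : ℕ) (g' : M.comp μ t) (k : Fin (R + 1)) :
    Measurable fun ω => M.GamHat μ (Om ω) t (q ω) n ω g' k :=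
  measurable_sampleMean n fun i => (measurable_ell hq i g').mul (measurable_regressor hOm i k)

theorem measurable_gmmHat (hOm : ∀ j k, Measurable fun ω => Om ω j k)
    (hq : ∀ γ, Measurable fun ω => q ω γ) (hW : ∀ j k, Measurable fun ω => W ω j k) (n : ℕ)
    (k : Fin (R + 1)) (g' : M.comp μ t) :
    Measurable fun ω => gmmMatrix (M.GamHat μ (Om ω) t (q ω) n ω) (W ω) k g' :=
  measurable_gmmMatrix_apply (A := fun ω => M.GamHat μ (Om ω) t (q ω) n ω)
    (measurable_GamHat hOm hq n) hW k g'

theorem measurable_deltaHat (hOm : ∀ j k, Measurable fun ω => Om ω j k)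
    (hq : ∀ γ, Measurable fun ω => q ω γ) (hW : ∀ j k, Measurable fun ω => W ω j k) (n : ℕ)
    (k : Fin (R + 1)) : Measurable fun ω => M.deltaHat μ (Om ω) t (q ω) (W ω) n ω k :=
  measurable_mulVec_apply (measurable_gmmHat hOm hq hW n) (fun g' =>
    measurable_sampleMean n fun i => (measurable_ell hq i g').mul (measurable_Y_sub t (g - 1) i)) k

theorem measurable_ATTHat (hOm : ∀ j k, Measurable fun ω => Om ω j k)
    (hq : ∀ γ, Measurable fun ω => q ω γ) (hW : ∀ j k, Measurable fun ω => W ω j k) (n : ℕ) :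
    Measurable fun ω => M.ATTHat μ (Om ω) t (q ω) (W ω) n ω :=
  (measurable_phat n g).inv.mul ((measurable_sampleMean n fun i => measurable_dY g t i).sub
    (measurable_dotProduct_apply (measurable_meanAHat hOm n) (measurable_deltaHat hOm hq hW n)))

theorem measurable_vHat (hOm : ∀ j k, Measurable fun ω => Om ω j k)
    (hq : ∀ γ, Measurable fun ω => q ω γ) (hW : ∀ j k, Measurable fun ω => W ω j k) (n i : ℕ) :
    Measurable fun ω => M.vHat μ (Om ω) t (q ω) (W ω) n ω i :=
  (measurable_Y_sub t (g - 1) i).sub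
    (measurable_dotProduct_apply (measurable_regressor hOm i) (measurable_deltaHat hOm hq hW n))

theorem measurable_psiHat (hOm : ∀ j k, Measurable fun ω => Om ω j k)
    (hq : ∀ γ, Measurable fun ω => q ω γ) (hW : ∀ j k, Measurable fun ω => W ω j k) (n i : ℕ) :
    Measurable fun ω => M.psiHat μ (Om ω) t (q ω) (W ω) n ω i := by
  have hp := measurable_phat (M := M) n g
  have hA := measurable_meanAHat (M := M) hOm n
  have hδ := measurable_deltaHat hOm hq hW n
  refine (((((measurable_dY g t i).sub
    (measurable_sampleMean n fun j => measurable_dY g t j)).div hp).add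
    (measurable_dotProduct_apply
      (x := fun ω => (M.phat n ω g)⁻¹ • M.meanAHat (Om ω) n ω)
      (fun k => hp.inv.mul (hA k)) fun k => ?_).neg).add
    (measurable_dotProduct_apply
      (x := fun ω => (M.phat n ω g)⁻¹ • M.deltaHat μ (Om ω) t (q ω) (W ω) n ω)
      (y := fun ω => regA g (Om ω) (M.G i ω) (M.path i ω) - M.meanAHat (Om ω) n ω)
      (fun k => hp.inv.mul (hδ k)) fun k => (measurable_regA hOm i k).sub (hA k)).neg).add
    (((measurable_ATTHat hOm hq hW n).div hp).mul ((measurable_groupInd_G i g).sub hp)).neg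
  exact measurable_mulVec_apply (measurable_gmmHat hOm hq hW n)
    (x := fun ω => M.vHat μ (Om ω) t (q ω) (W ω) n ω i • M.ell μ (q ω) t (M.G i ω))
    (fun g' => (measurable_vHat hOm hq hW n i).mul (measurable_ell hq i g')) k

end Estimates

/-! ### The identified pairs -/

/-- `v` appears only multiplied by `ell`, which is supported on groups treated after `t`. There no
anticipation gives `Y = Y0` at `t`, and the regression residual at `δ*` is `v`. -/
theorem RegularPair.residPsi_ae_eq [IsProbabilityMeasure μ] {g t : ℕ}
    {Om : Matrix (Fin (g - 2)) (Fin R) ℝ}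
    {OmH : ℕ → Ω → Matrix (Fin (g - 2)) (Fin R) ℝ} {W : Matrix (M.comp μ t) (M.comp μ t) ℝ}
    {WH : ℕ → Ω → Matrix (M.comp μ t) (M.comp μ t) ℝ} {q : ℕ → Ω → ℕ∞ → ℝ}
    (h : RegularPair M μ g t Om OmH W WH q) :
    M.residPsi μ Om t W 0 =ᵐ[μ] M.psi μ Om t W 0 := by
  have h1 : ∀ᵐ ω ∂μ, ∀ g' : M.comp μ t, groupInd (M.G 0 ω) g' *
      ((M.Y 0 t ω - M.Y 0 (g - 1) ω) - regressor g Om (M.path 0 ω) ⬝ᵥ M.deltaStar Om t) =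
      groupInd (M.G 0 ω) g' * (M.Y 0 t ω - M.Y0 0 t ω) +
        groupInd (M.G 0 ω) g' * M.v Om t 0 ω := by
    refine ae_all_iff.2 fun g' => ae_groupInd_mul_sub_regressor h.anticipation h.ife h.two_le
      h.le_T h.le_t h.t_mem h.isUnit_Om ?_
    exact le_trans (by exact_mod_cast h.le_t) (lt_of_mem_comp g'.2).le
  filter_upwards [h1, h.anticipation 0 t h.t_mem] with ω hω hant
  have h2 : ((M.Y 0 t ω - M.Y 0 (g - 1) ω) - regressor g Om (M.path 0 ω) ⬝ᵥ M.deltaStar Om t) •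
      M.ell μ (M.p μ) t (M.G 0 ω) = M.v Om t 0 ω • M.ell μ (M.p μ) t (M.G 0 ω) := by
    ext g'
    have h3 := hω g'
    simp only [Pi.smul_apply, smul_eq_mul, ell]
    by_cases hG : M.G 0 ω = g'
    · rw [sub_eq_zero.2 (hant (by rw [hG]; exact lt_of_mem_comp g'.2)), mul_zero, zero_add] at h3
      rw [← mul_div_assoc, ← mul_div_assoc, mul_comm, h3, mul_comm]
    · simp [groupInd, hG]
  simp only [residPsi, obsPsi, psi, h2]

theorem isUnit_det_of_rank_eq {k : ℕ} {A : Matrix (Fin k) (Fin k) ℝ} (h : A.rank = k) :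
    IsUnit A.det :=
  (Matrix.isUnit_iff_isUnit_det A).1
    (Matrix.mulVec_injective_iff_isUnit.1 (mulVec_injective_of_rank_eq h))

theorem tendsto_probFilter_of_matrixTendstoInProb [IsProbabilityMeasure μ] {a b : Type*}
    {X : ℕ → Ω → Matrix a b ℝ} {X₀ : Matrix a b ℝ} (h : MatrixTendstoInProb μ X X₀) :
    Tendsto (fun p : ℕ × Ω => X p.1 p.2) (probFilter μ) (𝓝 X₀) :=
  tendsto_matrix_iff.2 fun j k =>
    (tendstoInMeasure_const_iff (X := fun n ω => X n ω j k)).1 (h j k)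

/-- The rank conditions make the square matrix `Om'ΔF^pre` invertible; combined with the loading
condition, this gives the injectivity of `Gam`. -/
theorem regularPair_of_mem_pairs [IsProbabilityMeasure μ]
    (h_anticipation : M.NoAnticipation μ) (h_sampling : M.IIDSampling μ)
    (h_ife : M.InteractiveFixedEffects μ) (h_errors : M.IdiosyncraticErrors μ)
    (h_unconfounded : M.Unconfounded μ)
    (h_factors : M.FactorRank μ) (h_loadings : M.LoadingRank μ)
    (h_moments : ∀ t ∈ Finset.Icc 1 T, MemLp (M.Y 0 t) 4 μ) {gt : ℕ × ℕ} (hgt : gt ∈ M.pairs μ)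
    {W : Matrix (M.comp μ gt.2) (M.comp μ gt.2) ℝ}
    {WH : ℕ → Ω → Matrix (M.comp μ gt.2) (M.comp μ gt.2) ℝ}
    (hW : W.PosDef) (hWH : MatrixTendstoInProb μ WH W)
    {Om : Matrix (Fin (gt.1 - 2)) (Fin R) ℝ} {OmH : ℕ → Ω → Matrix (Fin (gt.1 - 2)) (Fin R) ℝ}
    (hOm : (Omᵀ * M.dFpre gt.1).rank = (M.dFpre gt.1).rank)
    (hOmH : MatrixTendstoInProb μ OmH Om)
    {q : ℕ → Ω → ℕ∞ → ℝ} (hq : q = (fun _ _ => M.p μ) ∨ q = M.phat) :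
    RegularPair M μ gt.1 gt.2 Om OmH W WH q := by
  obtain ⟨h1, h2, h3, -, h5, -⟩ := Finset.mem_filter.1 hgt
  obtain ⟨hg, ht⟩ := Finset.mem_product.1 h1
  have hT := (Finset.mem_Icc.1 hg).2
  have hdet := isUnit_det_of_rank_eq (hOm.trans (h_factors gt hgt))
  refine ⟨h_anticipation, h_ife, h_errors, h_unconfounded, h_sampling.1, h_sampling.2, h_moments,
    by omega, hT, h5, ht, (Finset.mem_filter.1 h2).2, hdet, ?_, hW,
    tendsto_probFilter_of_matrixTendstoInProb hOmH, tendsto_probFilter_of_matrixTendstoInProb hWH,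
    fun γ => ?_⟩
  · exact mulVec_Gam_injective h_anticipation h_ife h_errors h_unconfounded h_moments h_loadings.1
      (h_loadings.2 gt hgt) hT h5 hdet
  · rcases hq with rfl | rfl
    · exact tendsto_const_nhds
    · rw [← integral_groupInd]
      exact (PlugIn.of_isFeature (isFeature_groupInd γ)).tendsto_sampleMean h_sampling.1
        h_sampling.2

end StaggeredPanel

/-! ### Stacking over the pairs and the two limit theorems. -/

/-- Finitely many features form a vector-valued function of the observations. -/
theorem exists_measurable_vector_of_isFeature {Ω O κ : Type*} [MeasurableSpace Ω]
    [MeasurableSpace O] [Fintype κ] {μ : Measure Ω} {X : ℕ → Ω → O} {U : κ → ℕ → Ω → ℝ}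
    (h : ∀ a, IsFeature μ X (U a)) :
    ∃ ψ : O → EuclideanSpace ℝ κ, Measurable ψ ∧ (∀ i ω a, ψ (X i ω) a = U a i ω) ∧
      MemLp (fun ω => ψ (X 0 ω)) 2 μ := by
  choose f hf hU using fun a => (h a).2
  refine ⟨fun o => WithLp.toLp 2 fun a => f a o, by fun_prop, fun i ω a => (hU a i ω).symm,
    MemLp.of_eval_piLp fun a => ?_⟩
  exact (h a).memLp.ae_eq (ae_of_all _ fun ω => hU a 0 ω)

theorem tendsto_euclideanSpace_iff {ι κ : Type*} [Fintype κ] {l : Filter ι}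
    {x : ι → EuclideanSpace ℝ κ} {x₀ : EuclideanSpace ℝ κ} :
    Tendsto x l (𝓝 x₀) ↔ ∀ a, Tendsto (fun i => x i a) l (𝓝 (x₀ a)) := by
  rw [← tendsto_pi_nhds]
  exact ((PiLp.homeomorph 2 fun _ : κ => ℝ).isInducing.tendsto_nhds_iff (f := x))

namespace StaggeredPanel

variable {Ω : Type*} [MeasurableSpace Ω] {μ : Measure Ω} [IsProbabilityMeasure μ] {T R : ℕ}
  {M : StaggeredPanel Ω T R}

/-- The estimator is asymptotically linear, with a centred influence function. -/
theorem RegularPair.asymptotically_linear {g t : ℕ} {Om : Matrix (Fin (g - 2)) (Fin R) ℝ}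
    {OmH : ℕ → Ω → Matrix (Fin (g - 2)) (Fin R) ℝ} {W : Matrix (M.comp μ t) (M.comp μ t) ℝ}
    {WH : ℕ → Ω → Matrix (M.comp μ t) (M.comp μ t) ℝ} {q : ℕ → Ω → ℕ∞ → ℝ}
    (h : RegularPair M μ g t Om OmH W WH q) :
    ∫ ω, M.residPsi μ Om t W 0 ω ∂μ = 0 ∧
    Tendsto (fun p : ℕ × Ω => √(p.1 : ℝ) *
      (M.ATTHat μ (OmH p.1 p.2) t (q p.1 p.2) (WH p.1 p.2) p.1 p.2 - M.ATT μ g t) -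
      (√(p.1 : ℝ))⁻¹ * ∑ i ∈ Finset.range p.1, M.residPsi μ Om t W i p.2) (probFilter μ) (𝓝 0) := by
  obtain ⟨V, m, hV, hm, hATT⟩ := h.exists_plugIn_ATTHat
  -- The means `m` converge to this integral and equal zero with probability tending to one, so
  -- uniqueness of limits gives centring without computing the integral.
  have h0 : ∫ ω, M.residPsi μ Om t W 0 ω ∂μ = 0 :=
    tendsto_nhds_unique hV.tendsto_mean
      ((tendsto_congr' hm).2 tendsto_const_nhds)
  refine ⟨h0, (hV.tendsto_sqrt_mul_sampleMean_sub h.indep h.ident).congr' ?_⟩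
  filter_upwards [hm, hATT, eventually_probFilter_ge 1] with p hm hATT hp
  have hp' : (0 : ℝ) < p.1 := by exact_mod_cast hp
  have hs : (√(p.1 : ℝ))⁻¹ = √(p.1 : ℝ) * (p.1 : ℝ)⁻¹ := by
    have := Real.sq_sqrt hp'.le
    have h0 : √(p.1 : ℝ) ≠ 0 := (Real.sqrt_pos.2 hp').ne'
    field_simp
    exact this.symm
  rw [hm, hATT, h0, hs]
  simp only [sampleMean]
  ring

end StaggeredPanel

theorem mainTheorem5 {Ω : Type*} [MeasurableSpace Ω] (μ : Measure Ω) [IsProbabilityMeasure μ]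
    {T R : ℕ} (M : StaggeredPanel Ω T R)
    (h_staggered : M.StaggeredAdoption μ) (h_initial : M.NoneTreatedInitially μ)
    (h_anticipation : M.NoAnticipation μ) (h_sampling : M.IIDSampling μ)
    (h_ife : M.InteractiveFixedEffects μ) (h_errors : M.IdiosyncraticErrors μ)
    (h_unconfounded : M.Unconfounded μ)
    (h_factors : M.FactorRank μ) (h_loadings : M.LoadingRank μ)
    -- fourth moments of the outcomes
    (h_moments : ∀ t ∈ Finset.Icc 1 T, MemLp (M.Y 0 t) 4 μ)
    -- the weighting matrices and their estimates
    (W : (g t : ℕ) → Matrix (M.comp μ t) (M.comp μ t) ℝ)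
    (WHat : (g t n : ℕ) → Ω → Matrix (M.comp μ t) (M.comp μ t) ℝ)
    (hW : ∀ gt ∈ M.pairs μ, (W gt.1 gt.2).PosDef)
    (hWHat_data : ∀ gt ∈ M.pairs μ, ∀ n j k,
      Measurable[M.data n] fun ω => WHat gt.1 gt.2 n ω j k)
    (hWHat : ∀ gt ∈ M.pairs μ, MatrixTendstoInProb μ (WHat gt.1 gt.2) (W gt.1 gt.2))
    -- the matrices that select or combine pre-treatment periods: known (`OmHat` constant) or
    -- consistently estimated
    (Om : (g t : ℕ) → Matrix (Fin (g - 2)) (Fin R) ℝ)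
    (OmHat : (g t n : ℕ) → Ω → Matrix (Fin (g - 2)) (Fin R) ℝ)
    (hOm : ∀ gt ∈ M.pairs μ, (Om gt.1 gt.2).rank = R ∧
      ((Om gt.1 gt.2)ᵀ * M.dFpre gt.1).rank = (M.dFpre gt.1).rank)
    (hOmHat_data : ∀ gt ∈ M.pairs μ, ∀ n j k,
      Measurable[M.data n] fun ω => OmHat gt.1 gt.2 n ω j k)
    (hOmHat : ∀ gt ∈ M.pairs μ, MatrixTendstoInProb μ (OmHat gt.1 gt.2) (Om gt.1 gt.2))
    -- the sample version of `ℓ^comp` uses either the population or the sample group shares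
    (q : ℕ → Ω → ℕ∞ → ℝ) (hq : q = (fun _ _ => M.p μ) ∨ q = M.phat)
    -- the bootstrap weights
    (ζ : ℕ → Ω → ℝ) (hζ_meas : ∀ i, Measurable (ζ i)) (hζ_indep : iIndepFun ζ μ)
    (hζ_ident : ∀ i, IdentDistrib (ζ i) (ζ 0) μ μ) (hζ_mean : ∫ ω, ζ 0 ω ∂μ = 0)
    (hζ_var : ∫ ω, ζ 0 ω ^ 2 ∂μ = 1) (hζ_third : MemLp (ζ 0) 3 μ)
    (hζ_data : IndepFun (fun ω i => ζ i ω) (fun ω i => M.obs i ω) μ) :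
    -- `E[ΨΨ']` is finite
    MemLp (M.Psi μ Om W 0) 2 μ ∧
    -- conditionally on the data, the bootstrap converges to `N(0, E[ΨΨ'])`
    TendstoInBootstrapDistribution μ M.data
      (fun n ω => √(n : ℝ) •
        (M.ATTBoot μ OmHat WHat q ζ n ω - M.ATTHatVec μ OmHat WHat q n ω))
      (multivariateGaussian 0 (M.PsiCov μ Om W)) ∧
    -- which is the limit distribution of the estimator
    TendstoInDistribution
      (fun (n : ℕ) ω => √(n : ℝ) • (M.ATTHatVec μ OmHat WHat q n ω - M.ATTVec μ))
      atTop id (fun _ => μ) (multivariateGaussian 0 (M.PsiCov μ Om W)) := by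
  have mobs := M.measurable_obs
  have hζL2 : MemLp (ζ 0) 2 μ := hζ_third.mono_exponent (by norm_num)
  have hreg : ∀ a : M.pairs μ, StaggeredPanel.RegularPair M μ a.1.1 a.1.2 (Om a.1.1 a.1.2) (OmHat a.1.1 a.1.2)
      (W a.1.1 a.1.2) (WHat a.1.1 a.1.2) q := fun a =>
    StaggeredPanel.regularPair_of_mem_pairs h_anticipation h_sampling h_ife h_errors h_unconfounded h_factors
      h_loadings h_moments a.2 (hW _ a.2) (hWHat _ a.2) (hOm _ a.2).2 (hOmHat _ a.2) hq
  have hplug := fun a => (hreg a).plugIn_psiHat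
  -- `ψ` is the observable version of the influence function, so its values across units inherit the
  -- iid property from the observations.
  obtain ⟨ψ, mψ, hψU, hψ⟩ := exists_measurable_vector_of_isFeature fun a =>
    (hplug a).choose_spec.isFeature
  -- Agreement for unit `0` is enough: the unobservable version enters the conclusion only through
  -- its moments.
  have hΨ : M.Psi μ Om W 0 =ᵐ[μ] fun ω => ψ (M.obs 0 ω) := by
    filter_upwards [ae_all_iff.2 fun a => (hreg a).residPsi_ae_eq] with ω hω
    ext a
    rw [hψU, hω a]
    rfl
  have hcov : M.PsiCov μ Om W =
      Matrix.of fun a b => ∫ ω, ψ (M.obs 0 ω) a * ψ (M.obs 0 ω) b ∂μ := by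
    ext a b
    exact integral_congr_ae (hΨ.mono fun ω hω => by simp only [hω])
  have hν := charFun_multivariateGaussian_secondMoment hψ
  rw [← hcov] at hν
  -- measurability of the estimates
  have hle : ∀ n, M.data n ≤ ‹MeasurableSpace Ω› := fun n =>
    (measurable_pi_lambda _ fun i : Fin n => mobs i).comap_le
  have mOm : ∀ (a : M.pairs μ) n j k, Measurable fun ω => OmHat a.1.1 a.1.2 n ω j k :=
    fun a n j k => (hOmHat_data _ a.2 n j k).mono (hle n) le_rfl
  have mW : ∀ (a : M.pairs μ) n j k, Measurable fun ω => WHat a.1.1 a.1.2 n ω j k :=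
    fun a n j k => (hWHat_data _ a.2 n j k).mono (hle n) le_rfl
  have mq : ∀ n γ, Measurable fun ω => q n ω γ := by
    intro n γ
    rcases hq with rfl | rfl
    · exact measurable_const
    · exact StaggeredPanel.measurable_phat n γ
  have mATT : ∀ n, Measurable (M.ATTHatVec μ OmHat WHat q n) := fun n =>
    (WithLp.measurable_toLp 2 _).comp (measurable_pi_lambda _ fun a =>
      StaggeredPanel.measurable_ATTHat (mOm a n) (mq n) (mW a n) n)
  have mPsi : ∀ n i, Measurable (M.PsiHat μ OmHat WHat q n i) := fun n i =>
    (WithLp.measurable_toLp 2 _).comp (measurable_pi_lambda _ fun a =>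
      StaggeredPanel.measurable_psiHat (mOm a n) (mq n) (mW a n) n i)
  have mBoot : ∀ n, Measurable (M.ATTBoot μ OmHat WHat q ζ n) := fun n =>
    (mATT n).add (Measurable.fun_const_smul
      (Finset.measurable_fun_sum _ fun i _ => (hζ_meas i).smul (mPsi n i)) _)
  refine ⟨hψ.ae_eq hΨ.symm, ?_, ?_⟩
  -- What remains is that estimated and true influence functions give asymptotically equivalent
  -- multiplier sums; this is checked one coordinate at a time by the plug-in bound.
  · refine tendstoInBootstrapDistribution_of_multiplier mobs h_sampling.1 h_sampling.2 hζ_meas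
      hζ_indep hζ_ident hζL2 hζ_mean hζ_var hζ_data mψ hψ hν
      (fun n => (((mBoot n).sub (mATT n)).fun_const_smul _).aemeasurable) ?_
    rw [tendstoInMeasure_const_iff (X := fun n ω => √(n : ℝ) •
        (M.ATTBoot μ OmHat WHat q ζ n ω - M.ATTHatVec μ OmHat WHat q n ω) -
        (√(n : ℝ))⁻¹ • ∑ i ∈ Finset.range n, ζ i ω • ψ (M.obs i ω)),
      tendsto_euclideanSpace_iff]
    intro a
    refine ((hplug a).choose_spec.tendsto_inv_sqrt_mul_sum_multiplier mobs h_sampling.1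
      h_sampling.2 hζ_meas hζ_indep hζ_ident hζL2 hζ_mean hζ_data).congr' ?_
    filter_upwards [eventually_probFilter_ge 1] with p hp
    have hp' : (0 : ℝ) < p.1 := by exact_mod_cast hp
    have hs : (√(p.1 : ℝ))⁻¹ = √(p.1 : ℝ) * (p.1 : ℝ)⁻¹ := by
      have := Real.sq_sqrt hp'.le
      have h0 : √(p.1 : ℝ) ≠ 0 := (Real.sqrt_pos.2 hp').ne'
      field_simp
      exact this.symm
    simp only [StaggeredPanel.ATTBoot, add_sub_cancel_left, smul_smul, ← hs, ← smul_sub, ← Finset.sum_sub_distrib,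
      PiLp.smul_apply, WithLp.ofLp_sum, Finset.sum_apply, PiLp.sub_apply, hψU, smul_eq_mul]
    rfl
  -- The central limit theorem for `ψ` is combined with asymptotic linearity in each coordinate.
  · have hψX : iIndepFun (fun i ω => ψ (M.obs i ω)) μ :=
      h_sampling.1.comp (fun _ => ψ) fun _ => mψ
    have hclt := tendstoInDistribution_inv_sqrt_smul_sum hψX
      (fun i => (h_sampling.2 i).comp mψ) hψ (fun x => ?_) hν
    · refine tendstoInDistribution_of_tendstoInMeasure_sub _ _ hclt ?_
        fun n => (((mATT n).sub measurable_const).fun_const_smul _).aemeasurable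
      refine (tendstoInMeasure_const_iff (X := fun n ω => √(n : ℝ) •
        (M.ATTHatVec μ OmHat WHat q n ω - M.ATTVec μ) -
        (√(n : ℝ))⁻¹ • ∑ i ∈ Finset.range n, ψ (M.obs i ω)) (c := 0)).2
        (tendsto_euclideanSpace_iff.2 fun a => ?_)
      refine (hreg a).asymptotically_linear.2.congr fun p => ?_
      simp only [PiLp.smul_apply, WithLp.ofLp_sum, Finset.sum_apply, PiLp.sub_apply, hψU,
        smul_eq_mul]
      rfl
    · have hint : ∀ a, Integrable (fun ω => ψ (M.obs 0 ω) a) μ := fun a =>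
        (hψ.eval_piLp a).integrable (by norm_num)
      simp only [PiLp.inner_apply, RCLike.inner_apply, conj_trivial]
      rw [integral_finsetSum _ fun a _ => (hint a).const_mul _]
      refine Finset.sum_eq_zero fun a _ => ?_
      rw [integral_const_mul]
      simp only [hψU]
      rw [(hreg a).asymptotically_linear.1, mul_zero]
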